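/- Let $d\ge 1$, $a,b>0$, $\Lambda=a\mathbb Z^d\times b\mathbb Z^d$ and $Q=[-\tfrac1{2a},\tfrac1{2a}]^d\times[-\tfrac1{2b},\tfrac1{2b}]^d\subseteq\mathbb R^{2d}$. Use the Fourier transform $\hat f(\xi)=\int f(x)e^{-2\pi i x\cdot\xi}\,dx$ (extended to tempered distributions), $T_\lambda f(z)=f(z-\lambda)$, $\pi(x,\xi)f(t)=e^{2\pi i\xi\cdot t}f(t-x)$, the short-time Fourier transform $V_gf(z)=\langle f,\pi(z)g\rangle$, the coordinate change $\mathcal UF(\xi,x)=F(-x,\xi)$, and the Rihaczek distribution $R(f,h)(x,\xi)=f(x)\overline{\hat h(\xi)}e^{-2\pi i x\cdot\xi}$. The Kohn–Nirenberg operator $\sigma^{KN}$ is given by $\langle\sigma^{KN}f,h\rangle=\langle\sigma,R(h,f)\rangle=\int_{\mathbb R^{2d}}\sigma\,\overline{R(h,f)}$. Let $$\operatorname{sinc}(z)=\prod_{j=1}^{d}\frac{\sin(\pi z_j/a)}{\pi z_j/a}\prod_{j=d+1}^{2d}\frac{\sin(\pi z_j/b)}{\pi z_j/b}.$$ Let $g\in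 L^1(\mathbb R^d)$ with $\hat g\in L^1(\mathbb R^d)$, let $\varphi\in C_c^\infty(\mathbb R^{2d})$ with $\varphi=1$ on $Q$, assume that $\overline{\mathcal UV_gg}$ does not vanish on $\operatorname{supp}\varphi$, and set $K=\mathcal F^{-1}\bigl(\varphi/\overline{\mathcal UV_gg}\bigr)$. Then $\varphi/\overline{\mathcal UV_gg}$ is integrable and $\operatorname{sinc}*K$ is defined everywhere by an absolutely convergent integral. Moreover: 1. Let $1\le p<\infty$ and $\sigma\in L^p(\mathbb R^{2d})$ with $\operatorname{supp}\hat\sigma\subseteq Q$. Then the integrals defining $H_{\lambda\mu}=\langle\sigma^{KN}\pi(\mu)g,\pi(\lambda)g\rangle$, $\lambda,\mu\in\Lambda$, converge absolutely, and $$\sigma=\sum_{\lambda\in\Lambda}H_{\lambda\lambda}\,T_\lambda(\operatorname{sinc}*K),$$ where the series converges absolutely at every point, and (unconditionally) uniformly on $\mathbb R^{2d}$, to the continuous representative of $\sigma$. If $1<p<\infty$, it also converges (unconditionally) to $\sigma$ in $L^p(\mathbb R^{2d})$. 2. If $p=1$, the series converges (unconditionally) to $\sigma$ in $L^q(\mathbb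 R^{2d})$ for every $1<q\le\infty$; but if infinitely many $H_{\lambda\lambda}$ are nonzero, then for no enumeration of $\Lambda$ do the partial sums converge to $\sigma$ in $L^1(\mathbb R^{2d})$. 3. For all $g$ and $\varphi$ as above there is $\sigma\in L^1(\mathbb R^{2d})$ with $\operatorname{supp}\hat\sigma\subseteq Q$ for which the series does not converge to $\sigma$ in $L^1(\mathbb R^{2d})$ for any enumeration of $\Lambda$. -/

import Mathlib

open MeasureTheory Filter Topology
open scoped ENNReal FourierTransform SchwartzMap ComplexConjugate ContDiff

noncomputable section

namespace KohnNirenberg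

/-- The configuration space `ℝ^d` with its Euclidean structure and Lebesgue measure. -/
abbrev Config (d : ℕ) := EuclideanSpace ℝ (Fin d)

/-- The time-frequency plane `ℝ^{2d}`; the left summand indexes the first `d` coordinates and the
right summand the last `d` coordinates. -/
abbrev Phase (d : ℕ) := EuclideanSpace ℝ (Fin d ⊕ Fin d)

variable {d : ℕ}

/-- The first `d` coordinates of `z ∈ ℝ^{2d}`. -/
def fstPart (z : Phase d) : Config d := WithLp.toLp 2 fun i => z (Sum.inl i)

/-- The last `d` coordinates of `z ∈ ℝ^{2d}`. -/
def sndPart (z : Phase d) : Config d := WithLp.toLp 2 fun i => z (Sum.inr i)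

/-- The point `(x, ξ) ∈ ℝ^{2d}`. -/
def pair (x ξ : Config d) : Phase d := WithLp.toLp 2 (Sum.elim (fun i => x i) fun i => ξ i)

/-- The character `e^{2 π i x · y}`. -/
def character (x y : Config d) : ℂ := Complex.exp (2 * Real.pi * Complex.I * (inner ℝ x y : ℝ))

/-- The time-frequency shift `π(z) f(t) = e^{2 π i ξ · t} f(t - x)`, `z = (x, ξ)`. -/
def tfShift (z : Phase d) (f : Config d → ℂ) (t : Config d) : ℂ :=
  character (sndPart z) t * f (t - fstPart z)

/-- The short-time Fourier transform `V_g f(x, ξ) = ∫ f(t) conj(g(t - x)) e^{-2 π i ξ · t} dt`,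
that is, `⟨f, π(z) g⟩` with `z = (x, ξ)`. -/
def stft (g f : Config d → ℂ) (z : Phase d) : ℂ :=
  ∫ t, f t * conj (g (t - fstPart z)) * character (-sndPart z) t

/-- The coordinate change `U F(ξ, x) = F(-x, ξ)`. -/
def swapU (F : Phase d → ℂ) (w : Phase d) : ℂ := F (pair (-sndPart w) (fstPart w))

/-- The Rihaczek distribution `R(f, h)(x, ξ) = f(x) conj(ĥ(ξ)) e^{-2 π i x · ξ}`. -/
def rihaczek (f h : Config d → ℂ) (z : Phase d) : ℂ :=
  f (fstPart z) * conj (𝓕 h (sndPart z)) * character (-fstPart z) (sndPart z)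

/-- The form `⟨σ^{KN} f, h⟩ = ⟨σ, R(h, f)⟩` of the Kohn-Nirenberg pseudodifferential operator
with symbol `σ`. -/
def knForm (σ : Phase d → ℂ) (f h : Config d → ℂ) : ℂ :=
  ∫ z, σ z * conj (rihaczek h f z)

/-- Indices `(k, l) ∈ ℤ^d × ℤ^d` of the points of the lattice `a ℤ^d × b ℤ^d`. -/
abbrev Index (d : ℕ) := (Fin d → ℤ) × (Fin d → ℤ)

/-- The point `(a k, b l)` of the lattice `Λ = a ℤ^d × b ℤ^d`. -/
def latticePoint (a b : ℝ) (m : Index d) : Phase d :=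
  pair (WithLp.toLp 2 fun i => a * (m.1 i : ℝ)) (WithLp.toLp 2 fun i => b * (m.2 i : ℝ))

/-- The channel matrix `H_{λ μ} = ⟨σ^{KN} π(μ) g, π(λ) g⟩`, `λ, μ ∈ Λ`. -/
def channelMatrix (a b : ℝ) (g : Config d → ℂ) (σ : Phase d → ℂ) (l m : Index d) : ℂ :=
  knForm σ (tfShift (latticePoint a b m) g) (tfShift (latticePoint a b l) g)

/-- The box `Q = [-1/(2a), 1/(2a)]^d × [-1/(2b), 1/(2b)]^d`. -/
def box (a b : ℝ) : Set (Phase d) :=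
  {w | (∀ i : Fin d, |w (Sum.inl i)| ≤ 1 / (2 * a)) ∧ ∀ i : Fin d, |w (Sum.inr i)| ≤ 1 / (2 * b)}

/-- The cardinal sine of the lattice `a ℤ^d × b ℤ^d`: the product of the functions
`sin (π x_j / a) / (π x_j / a)`, `j ≤ d`, and `sin (π x_j / b) / (π x_j / b)`, `j > d`. It is `1`
at the origin and `0` at every other lattice point. -/
def latticeSinc (a b : ℝ) (z : Phase d) : ℂ :=
  (((∏ i : Fin d, Real.sinc (Real.pi * z (Sum.inl i) / a)) *
    ∏ i : Fin d, Real.sinc (Real.pi * z (Sum.inr i) / b) : ℝ) : ℂ)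

/-- The quotient `φ / conj(U V_g g)`. -/
def quotientSymbol (g : Config d → ℂ) (φ : Phase d → ℂ) (w : Phase d) : ℂ :=
  φ w / conj (swapU (stft g g) w)

/-- The kernel `K = 𝓕⁻¹ (φ / conj(U V_g g))`. -/
def kernelK (g : Config d → ℂ) (φ : Phase d → ℂ) : Phase d → ℂ := 𝓕⁻ (quotientSymbol g φ)

/-- The convolution `sinc ∗ K`. -/
def sincConvK (a b : ℝ) (g : Config d → ℂ) (φ : Phase d → ℂ) : Phase d → ℂ :=
  convolution (latticeSinc a b) (kernelK g φ) (ContinuousLinearMap.mul ℂ ℂ) volume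

/-- The term `H_{λ λ} T_λ (sinc ∗ K)` of the modified cardinal series. -/
def seriesTerm (a b : ℝ) (g : Config d → ℂ) (φ : Phase d → ℂ) (σ : Phase d → ℂ)
    (l : Index d) (z : Phase d) : ℂ :=
  channelMatrix a b g σ l l * sincConvK a b g φ (z - latticePoint a b l)

/-- Unconditional convergence of the series `∑ u i` to `f` in `L^q`. -/
def SeriesConvergesInLp {ι : Type*} (q : ℝ≥0∞) (u : ι → Phase d → ℂ) (f : Phase d → ℂ) : Prop :=
  (∀ i, MemLp (u i) q volume) ∧
    Tendsto (fun s : Finset ι => eLpNorm (fun z => ∑ i ∈ s, u i z - f z) q volume) atTop (𝓝 0)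

/-- For some ordering of the index set into a sequence, the partial sums of `∑ u i` converge to `f`
in the norm of `L^q`. This is weaker than `SeriesConvergesInLp` when `ι` is countably infinite. -/
def SomeOrderingConvergesInLp {ι : Type*} (q : ℝ≥0∞) (u : ι → Phase d → ℂ)
    (f : Phase d → ℂ) : Prop :=
  ∃ e : ℕ ≃ ι,
    Tendsto (fun N : ℕ => eLpNorm (fun z => ∑ n ∈ Finset.range N, u (e n) z - f z) q volume)
      atTop (𝓝 0)

end KohnNirenberg

end

open KohnNirenberg

/-! The diagonal of the channel matrix sees the symbol only through a convolution. By covariance,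
R(π(λ)g, π(λ)g) = T_λ R(g, g), so H_λλ = (σ ∗ ρ)(λ) with ρ(z) = conj R(g, g)(-z), and ρ̂ = conj(U
V_g g). Hence F = σ ∗ ρ again has spectrum in Q, and the H_λλ are its samples on the lattice for
which Q is the critical box. The cardinal series rebuilds F from these samples, and convolution with
K undoes ρ because ρ̂ K̂ = φ equals 1 on Q. Convolving the cardinal series with K term by term gives
the formula (`exists_representative_hasSum`).

For this K has to be integrable. This is a local form of Wiener's lemma (`isFourierL1_div`): near
each point ρ̂ is a nonzero constant times 1 + k̂ with ‖k‖₁ < 1, so a Neumann series inverts it, and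
a partition of unity glues the pieces.

The hypothesis on the spectrum is distributional and concerns a closed box. Since the box is
star-shaped about an interior point, it still gives σ = σ ∗ Φ for every Schwartz Φ with Φ̂ = 1 on Q
only (`ae_eq_integral_mul_schwartz_sub`). This yields a bounded continuous representative, in L^r
for every r ≥ max(p, 1). The sampling theorem at the critical rate is Parseval on a cube for
integrable functions. For F in L^r, 1 < r < ∞, one dilates slightly and multiplies by a rapidly
decreasing factor, then passes to the limit, using that the samples stay bounded in ℓ^r
(Plancherel-Pólya) while the translates of sinc lie in ℓ^{r'}. The same Hölder pairing gives
absolute and uniform convergence.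

Convergence in L^r amounts to boundedness of c ↦ ∑ c_k sinc(· - k) from ℓ^r to L^r. Pulling sin(πx)
out of the sum turns this into the discrete Hilbert transform, which is bounded by M. Riesz' contour
argument for 1 < r ≤ 2 and by duality for r > 2. Several variables follow by iterating the
one-dimensional bound.

In L¹ the obstruction is that sinc ∗ K has Fourier transform c 1_Q K̂, which jumps at the boundary
of Q; so no nonzero term is integrable, whereas the terms of an L¹-convergent series eventually are.
For a symbol whose spectrum lies in the half-size box the series cannot be finite either: a
trigonometric polynomial would vanish on an open set, hence everywhere. -/

namespace KohnNirenberg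

/-! ### Fourier inversion and uniqueness for integrable functions. -/

section FourierBasics

variable {V : Type*} [NormedAddCommGroup V] [InnerProductSpace ℝ V] [FiniteDimensional ℝ V]
  [MeasurableSpace V] [BorelSpace V]

theorem continuous_fourier {f : V → ℂ} (hf : Integrable f) : Continuous (𝓕 f) :=
  VectorFourier.fourierIntegral_continuous Real.continuous_fourierChar
    (innerSL ℝ).continuous₂ hf

theorem continuous_fourierInv {f : V → ℂ} (hf : Integrable f) : Continuous (𝓕⁻ f) := by
  have : 𝓕⁻ f = fun w => 𝓕 f (-w) := funext fun w => Real.fourierInv_eq_fourier_neg f w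
  rw [this]
  exact (continuous_fourier hf).comp continuous_neg

theorem norm_fourier_le (f : V → ℂ) (w : V) : ‖𝓕 f w‖ ≤ ∫ v, ‖f v‖ :=
  VectorFourier.norm_fourierIntegral_le_integral_norm _ _ _ _ _

theorem integral_fourier_mul_eq {f g : V → ℂ} (hf : Integrable f) (hg : Integrable g) :
    ∫ w, 𝓕 f w * g w = ∫ w, f w * 𝓕 g w := by
  have := VectorFourier.integral_fourierIntegral_smul_eq_flip (μ := volume) (ν := volume)
    (L := innerₗ V) (e := Real.fourierChar) Real.continuous_fourierChar
    (innerSL ℝ).continuous₂ hf hg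
  simp only [smul_eq_mul, flip_innerₗ] at this
  exact this

theorem integral_fourierInv_mul_eq {f g : V → ℂ} (hf : Integrable f) (hg : Integrable g) :
    ∫ w, 𝓕⁻ f w * g w = ∫ w, f w * 𝓕⁻ g w := by
  rw [Real.fourierInv_eq_fourier_comp_neg]
  rw [integral_fourier_mul_eq hf.comp_neg hg, ← integral_neg_eq_self]
  simp [Real.fourierInv_eq_fourier_neg]

theorem ae_eq_of_schwartz_integral {f g : V → ℂ} (hf : LocallyIntegrable f)
    (hg : LocallyIntegrable g) (h : ∀ ψ : 𝓢(V, ℂ), ∫ x, f x * ψ x = ∫ x, g x * ψ x) :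
    f =ᵐ[volume] g := by
  refine ae_eq_of_integral_contDiff_smul_eq hf hg fun u hu hc => ?_
  have hg₁ : HasCompactSupport (Complex.ofRealCLM ∘ u) := hc.comp_left rfl
  have hg₂ : ContDiff ℝ ∞ (Complex.ofRealCLM ∘ u) := by fun_prop
  have := h (hg₁.toSchwartzMap hg₂)
  simpa [mul_comm] using this

/-- Continuity of f is not assumed: the identity is tested against Schwartz functions, and the
multiplication formula moves both transforms onto the test function, where they cancel. -/
theorem fourierInv_fourier_ae {f : V → ℂ} (hf : Integrable f) (hf' : Integrable (𝓕 f)) :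
    𝓕⁻ (𝓕 f) =ᵐ[volume] f := by
  refine ae_eq_of_schwartz_integral (continuous_fourierInv hf').locallyIntegrable
    hf.locallyIntegrable fun ψ => ?_
  rw [integral_fourierInv_mul_eq hf' ψ.integrable]
  have h1 : 𝓕⁻ (ψ : V → ℂ) = ((𝓕⁻ ψ : 𝓢(V, ℂ)) : V → ℂ) := (SchwartzMap.fourierInv_coe ψ).symm
  rw [h1, integral_fourier_mul_eq hf (𝓕⁻ ψ).integrable, ← SchwartzMap.fourier_coe]
  simp

theorem fourier_fourierInv_ae {f : V → ℂ} (hf : Integrable f) (hf' : Integrable (𝓕⁻ f)) :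
    𝓕 (𝓕⁻ f) =ᵐ[volume] f := by
  rw [Real.fourierInv_eq_fourier_comp_neg] at hf'
  have h := fourierInv_fourier_ae hf.comp_neg hf'
  have h2 : 𝓕 (𝓕⁻ f) = fun w => 𝓕⁻ (𝓕 (fun x => f (-x))) (-w) := by
    funext w
    rw [Real.fourierInv_eq_fourier_comp_neg, Real.fourierInv_eq_fourier_neg, neg_neg]
  rw [h2]
  have := (Measure.measurePreserving_neg (volume : Measure V)).quasiMeasurePreserving.ae_eq_comp h
  filter_upwards [this] with w hw
  simpa using hw

/-- Every Schwartz test function is itself a Fourier transform, so the multiplication formula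
reduces the pairings with f and g to pairings with their transforms. -/
theorem ae_eq_of_fourier_eq {f g : V → ℂ} (hf : Integrable f) (hg : Integrable g)
    (h : 𝓕 f = 𝓕 g) : f =ᵐ[volume] g := by
  refine ae_eq_of_schwartz_integral hf.locallyIntegrable hg.locallyIntegrable fun ψ => ?_
  have h1 : (ψ : V → ℂ) = 𝓕 ((𝓕⁻ ψ : 𝓢(V, ℂ)) : V → ℂ) := by
    rw [← SchwartzMap.fourier_coe]; simp
  rw [h1, ← integral_fourier_mul_eq hf (𝓕⁻ ψ).integrable,
    ← integral_fourier_mul_eq hg (𝓕⁻ ψ).integrable, h]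

theorem integrable_fourierChar_smul {f : V → ℂ} (hf : Integrable f) (w : V) :
    Integrable fun v => 𝐞 (-inner ℝ v w) • f v :=
  (Real.fourierIntegral_convergent_iff w).2 hf

theorem fourier_add' {f g : V → ℂ} (hf : Integrable f) (hg : Integrable g) :
    𝓕 (fun x => f x + g x) = fun w => 𝓕 f w + 𝓕 g w := by
  funext w
  simp only [Real.fourier_eq, smul_add]
  exact integral_add (integrable_fourierChar_smul hf w) (integrable_fourierChar_smul hg w)

theorem fourier_const_mul' (c : ℂ) (f : V → ℂ) :
    𝓕 (fun x => c * f x) = fun w => c * 𝓕 f w := by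
  funext w
  simp only [Real.fourier_eq]
  rw [← integral_const_mul]
  refine integral_congr_ae (ae_of_all _ fun v => ?_)
  simp only [Circle.smul_def, smul_eq_mul]
  ring

theorem fourier_convolution {f g : V → ℂ} (hf : Integrable f) (hg : Integrable g) (w : V) :
    𝓕 (convolution f g (ContinuousLinearMap.mul ℂ ℂ) volume) w = 𝓕 f w * 𝓕 g w :=
  Real.fourier_mul_convolution_eq hf hg w

theorem integrable_convolution {f g : V → ℂ} (hf : Integrable f) (hg : Integrable g) :
    Integrable (convolution f g (ContinuousLinearMap.mul ℂ ℂ) volume) :=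
  hf.integrable_convolution _ hg

/-- A smooth compactly supported function, as the Fourier transform of a Schwartz function. -/
theorem exists_schwartz_fourier_eq {φ : V → ℂ} (hφ : ContDiff ℝ ∞ φ) (hc : HasCompactSupport φ) :
    ∃ Φ : 𝓢(V, ℂ), 𝓕 (Φ : V → ℂ) = φ := by
  refine ⟨𝓕⁻ (hc.toSchwartzMap hφ), ?_⟩
  rw [← SchwartzMap.fourier_coe]
  simp only [FourierTransform.fourier_fourierInv_eq]
  rfl

theorem integrable_tsum_of_summable_integral_norm {α : Type*} [MeasurableSpace α] {μ : Measure α}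
    {h : ℕ → α → ℂ} (hint : ∀ n, Integrable (h n) μ)
    (hsum : Summable fun n => ∫ x, ‖h n x‖ ∂μ) : Integrable (fun x => ∑' n, h n x) μ := by
  have hfin : ∫⁻ x, ∑' n, ‖h n x‖ₑ ∂μ < ⊤ := by
    rw [lintegral_tsum fun n => (hint n).aestronglyMeasurable.enorm]
    have : ∀ n, ∫⁻ x, ‖h n x‖ₑ ∂μ = ENNReal.ofReal (∫ x, ‖h n x‖ ∂μ) := fun n =>
      (ofReal_integral_norm_eq_lintegral_enorm (hint n)).symm
    simp only [this]
    exact hsum.tsum_ofReal_lt_top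
  have hae : ∀ᵐ x ∂μ, Summable fun n => h n x := by
    have := ae_lt_top' (AEMeasurable.tsum fun n =>
      (hint n).aestronglyMeasurable.enorm) hfin.ne
    filter_upwards [this] with x hx
    refine Summable.of_norm ?_
    have h2 : ∑' n, ((‖h n x‖₊ : NNReal) : ℝ≥0∞) ≠ ⊤ := hx.ne
    have h3 := ENNReal.tsum_coe_ne_top_iff_summable.1 h2
    exact NNReal.summable_coe.2 h3
  refine ⟨?_, ?_⟩
  · refine aestronglyMeasurable_of_tendsto_ae atTop
      (f := fun N x => ∑ n ∈ Finset.range N, h n x)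
      (fun N => Finset.aestronglyMeasurable_fun_sum _ fun n _ => (hint n).aestronglyMeasurable) ?_
    filter_upwards [hae] with x hx
    exact hx.hasSum.tendsto_sum_nat
  · refine lt_of_le_of_lt (lintegral_mono fun x => ?_) hfin
    exact enorm_tsum_le_tsum_enorm

end FourierBasics


/-! ### Wiener's lemma in the Fourier algebra. -/

section Wiener

set_option linter.unusedSectionVars false

variable {V : Type*} [NormedAddCommGroup V] [InnerProductSpace ℝ V] [FiniteDimensional ℝ V]
  [MeasurableSpace V] [BorelSpace V]

theorem one_add_norm_le_mul (x v : V) : 1 + ‖x‖ ≤ (1 + ‖x - v‖) * (1 + ‖v‖) := by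
  have : ‖x‖ ≤ ‖x - v‖ + ‖v‖ := by simpa using norm_add_le (x - v) v
  nlinarith [norm_nonneg (x - v), norm_nonneg v]

theorem exists_schwartz_decay (f : 𝓢(V, ℂ)) (N : ℕ) :
    ∃ C : ℝ, 0 < C ∧ ∀ x, ‖f x‖ ≤ C * (1 + ‖x‖) ^ (-(N : ℝ)) := by
  refine ⟨2 ^ N * (Finset.Iic (N, 0)).sup (fun m => SchwartzMap.seminorm ℝ m.1 m.2) f + 1,
    ?_, fun x => ?_⟩
  · positivity
  · have h := SchwartzMap.one_add_le_sup_seminorm_apply (𝕜 := ℝ) (m := (N, 0)) (k := N) (n := 0)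
      le_rfl le_rfl f x
    rw [norm_iteratedFDeriv_zero] at h
    have hp : (0 : ℝ) < (1 + ‖x‖) ^ N := by positivity
    rw [Real.rpow_neg (by positivity), Real.rpow_natCast, ← div_eq_mul_inv, le_div_iff₀ hp]
    linarith

theorem exists_schwartz_decay_shift (f : 𝓢(V, ℂ)) (N : ℕ) :
    ∃ C : ℝ, 0 < C ∧ ∀ x v, ‖f (x - v)‖ ≤ C * (1 + ‖x‖) ^ (-(N : ℝ)) * (1 + ‖v‖) ^ N := by
  obtain ⟨C, hC, h⟩ := exists_schwartz_decay f N
  refine ⟨C, hC, fun x v => (h (x - v)).trans ?_⟩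
  have h1 : (0 : ℝ) < (1 + ‖x‖) ^ N := by positivity
  have h2 : (0 : ℝ) < (1 + ‖x - v‖) ^ N := by positivity
  rw [Real.rpow_neg (by positivity), Real.rpow_neg (by positivity), Real.rpow_natCast,
    Real.rpow_natCast, mul_assoc]
  gcongr
  rw [inv_le_iff_one_le_mul₀ h2, mul_assoc, ← div_eq_inv_mul, one_le_div₀ h1, ← mul_pow]
  have := one_add_norm_le_mul x v
  rw [mul_comm]
  gcongr

theorem integrable_decay : Integrable fun x : V =>
    (1 + ‖x‖) ^ (-((Module.finrank ℝ V + 1 : ℕ) : ℝ)) :=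
  integrable_one_add_norm (by push_cast; linarith)

theorem tendsto_integral_translate_sub (β : 𝓢(V, ℂ)) :
    Tendsto (fun v => ∫ x, ‖β (x - v) - β x‖) (𝓝 0) (𝓝 0) := by
  obtain ⟨C, hC, h⟩ := exists_schwartz_decay_shift β (Module.finrank ℝ V + 1)
  have h0 : (0 : ℝ) = ∫ x : V, ‖β (x - 0) - β x‖ := by simp
  rw [h0]
  refine tendsto_integral_filter_of_dominated_convergence
    (fun x => C * (1 + ‖x‖) ^ (-((Module.finrank ℝ V + 1 : ℕ) : ℝ)) *
      2 ^ (Module.finrank ℝ V + 1) + C * (1 + ‖x‖) ^ (-((Module.finrank ℝ V + 1 : ℕ) : ℝ)) *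
      2 ^ (Module.finrank ℝ V + 1)) ?_ ?_ ?_ ?_
  · refine Eventually.of_forall fun v => Continuous.aestronglyMeasurable ?_
    have := β.continuous
    fun_prop
  · filter_upwards [Metric.ball_mem_nhds (0 : V) one_pos] with v hv
    refine ae_of_all _ fun x => ?_
    have hv' : ‖v‖ < 1 := by simpa using hv
    rw [norm_norm]
    refine (norm_sub_le _ _).trans (add_le_add ((h x v).trans ?_) ?_)
    · gcongr; linarith
    · have := h x 0
      rw [sub_zero] at this
      refine this.trans ?_
      gcongr; simp
  · exact (((integrable_decay (V := V)).const_mul C).mul_const _).add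
      (((integrable_decay (V := V)).const_mul C).mul_const _)
  · refine ae_of_all _ fun x => ?_
    have hc : Continuous fun v => ‖β (x - v) - β x‖ := by
      have := β.continuous
      fun_prop
    simpa using hc.tendsto 0

/-- Membership in the Fourier algebra: `F` is the Fourier transform of an integrable function. -/
def IsFourierL1 (F : V → ℂ) : Prop := ∃ h : V → ℂ, Integrable h ∧ 𝓕 h = F

theorem IsFourierL1.add {F G : V → ℂ} (hF : IsFourierL1 F) (hG : IsFourierL1 G) :
    IsFourierL1 fun w => F w + G w := by
  obtain ⟨f, hf, rfl⟩ := hF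
  obtain ⟨g, hg, rfl⟩ := hG
  exact ⟨_, hf.add hg, fourier_add' hf hg⟩

theorem IsFourierL1.sum {ι : Type*} {F : ι → V → ℂ} (s : Finset ι)
    (hF : ∀ i ∈ s, IsFourierL1 (F i)) : IsFourierL1 fun w => ∑ i ∈ s, F i w := by
  classical
  induction s using Finset.induction_on with
  | empty =>
    refine ⟨fun _ => 0, integrable_zero _ _ _, ?_⟩
    funext w
    simp [Real.fourier_eq]
  | insert i s hi ih =>
    simp only [Finset.sum_insert hi]
    exact (hF i (by simp)).add (ih fun j hj => hF j (by simp [hj]))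

theorem fourier_modulate (f : V → ℂ) (w₀ w : V) :
    𝓕 (fun x => ((𝐞 (inner ℝ x w₀) : Circle) : ℂ) * f x) w = 𝓕 f (w - w₀) := by
  simp only [Real.fourier_eq]
  refine integral_congr_ae (ae_of_all _ fun v => ?_)
  simp only [Circle.smul_def, smul_eq_mul]
  rw [← mul_assoc, ← Circle.coe_mul, ← AddChar.map_add_eq_mul, inner_sub_right]
  congr 4
  ring

theorem integrable_modulate {f : V → ℂ} (hf : Integrable f) (w₀ : V) :
    Integrable fun x => ((𝐞 (inner ℝ x w₀) : Circle) : ℂ) * f x := by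
  have := integrable_fourierChar_smul hf (-w₀)
  simpa [Circle.smul_def] using this

theorem IsFourierL1.comp_sub {F : V → ℂ} (hF : IsFourierL1 F) (w₀ : V) :
    IsFourierL1 fun w => F (w - w₀) := by
  obtain ⟨f, hf, rfl⟩ := hF
  exact ⟨_, integrable_modulate hf w₀, funext fun w => fourier_modulate f w₀ w⟩

/-- The Neumann series in the convolution algebra `L¹`. -/
theorem exists_fourier_mul_one_add_eq {k Ψ : V → ℂ} (hk : Integrable k) (hΨ : Integrable Ψ)
    (hk1 : ∫ x, ‖k x‖ < 1) :
    ∃ H : V → ℂ, Integrable H ∧ ∀ w, 𝓕 H w * (1 + 𝓕 k w) = 𝓕 Ψ w := by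
  set q := ∫ x, ‖k x‖ with hq
  have hq0 : 0 ≤ q := integral_nonneg fun _ => norm_nonneg _
  -- The n-th term is the n-fold convolution power of -k applied to Ψ. Starting from Ψ replaces the
  -- unit, which L¹ does not have.
  let h : ℕ → V → ℂ := fun n => Nat.rec Ψ
    (fun _ g => convolution (fun x => -k x) g (ContinuousLinearMap.mul ℂ ℂ) volume) n
  have hint : ∀ n, Integrable (h n) := by
    intro n
    induction n with
    | zero => exact hΨ
    | succ n ih => exact integrable_convolution hk.neg ih
  have hnorm : ∀ n, ∫ x, ‖h n x‖ ≤ q ^ n * ∫ x, ‖Ψ x‖ := by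
    intro n
    induction n with
    | zero => simp [h]
    | succ n ih =>
      have h1 : ∫ x, ‖h (n + 1) x‖ ≤ ∫ x, convolution (fun x => ‖k x‖) (fun x => ‖h n x‖)
          (ContinuousLinearMap.mul ℝ ℝ) volume x := by
        refine integral_mono (hint (n + 1)).norm
          (hk.norm.integrable_convolution _ (hint n).norm) fun x => ?_
        refine (norm_integral_le_integral_norm _).trans (le_of_eq ?_)
        refine integral_congr_ae (ae_of_all _ fun t => ?_)
        simp [h]
      rw [integral_convolution _ hk.norm (hint n).norm] at h1
      refine h1.trans ?_
      simp only [ContinuousLinearMap.mul_apply', ← hq]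
      rw [pow_succ', mul_assoc]
      gcongr
  have hF : ∀ n w, 𝓕 (h n) w = (-𝓕 k w) ^ n * 𝓕 Ψ w := by
    intro n w
    induction n with
    | zero => simp [h]
    | succ n ih =>
      have : 𝓕 (h (n + 1)) w = 𝓕 (fun x => -k x) w * 𝓕 (h n) w :=
        fourier_convolution hk.neg (hint n) w
      have h2 : 𝓕 (fun x => -k x) w = - 𝓕 k w := by
        have := congrFun (fourier_const_mul' (-1) k) w
        simpa using this
      rw [this, h2, ih]
      ring
  have hsum : Summable fun n => ∫ x, ‖h n x‖ :=
    Summable.of_nonneg_of_le (fun n => integral_nonneg fun _ => norm_nonneg _) hnorm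
      ((summable_geometric_of_lt_one hq0 hk1).mul_right _)
  refine ⟨fun x => ∑' n, h n x, integrable_tsum_of_summable_integral_norm hint hsum, fun w => ?_⟩
  have hs : HasSum (fun n => 𝓕 (h n) w) (𝓕 (fun x => ∑' n, h n x) w) := by
    simp only [Real.fourier_eq]
    have := hasSum_integral_of_summable_integral_norm (μ := volume)
      (F := fun n v => 𝐞 (-inner ℝ v w) • h n v)
      (fun n => integrable_fourierChar_smul (hint n) w) (by simpa [Circle.norm_smul] using hsum)
    have h3 : ∀ v, (∑' n, 𝐞 (-inner ℝ v w) • h n v) = 𝐞 (-inner ℝ v w) • ∑' n, h n v := by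
      intro v
      simp only [Circle.smul_def, smul_eq_mul]
      exact tsum_mul_left
    simpa only [h3] using this
  have hw : ‖-𝓕 k w‖ < 1 := by
    rw [norm_neg]
    exact (norm_fourier_le k w).trans_lt hk1
  have hs2 : HasSum (fun n => 𝓕 (h n) w) ((1 - -𝓕 k w)⁻¹ * 𝓕 Ψ w) := by
    simp only [hF]
    exact (hasSum_geometric_of_norm_lt_one hw).mul_right _
  rw [hs.unique hs2, sub_neg_eq_add]
  have : 1 + 𝓕 k w ≠ 0 := by
    intro h0
    have : -𝓕 k w = 1 := by linear_combination -h0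
    rw [this] at hw
    simp at hw
  field_simp

/-- With β_ε(x) = ε^n β(εx) this says h ∗ β_ε - (∫ h) β_ε → 0 in L¹; on the Fourier side, ĥ - ĥ(0)
times a cutoff at scale ε is small in the norm of the Fourier algebra. By Fubini and scaling the
norm is at most ∫ |h(y)| τ(εy) dy, with τ the L¹ modulus of continuity of β, and dominated
convergence applies. -/
theorem tendsto_integral_norm_convolution_sub {h : V → ℂ} (hh : Integrable h) (β : 𝓢(V, ℂ)) :
    Tendsto (fun ε : ℝ => ∫ x, ‖∫ y, h y * ((ε ^ Module.finrank ℝ V : ℝ) *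
      β (ε • (x - y)) - (ε ^ Module.finrank ℝ V : ℝ) * β (ε • x))‖) (𝓝[>] 0) (𝓝 0) := by
  set n := Module.finrank ℝ V
  set τ : V → ℝ := fun v => ∫ x, ‖β (x - v) - β x‖ with hτ
  have hτ0 : Tendsto τ (𝓝 0) (𝓝 0) := tendsto_integral_translate_sub β
  have hτb : ∀ v, τ v ≤ 2 * ∫ x, ‖β x‖ := by
    intro v
    calc τ v ≤ ∫ x, (‖β (x - v)‖ + ‖β x‖) :=
          integral_mono ((β.integrable.comp_sub_right v).sub β.integrable).norm
            ((β.integrable.comp_sub_right v).norm.add β.integrable.norm)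
            fun x => norm_sub_le _ _
      _ = 2 * ∫ x, ‖β x‖ := by
          rw [integral_add (β.integrable.comp_sub_right v).norm β.integrable.norm,
            integral_sub_right_eq_self (fun x => ‖β x‖) v]
          ring
  have hτn : ∀ v, 0 ≤ τ v := fun v => integral_nonneg fun _ => norm_nonneg _
  have hscale : ∀ ε : ℝ, 0 < ε → ∀ y, ∫ x, ‖((ε ^ n : ℝ) : ℂ) * β (ε • (x - y)) -
      (ε ^ n : ℝ) * β (ε • x)‖ = τ (ε • y) := by
    intro ε hε y
    have h1 : ∀ x, ‖((ε ^ n : ℝ) : ℂ) * β (ε • (x - y)) - (ε ^ n : ℝ) * β (ε • x)‖ =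
        ε ^ n * ‖β (ε • x - ε • y) - β (ε • x)‖ := by
      intro x
      rw [← mul_sub, norm_mul, Complex.norm_real, Real.norm_of_nonneg (by positivity), smul_sub]
    simp only [h1]
    rw [integral_const_mul, Measure.integral_comp_smul volume
      (fun x => ‖β (x - ε • y) - β x‖) ε, abs_of_pos (by positivity), smul_eq_mul, ← mul_assoc,
      mul_inv_cancel₀ (by positivity), one_mul]
  have hprod : ∀ ε : ℝ, 0 < ε → Integrable (fun p : V × V => h p.2 * ((ε ^ n : ℝ) *
      β (ε • (p.1 - p.2)) - (ε ^ n : ℝ) * β (ε • p.1))) (volume.prod volume) := by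
    intro ε hε
    have hβ : Integrable fun x => ((ε ^ n : ℝ) : ℂ) * β (ε • x) :=
      ((integrable_comp_smul_iff volume _ hε.ne').2 β.integrable).const_mul _
    have h1 : Integrable (fun p : V × V => h p.2 * (((ε ^ n : ℝ) : ℂ) * β (ε • (p.1 - p.2))))
        (volume.prod volume) :=
      Integrable.convolution_integrand (ContinuousLinearMap.mul ℂ ℂ) hh hβ
    have h2 : Integrable (fun p : V × V => h p.2 * (((ε ^ n : ℝ) : ℂ) * β (ε • p.1)))
        (volume.prod volume) := by
      have := hβ.mul_prod hh
      simpa [mul_comm] using this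
    refine (h1.sub h2).congr (ae_of_all _ fun p => ?_)
    simp only [Pi.sub_apply, mul_sub]
  have hlim : Tendsto (fun ε : ℝ => ∫ y, ‖h y‖ * τ (ε • y)) (𝓝[>] 0) (𝓝 0) := by
    have h0 : ∫ y : V, ‖h y‖ * 0 = 0 := by simp
    suffices Tendsto (fun ε : ℝ => ∫ y, ‖h y‖ * τ (ε • y)) (𝓝[>] 0) (𝓝 (∫ y : V, ‖h y‖ * 0)) by
      rwa [h0] at this
    refine tendsto_integral_filter_of_dominated_convergence
      (fun y => ‖h y‖ * (2 * ∫ x, ‖β x‖)) ?_ ?_ (hh.norm.mul_const _) ?_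
    · filter_upwards [self_mem_nhdsWithin] with ε hε
      have := (hprod ε hε).norm.integral_prod_right
      refine this.aestronglyMeasurable.congr (ae_of_all _ fun y => ?_)
      simp only [norm_mul]
      rw [integral_const_mul, hscale ε hε]
    · refine Eventually.of_forall fun ε => ae_of_all _ fun y => ?_
      rw [norm_mul, norm_norm, Real.norm_of_nonneg (hτn _)]
      exact mul_le_mul_of_nonneg_left (hτb _) (norm_nonneg _)
    · refine ae_of_all _ fun y => ?_
      refine Tendsto.const_mul _ (hτ0.comp ?_)
      have : Tendsto (fun ε : ℝ => ε • y) (𝓝 0) (𝓝 ((0 : ℝ) • y)) :=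
        (continuous_id.smul continuous_const).tendsto 0
      rw [zero_smul] at this
      exact this.mono_left nhdsWithin_le_nhds
  refine squeeze_zero' (Eventually.of_forall fun ε => integral_nonneg fun _ => norm_nonneg _)
    ?_ hlim
  filter_upwards [self_mem_nhdsWithin] with ε hε
  calc _ ≤ ∫ x, ∫ y, ‖h y * ((ε ^ n : ℝ) * β (ε • (x - y)) - (ε ^ n : ℝ) * β (ε • x))‖ :=
        integral_mono (hprod ε hε).integral_prod_left.norm (hprod ε hε).norm.integral_prod_left
          fun x => norm_integral_le_integral_norm _
    _ = ∫ y, ∫ x, ‖h y * ((ε ^ n : ℝ) * β (ε • (x - y)) - (ε ^ n : ℝ) * β (ε • x))‖ :=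
        integral_integral_swap (hprod ε hε).norm
    _ = ∫ y, ‖h y‖ * τ (ε • y) := by
        refine integral_congr_ae (ae_of_all _ fun y => ?_)
        simp only [norm_mul]
        rw [integral_const_mul, hscale ε hε]

theorem fourier_dilate (f : V → ℂ) {ε : ℝ} (hε : 0 < ε) (w : V) :
    𝓕 (fun x => ((ε ^ Module.finrank ℝ V : ℝ) : ℂ) * f (ε • x)) w = 𝓕 f (ε⁻¹ • w) := by
  rw [fourier_const_mul']
  simp only [Real.fourier_eq]
  have := Measure.integral_comp_smul volume (fun x : V => 𝐞 (-inner ℝ x (ε⁻¹ • w)) • f x) ε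
  rw [abs_of_pos (by positivity)] at this
  have h2 : ∀ x : V, inner ℝ (ε • x) (ε⁻¹ • w) = inner ℝ x w := by
    intro x
    rw [real_inner_smul_left, real_inner_smul_right, ← mul_assoc, mul_inv_cancel₀ hε.ne', one_mul]
  simp only [h2] at this
  rw [this, Complex.real_smul, ← mul_assoc, ← Complex.ofReal_mul,
    mul_inv_cancel₀ (by positivity), Complex.ofReal_one, one_mul]

/-- Put c = ĥ(0) and k̂(w) = c⁻¹ (ĥ(w) - c) b(w/ε) with b a bump function. For small ε the L¹ norm
of k is below 1, so 1 + k̂ can be inverted by the Neumann series, and on the ball where b(·/ε) = 1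
it coincides with ĥ/c. -/
theorem exists_isFourierL1_div_zero {h : V → ℂ} (hh : Integrable h) (h0 : 𝓕 h 0 ≠ 0) :
    ∃ U : Set V, IsOpen U ∧ (0 : V) ∈ U ∧ ∀ χ : V → ℂ, ContDiff ℝ ∞ χ → HasCompactSupport χ →
      tsupport χ ⊆ U → IsFourierL1 fun w => χ w / 𝓕 h w := by
  set n := Module.finrank ℝ V
  set c := 𝓕 h 0 with hc
  have hcint : c = ∫ y, h y := by rw [hc, Real.fourier_eq]; simp
  obtain ⟨b⟩ : Nonempty (ContDiffBump (0 : V)) := inferInstance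
  obtain ⟨β, hβ⟩ := exists_schwartz_fourier_eq (φ := fun w => ((b w : ℝ) : ℂ))
    (Complex.ofRealCLM.contDiff.comp b.contDiff)
    (b.hasCompactSupport.comp_left (g := fun x : ℝ => (x : ℂ)) rfl)
  have hlim := tendsto_integral_norm_convolution_sub hh β
  have hev := (hlim.eventually (gt_mem_nhds (norm_pos_iff.2 h0))).and self_mem_nhdsWithin
  obtain ⟨ε, hε1, hε⟩ := hev.exists
  have hε' : (0 : ℝ) < ε := hε
  set βε : V → ℂ := fun x => ((ε ^ n : ℝ) : ℂ) * β (ε • x) with hβε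
  have hβi : Integrable βε :=
    ((integrable_comp_smul_iff volume _ hε'.ne').2 β.integrable).const_mul _
  set k : V → ℂ := fun x => c⁻¹ * (convolution h βε (ContinuousLinearMap.mul ℂ ℂ) volume x +
    (-c) * βε x) with hk
  have hki : Integrable k :=
    ((integrable_convolution hh hβi).add (hβi.const_mul _)).const_mul _
  have hkF : ∀ w, 𝓕 k w = c⁻¹ * ((𝓕 h w - c) * b (ε⁻¹ • w)) := by
    intro w
    rw [hk, fourier_const_mul', fourier_add' (integrable_convolution hh hβi) (hβi.const_mul _),
      fourier_const_mul']
    simp only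
    rw [fourier_convolution hh hβi, hβε, fourier_dilate _ hε', hβ]
    ring
  have hk1 : ∫ x, ‖k x‖ < 1 := by
    have hae : ∀ᵐ x, ‖k x‖ = ‖c‖⁻¹ * ‖∫ y, h y * ((ε ^ n : ℝ) * β (ε • (x - y)) -
        (ε ^ n : ℝ) * β (ε • x))‖ := by
      filter_upwards [(Integrable.ae_convolution_exists (ContinuousLinearMap.mul ℂ ℂ) hh hβi)]
        with x hx
      rw [hk]
      simp only [norm_mul, norm_inv]
      congr 2
      rw [convolution_def, hcint]
      have hx' : Integrable fun y => h y * (((ε ^ n : ℝ) : ℂ) * β (ε • (x - y))) := hx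
      simp only [mul_sub]
      rw [integral_sub hx' (hh.mul_const _), integral_mul_const]
      simp [hβε]
      ring
    rw [integral_congr_ae hae, integral_const_mul]
    rw [inv_mul_lt_iff₀ (norm_pos_iff.2 h0), mul_one]
    exact hε1
  -- Inside this radius b(w/ε) = 1; outside it χ vanishes, and then so does Ĥ because 1 + k̂ ≠ 0.
  refine ⟨Metric.ball 0 (ε * b.rIn), Metric.isOpen_ball,
    Metric.mem_ball_self (mul_pos hε' b.rIn_pos), fun χ hχ hχc hχs => ?_⟩
  obtain ⟨Ψ, hΨ⟩ := exists_schwartz_fourier_eq hχ hχc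
  obtain ⟨H, hH, hHF⟩ := exists_fourier_mul_one_add_eq hki Ψ.integrable hk1
  refine ⟨fun x => c⁻¹ * H x, hH.const_mul _, ?_⟩
  rw [fourier_const_mul']
  funext w
  have hw := hHF w
  rw [hΨ, hkF] at hw
  have hne : 1 + 𝓕 k w ≠ 0 := by
    intro h1
    have : ‖𝓕 k w‖ < 1 := (norm_fourier_le k w).trans_lt hk1
    have h2 : 𝓕 k w = -1 := by linear_combination h1
    rw [h2] at this
    simp at this
  rw [hkF] at hne
  by_cases hwU : w ∈ Metric.ball (0 : V) (ε * b.rIn)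
  · have hb1 : b (ε⁻¹ • w) = 1 := by
      refine b.one_of_mem_closedBall ?_
      rw [mem_closedBall_zero_iff, norm_smul, norm_inv, Real.norm_of_nonneg hε'.le,
        inv_mul_le_iff₀ hε']
      exact (mem_ball_zero_iff.1 hwU).le
    rw [hb1] at hw hne
    have h3 : 1 + c⁻¹ * ((𝓕 h w - c) * ((1 : ℝ) : ℂ)) = c⁻¹ * 𝓕 h w := by
      field_simp
      push_cast
      ring
    rw [h3] at hw hne
    have h4 : 𝓕 h w ≠ 0 := fun h => hne (by rw [h, mul_zero])
    rw [eq_div_iff h4, ← hw]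
    ring
  · have : χ w = 0 := image_eq_zero_of_notMem_tsupport fun h => hwU (hχs h)
    rw [this] at hw ⊢
    have := (mul_eq_zero.1 hw).resolve_right hne
    simp [this]

theorem exists_isFourierL1_div {h : V → ℂ} (hh : Integrable h) {w₀ : V} (h0 : 𝓕 h w₀ ≠ 0) :
    ∃ U : Set V, IsOpen U ∧ w₀ ∈ U ∧ ∀ χ : V → ℂ, ContDiff ℝ ∞ χ → HasCompactSupport χ →
      tsupport χ ⊆ U → IsFourierL1 fun w => χ w / 𝓕 h w := by
  have hm := fourier_modulate h (-w₀)
  obtain ⟨U, hU, h0U, hdiv⟩ := exists_isFourierL1_div_zero (integrable_modulate hh (-w₀))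
    (by rw [hm]; simpa using h0)
  refine ⟨(fun w => w - w₀) ⁻¹' U, hU.preimage (by fun_prop), by simpa using h0U,
    fun χ hχ hc hs => ?_⟩
  have hts : tsupport (fun w => χ (w + w₀)) = (Homeomorph.addRight w₀) ⁻¹' tsupport χ := by
    have := tsupport_comp_eq_preimage χ (Homeomorph.addRight w₀)
    exact this
  have := hdiv (fun w => χ (w + w₀)) (hχ.comp (contDiff_id.add contDiff_const))
    (hc.comp_homeomorph (Homeomorph.addRight w₀)) (by
      rw [hts]
      intro w hw
      have := hs hw
      simpa using this)
  have h2 := this.comp_sub w₀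
  simp only [hm] at h2
  convert h2 using 3 <;> simp

/-- The localization device used twice: to globalize the local inverses in Wiener's lemma, and to
show that a distribution vanishes on test functions supported off its support. -/
theorem exists_contDiff_decomposition {ι : Type*} {φ : V → ℂ} (hφ : ContDiff ℝ ∞ φ)
    (hc : HasCompactSupport φ) (U : ι → Set V) (hU : ∀ i, IsOpen (U i))
    (hcov : tsupport φ ⊆ ⋃ i, U i) :
    ∃ (s : Finset ι) (χ : ι → V → ℂ), (∀ i, ContDiff ℝ ∞ (χ i) ∧ HasCompactSupport (χ i) ∧
      tsupport (χ i) ⊆ U i) ∧ ∀ w, φ w = ∑ i ∈ s, χ i w := by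
  obtain ⟨f, hf⟩ := SmoothPartitionOfUnity.exists_isSubordinate (modelWithCornersSelf ℝ V)
    (isClosed_tsupport φ) U hU hcov
  have hfin := f.locallyFinite.finite_nonempty_inter_compact hc
  refine ⟨hfin.toFinset, fun i w => ((f i w : ℝ) : ℂ) * φ w, fun i => ⟨?_, ?_, ?_⟩, fun w => ?_⟩
  · exact (Complex.ofRealCLM.contDiff.comp (f i).contMDiff.contDiff).mul hφ
  · exact hc.mul_left
  · refine (tsupport_mul_subset_left (f := fun w => ((f i w : ℝ) : ℂ)) (g := φ)).trans ?_
    refine (closure_mono ?_).trans (hf i)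
    intro w hw
    simpa using hw
  · rw [← Finset.sum_mul]
    by_cases hw : w ∈ tsupport φ
    · have h1 := f.sum_eq_one hw
      rw [finsum_eq_sum_of_support_subset (s := hfin.toFinset)] at h1
      · rw [← Complex.ofReal_sum, h1]; simp
      · intro i hi
        simp only [Set.Finite.coe_toFinset, Set.mem_ofPred_eq]
        exact ⟨w, hi, hw⟩
    · rw [image_eq_zero_of_notMem_tsupport hw, mul_zero]

/-- **Wiener's lemma**, localized: the quotient of a test function by a Fourier transform of an
integrable function which does not vanish on its support is such a Fourier transform. -/
theorem isFourierL1_div {h : V → ℂ} (hh : Integrable h) {φ : V → ℂ} (hφ : ContDiff ℝ ∞ φ)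
    (hc : HasCompactSupport φ) (h0 : ∀ w ∈ tsupport φ, 𝓕 h w ≠ 0) :
    IsFourierL1 fun w => φ w / 𝓕 h w := by
  choose! U hUo hUm hU using fun (w : tsupport φ) => exists_isFourierL1_div hh (h0 w w.2)
  obtain ⟨s, χ, hχ, hsum⟩ := exists_contDiff_decomposition hφ hc U hUo
    fun w hw => Set.mem_iUnion.2 ⟨⟨w, hw⟩, hUm _⟩
  have := IsFourierL1.sum (F := fun i w => χ i w / 𝓕 h w) s
    fun i _ => hU i (χ i) (hχ i).1 (hχ i).2.1 (hχ i).2.2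
  simpa only [hsum, Finset.sum_div] using this

end Wiener


/-! ### Reproducing formula for L^p functions with spectrum in a closed star-shaped set. -/

section Bandlimited

set_option linter.unusedSectionVars false

variable {V : Type*} [NormedAddCommGroup V] [InnerProductSpace ℝ V] [FiniteDimensional ℝ V]
  [MeasurableSpace V] [BorelSpace V]

/-- For large N the weight lies in the dual exponent, so Hölder applies. This one weight dominates
every later integral of σ against Schwartz functions. -/
theorem exists_integrable_mul_decay {σ : V → ℂ} {p : ℝ≥0∞} (hp : 1 ≤ p) (hσ : MemLp σ p) :
    ∃ N : ℕ, Integrable fun y => ‖σ y‖ * (1 + ‖y‖) ^ (-(N : ℝ)) := by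
  have := ENNReal.HolderConjugate.inv_one_sub_inv' hp
  obtain ⟨k, hk⟩ := Measure.HasTemperateGrowth.exists_eLpNorm_lt_top ((1 - p⁻¹)⁻¹)
    (μ := (volume : Measure V)) inferInstance
  refine ⟨k, MemLp.integrable_mul (p := p) (q := (1 - p⁻¹)⁻¹) hσ.norm ⟨?_, hk⟩⟩
  refine Continuous.aestronglyMeasurable ?_
  refine Continuous.rpow_const (by fun_prop) fun x => Or.inl ?_
  positivity

theorem exists_schwartz_decay_add (η : 𝓢(V, ℂ)) (N : ℕ) : ∃ C : ℝ, 0 < C ∧ ∀ (y t : V) (c : ℝ),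
    |c| ≤ 1 → ‖η (y + c • t)‖ ≤ C * (1 + ‖y‖) ^ (-(N : ℝ)) * (1 + ‖t‖) ^ N := by
  obtain ⟨C, hC, h⟩ := exists_schwartz_decay_shift η N
  refine ⟨C, hC, fun y t c hc => ?_⟩
  have := h y (-(c • t))
  rw [sub_neg_eq_add, norm_neg] at this
  refine this.trans ?_
  gcongr
  rw [norm_smul]
  exact mul_le_of_le_one_left (norm_nonneg _) hc

theorem integrable_schwartz_mul_pow (κ : 𝓢(V, ℂ)) (N : ℕ) :
    Integrable fun t => ‖κ t‖ * (1 + ‖t‖) ^ N := by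
  obtain ⟨C, hC, h⟩ := exists_schwartz_decay κ (N + (Module.finrank ℝ V + 1))
  refine Integrable.mono' ((integrable_decay (V := V)).const_mul C) ?_ (ae_of_all _ fun t => ?_)
  · refine Continuous.aestronglyMeasurable ?_
    have := κ.continuous
    fun_prop
  · rw [norm_mul, norm_norm, Real.norm_of_nonneg (by positivity)]
    calc ‖κ t‖ * (1 + ‖t‖) ^ N ≤
        C * (1 + ‖t‖) ^ (-((N + (Module.finrank ℝ V + 1) : ℕ) : ℝ)) * (1 + ‖t‖) ^ N := by
          gcongr; exact h t
      _ = _ := by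
          rw [mul_assoc, ← Real.rpow_natCast (1 + ‖t‖) N, ← Real.rpow_add (by positivity)]
          congr 2
          push_cast
          ring

theorem integrable_prod_schwartz_add {σ : V → ℂ} (hm : AEStronglyMeasurable σ) {N : ℕ}
    (hN : Integrable fun y => ‖σ y‖ * (1 + ‖y‖) ^ (-(N : ℝ))) (κ η : 𝓢(V, ℂ)) {c : ℝ}
    (hc : |c| ≤ 1) :
    Integrable (fun q : V × V => σ q.1 * (κ q.2 * η (q.1 + c • q.2))) (volume.prod volume) := by
  obtain ⟨C, hC, h⟩ := exists_schwartz_decay_add η N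
  refine Integrable.mono' ((hN.mul_prod (integrable_schwartz_mul_pow κ N)).const_mul C) ?_
    (ae_of_all _ fun q => ?_)
  · refine hm.comp_fst.mul (Continuous.aestronglyMeasurable ?_)
    have := κ.continuous
    have := η.continuous
    fun_prop
  · rw [norm_mul, norm_mul]
    calc ‖σ q.1‖ * (‖κ q.2‖ * ‖η (q.1 + c • q.2)‖) ≤
        ‖σ q.1‖ * (‖κ q.2‖ * (C * (1 + ‖q.1‖) ^ (-(N : ℝ)) * (1 + ‖q.2‖) ^ N)) := by
          gcongr; exact h _ _ _ hc
      _ = _ := by ring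

/-- The bound |u j| ≤ 1 gives one dominating function for all j. The limit is used at c = 0, where a
cutoff is removed, and at c = 1, where a dilation is removed. -/
theorem tendsto_integral_mul_schwartz_add {σ : V → ℂ} (hm : AEStronglyMeasurable σ) {N : ℕ}
    (hN : Integrable fun y => ‖σ y‖ * (1 + ‖y‖) ^ (-(N : ℝ))) (κ η : 𝓢(V, ℂ)) {u : ℕ → ℝ}
    (hu : ∀ j, |u j| ≤ 1) {c : ℝ} (hc : Tendsto u atTop (𝓝 c)) :
    Tendsto (fun j => ∫ y, σ y * ∫ t, κ t * η (y + u j • t)) atTop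
      (𝓝 (∫ y, σ y * ∫ t, κ t * η (y + c • t))) := by
  obtain ⟨C, hC, h⟩ := exists_schwartz_decay_add η N
  have hb : ∀ (y t : V) (e : ℝ), |e| ≤ 1 → ‖κ t * η (y + e • t)‖ ≤
      C * (1 + ‖y‖) ^ (-(N : ℝ)) * (‖κ t‖ * (1 + ‖t‖) ^ N) := by
    intro y t e he
    rw [norm_mul]
    calc _ ≤ ‖κ t‖ * (C * (1 + ‖y‖) ^ (-(N : ℝ)) * (1 + ‖t‖) ^ N) := by
          gcongr; exact h _ _ _ he
      _ = _ := by ring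
  have hκ := κ.continuous
  have hη := η.continuous
  refine tendsto_integral_of_dominated_convergence
    (fun y => ‖σ y‖ * (1 + ‖y‖) ^ (-(N : ℝ)) * (C * ∫ t, ‖κ t‖ * (1 + ‖t‖) ^ N))
    (fun j => ?_) (hN.mul_const _) (fun j => ae_of_all _ fun y => ?_) (ae_of_all _ fun y => ?_)
  · have := (integrable_prod_schwartz_add hm hN κ η (hu j)).integral_prod_left.aestronglyMeasurable
    simpa only [integral_const_mul] using this
  · rw [norm_mul]
    calc _ ≤ ‖σ y‖ * ∫ t, C * (1 + ‖y‖) ^ (-(N : ℝ)) * (‖κ t‖ * (1 + ‖t‖) ^ N) := by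
          gcongr
          exact norm_integral_le_of_norm_le ((integrable_schwartz_mul_pow κ N).const_mul _)
            (ae_of_all _ fun t => hb y t _ (hu j))
      _ = _ := by rw [integral_const_mul]; ring
  · refine Tendsto.const_mul _ (tendsto_integral_of_dominated_convergence
      (fun t => C * (1 + ‖y‖) ^ (-(N : ℝ)) * (‖κ t‖ * (1 + ‖t‖) ^ N)) (fun j => ?_)
      ((integrable_schwartz_mul_pow κ N).const_mul _)
      (fun j => ae_of_all _ fun t => hb y t _ (hu j)) (ae_of_all _ fun t => ?_))
    · exact Continuous.aestronglyMeasurable (by fun_prop)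
    · have h1 : Continuous fun e : ℝ => κ t * η (y + e • t) := by fun_prop
      exact (h1.tendsto c).comp hc

/-- Fubini: a factor Φ̂(c ·) averages the transform of v over translates by ct with weight Φ(t).
Keeping c as a parameter, with c = 0 allowed, is what makes the limits in c accessible. -/
theorem fourier_mul_dilate {Φ v : V → ℂ} (hΦ : Integrable Φ) (hv : Integrable v) (c : ℝ) (y : V) :
    𝓕 (fun w => 𝓕 Φ (c • w) * v w) y = ∫ t, Φ t * 𝓕 v (y + c • t) := by
  simp only [Real.fourier_eq, Circle.smul_def, smul_eq_mul]
  have hint : Integrable (fun q : V × V => ((𝐞 (-inner ℝ q.1 y) : Circle) : ℂ) *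
      ((𝐞 (-inner ℝ q.2 (c • q.1)) : Circle) * Φ q.2 * v q.1)) (volume.prod volume) := by
    have h1 : Integrable (fun q : V × V => v q.1 * Φ q.2) (volume.prod volume) := hv.mul_prod hΦ
    have h2 : Continuous (fun q : V × V => ((𝐞 (-inner ℝ q.1 y) : Circle) : ℂ) *
        ((𝐞 (-inner ℝ q.2 (c • q.1)) : Circle))) := by
      have := Real.continuous_fourierChar
      fun_prop
    refine (h1.bdd_mul (c := 1) h2.aestronglyMeasurable (ae_of_all _ fun q => ?_)).congr
      (ae_of_all _ fun q => ?_)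
    · rw [norm_mul, Circle.norm_coe, Circle.norm_coe, one_mul]
    · simp only; ring
  calc _ = ∫ w, ∫ t, ((𝐞 (-inner ℝ w y) : Circle) : ℂ) *
        ((𝐞 (-inner ℝ t (c • w)) : Circle) * Φ t * v w) := by
        refine integral_congr_ae (ae_of_all _ fun w => ?_)
        simp only
        rw [integral_const_mul, integral_mul_const]
    _ = ∫ t, ∫ w, ((𝐞 (-inner ℝ w y) : Circle) : ℂ) *
        ((𝐞 (-inner ℝ t (c • w)) : Circle) * Φ t * v w) := integral_integral_swap hint
    _ = _ := by
        refine integral_congr_ae (ae_of_all _ fun t => ?_)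
        simp only
        rw [← integral_const_mul]
        refine integral_congr_ae (ae_of_all _ fun w => ?_)
        simp only
        have : ((𝐞 (-inner ℝ w (y + c • t)) : Circle) : ℂ) =
            (𝐞 (-inner ℝ w y) : Circle) * (𝐞 (-inner ℝ t (c • w)) : Circle) := by
          rw [← Circle.coe_mul, ← AddChar.map_add_eq_mul, inner_add_right, real_inner_smul_right,
            real_inner_smul_right, real_inner_comm t w]
          congr 3
          ring
        rw [this]
        ring

theorem eq_zero_of_hasCompactSupport_of_disjoint_dsupport {T : 𝓢'(V, ℂ)} {u : 𝓢(V, ℂ)}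
    (hu : HasCompactSupport u) (hd : Disjoint (tsupport u) (Distribution.dsupport T)) :
    T u = 0 := by
  have hloc : ∀ x : tsupport (u : V → ℂ), ∃ s : Set V, Distribution.IsVanishingOn T s ∧ IsOpen s ∧
      (x : V) ∈ s := fun x =>
    (Distribution.notMem_dsupport_iff (x : V)).1 (Set.disjoint_left.1 hd x.2)
  choose U hUv hUo hUm using hloc
  obtain ⟨s, χ, hχ, hsum⟩ := exists_contDiff_decomposition (u.smooth ⊤) hu U hUo
    fun w hw => Set.mem_iUnion.2 ⟨⟨w, hw⟩, hUm _⟩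
  have : u = ∑ i ∈ s, (hχ i).2.1.toSchwartzMap (hχ i).1 := by
    ext w
    rw [hsum w]
    simp
  rw [this, map_sum]
  exact Finset.sum_eq_zero fun i _ => hUv i _ (hχ i).2.2

/-- The vanishing is first known for compactly supported u. A general Schwartz u is multiplied by
b(c ·) with a bump function b; the product is compactly supported with no larger support, and c → 0
recovers u. -/
theorem integral_mul_fourier_eq_zero {p : ℝ≥0∞} [hp : Fact (1 ≤ p)]
    (σ : Lp ℂ p (volume : Measure V)) {u : 𝓢(V, ℂ)}
    (hd : Disjoint (tsupport u) (Distribution.dsupport (𝓕 (σ : 𝓢'(V, ℂ)) : 𝓢'(V, ℂ)))) :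
    ∫ y, σ y * 𝓕 (u : V → ℂ) y = 0 := by
  obtain ⟨N, hN⟩ := exists_integrable_mul_decay hp.out (Lp.memLp σ)
  obtain ⟨b⟩ : Nonempty (ContDiffBump (0 : V)) := inferInstance
  have hb1 : ContDiff ℝ ∞ fun w => ((b w : ℝ) : ℂ) := Complex.ofRealCLM.contDiff.comp b.contDiff
  have hb2 : HasCompactSupport fun w => ((b w : ℝ) : ℂ) :=
    b.hasCompactSupport.comp_left (g := fun x : ℝ => (x : ℂ)) rfl
  obtain ⟨κ, hκ⟩ := exists_schwartz_fourier_eq hb1 hb2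
  have hlim := tendsto_integral_mul_schwartz_add (Lp.memLp σ).aestronglyMeasurable hN κ (𝓕 u)
    (u := fun j : ℕ => 1 / ((j : ℝ) + 1)) (c := 0) (fun j => by
      rw [abs_of_pos (by positivity), div_le_one (by positivity)]
      linarith [(Nat.cast_nonneg j : (0 : ℝ) ≤ j)]) tendsto_one_div_add_atTop_nhds_zero_nat
  have hz : ∀ j : ℕ, ∫ y, σ y * ∫ t, κ t * (𝓕 u : 𝓢(V, ℂ)) (y + (1 / ((j : ℝ) + 1)) • t) = 0 := by
    intro j
    set c : ℝ := 1 / ((j : ℝ) + 1) with hc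
    have hc0 : c ≠ 0 := by positivity
    have hcs : HasCompactSupport fun w => ((b (c • w) : ℝ) : ℂ) :=
      hb2.comp_homeomorph (Homeomorph.smulOfNeZero c hc0)
    have h1 : ContDiff ℝ ∞ fun w => ((b (c • w) : ℝ) : ℂ) * u w :=
      (hb1.comp (contDiff_const_smul c)).mul (u.smooth ⊤)
    have h2 : HasCompactSupport fun w => ((b (c • w) : ℝ) : ℂ) * u w := hcs.mul_right
    have h3 := eq_zero_of_hasCompactSupport_of_disjoint_dsupport
      (T := (𝓕 (σ : 𝓢'(V, ℂ)) : 𝓢'(V, ℂ))) (u := h2.toSchwartzMap h1) h2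
      (hd.mono_left (tsupport_mul_subset_right (f := fun w => ((b (c • w) : ℝ) : ℂ))
        (g := (u : V → ℂ))))
    rw [TemperedDistribution.fourier_apply, Lp.toTemperedDistribution_apply] at h3
    rw [← h3]
    refine integral_congr_ae (ae_of_all _ fun y => ?_)
    simp only [smul_eq_mul]
    rw [mul_comm, SchwartzMap.fourier_coe, SchwartzMap.fourier_coe,
      ← fourier_mul_dilate κ.integrable u.integrable, hκ]
    rfl
  have h0 := tendsto_nhds_unique hlim (by simp only [hz]; exact tendsto_const_nhds)
  rw [← h0]
  refine integral_congr_ae (ae_of_all _ fun y => ?_)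
  simp only [zero_smul, add_zero]
  rw [integral_mul_const]
  -- The integral of κ is κ̂(0) = b(0) = 1.
  have : ∫ t, κ t = 1 := by
    have h5 := congrFun hκ 0
    rw [Real.fourier_eq] at h5
    simpa [b.one_of_mem_closedBall (Metric.mem_closedBall_self b.rIn_pos.le)] using h5
  rw [this, one_mul, SchwartzMap.fourier_coe]

theorem schwartz_decay_sub (Φ : 𝓢(V, ℂ)) (N : ℕ) : ∃ C : ℝ, 0 < C ∧ ∀ z y : V,
    ‖Φ (z - y)‖ ≤ C * (1 + ‖y‖) ^ (-(N : ℝ)) * (1 + ‖z‖) ^ N := by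
  obtain ⟨C, hC, h⟩ := exists_schwartz_decay Φ N
  refine ⟨C, hC, fun z y => (h (z - y)).trans ?_⟩
  have h1 : (0 : ℝ) < (1 + ‖y‖) ^ N := by positivity
  have h2 : (0 : ℝ) < (1 + ‖z - y‖) ^ N := by positivity
  rw [Real.rpow_neg (by positivity), Real.rpow_neg (by positivity), Real.rpow_natCast,
    Real.rpow_natCast, mul_assoc]
  gcongr
  rw [inv_le_iff_one_le_mul₀ h2, mul_assoc, ← div_eq_inv_mul, one_le_div₀ h1, ← mul_pow]
  have := one_add_norm_le_mul y z
  rw [mul_comm, norm_sub_rev]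
  gcongr

theorem integrable_mul_schwartz_sub {σ : V → ℂ} (hm : AEStronglyMeasurable σ) {N : ℕ}
    (hN : Integrable fun y => ‖σ y‖ * (1 + ‖y‖) ^ (-(N : ℝ))) (Φ : 𝓢(V, ℂ)) (z : V) :
    Integrable fun y => σ y * Φ (z - y) := by
  obtain ⟨C, hC, h⟩ := schwartz_decay_sub Φ N
  have hΦ := Φ.continuous
  refine Integrable.mono' (hN.mul_const (C * (1 + ‖z‖) ^ N))
    (hm.mul (Continuous.aestronglyMeasurable (by fun_prop))) (ae_of_all _ fun y => ?_)
  rw [norm_mul]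
  calc _ ≤ ‖σ y‖ * (C * (1 + ‖y‖) ^ (-(N : ℝ)) * (1 + ‖z‖) ^ N) := by gcongr; exact h z y
    _ = _ := by ring

theorem continuous_integral_mul_schwartz_sub {σ : V → ℂ} (hm : AEStronglyMeasurable σ) {N : ℕ}
    (hN : Integrable fun y => ‖σ y‖ * (1 + ‖y‖) ^ (-(N : ℝ))) (Φ : 𝓢(V, ℂ)) :
    Continuous fun z => ∫ y, σ y * Φ (z - y) := by
  obtain ⟨C, hC, h⟩ := schwartz_decay_sub Φ N
  have hΦ := Φ.continuous
  refine continuous_iff_continuousAt.2 fun z₀ => ?_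
  refine continuousAt_of_dominated
    (bound := fun y => ‖σ y‖ * (1 + ‖y‖) ^ (-(N : ℝ)) * (C * (1 + (‖z₀‖ + 1)) ^ N)) ?_ ?_
    (hN.mul_const _) ?_
  · exact Eventually.of_forall fun z =>
      hm.mul (Continuous.aestronglyMeasurable (by fun_prop))
  · filter_upwards [Metric.ball_mem_nhds z₀ one_pos] with z hz
    refine ae_of_all _ fun y => ?_
    have hz' : ‖z‖ ≤ ‖z₀‖ + 1 := by
      have := norm_sub_norm_le z z₀
      rw [mem_ball_iff_norm] at hz
      linarith
    rw [norm_mul]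
    calc _ ≤ ‖σ y‖ * (C * (1 + ‖y‖) ^ (-(N : ℝ)) * (1 + ‖z‖) ^ N) := by gcongr; exact h z y
      _ ≤ ‖σ y‖ * (C * (1 + ‖y‖) ^ (-(N : ℝ)) * (1 + (‖z₀‖ + 1)) ^ N) := by gcongr
      _ = _ := by ring
  · exact ae_of_all _ fun y => Continuous.continuousAt (by fun_prop)

/-- A function with spectrum in a closed set `C`, star-shaped about an interior point at the
origin, is reproduced by every Schwartz function whose Fourier transform is `1` on `C`. -/
theorem ae_eq_integral_mul_schwartz_sub {p : ℝ≥0∞} [hp : Fact (1 ≤ p)]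
    (σ : Lp ℂ p (volume : Measure V)) {C : Set V}
    (hC : ∀ r : ℝ, 0 < r → r < 1 → ∀ x ∈ C, r • x ∈ interior C)
    (hσ : Distribution.dsupport (𝓕 (σ : 𝓢'(V, ℂ)) : 𝓢'(V, ℂ)) ⊆ C)
    (Φ : 𝓢(V, ℂ)) (hΦ : ∀ w ∈ C, 𝓕 (Φ : V → ℂ) w = 1) :
    σ =ᵐ[volume] fun z => ∫ y, σ y * Φ (z - y) := by
  have hm := (Lp.memLp σ).aestronglyMeasurable
  obtain ⟨N, hN⟩ := exists_integrable_mul_decay hp.out (Lp.memLp σ)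
  refine ae_eq_of_schwartz_integral ((Lp.memLp σ).locallyIntegrable hp.out)
    (continuous_integral_mul_schwartz_sub hm hN Φ).locallyIntegrable fun ψ => ?_
  -- The shift by 2 keeps the dilation factor strictly positive already at j = 0.
  have hj : ∀ j : ℕ, 0 < 1 - 1 / ((j : ℝ) + 2) ∧ 1 - 1 / ((j : ℝ) + 2) < 1 := by
    intro j
    have hj0 : (0 : ℝ) ≤ j := Nat.cast_nonneg j
    have h1 : 1 / ((j : ℝ) + 2) < 1 := by rw [div_lt_one (by positivity)]; linarith
    have h2 : 0 < 1 / ((j : ℝ) + 2) := by positivity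
    constructor <;> linarith
  have htend : Tendsto (fun j : ℕ => 1 - 1 / ((j : ℝ) + 2)) atTop (𝓝 1) := by
    have h1 := (tendsto_one_div_add_atTop_nhds_zero_nat (𝕜 := ℝ)).comp (tendsto_add_atTop_nat 1)
    have h2 := h1.const_sub 1
    rw [sub_zero] at h2
    refine h2.congr fun j => ?_
    simp only [Function.comp]
    push_cast
    ring
  have hlim := tendsto_integral_mul_schwartz_add hm hN Φ ψ
    (u := fun j : ℕ => 1 - 1 / ((j : ℝ) + 2)) (c := 1)
    (fun j => by rw [abs_of_pos (hj j).1]; exact (hj j).2.le) htend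
  have hstage : ∀ j : ℕ, ∫ y, σ y * ∫ t, Φ t * ψ (y + (1 - 1 / ((j : ℝ) + 2)) • t) =
      ∫ y, σ y * ψ y := by
    intro j
    set r : ℝ := 1 - 1 / ((j : ℝ) + 2)
    obtain ⟨hr0, hr1⟩ := hj j
    have hfi : ∀ f : 𝓢(V, ℂ), 𝓕 (((𝓕⁻ f : 𝓢(V, ℂ))) : V → ℂ) = f := by
      intro f
      rw [← SchwartzMap.fourier_coe]; simp
    have hg : Function.HasTemperateGrowth fun w => (𝓕 Φ : 𝓢(V, ℂ)) (r • w) - 1 := by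
      have h1 : Function.HasTemperateGrowth fun w : V => r • w :=
        (r • ContinuousLinearMap.id ℝ V).hasTemperateGrowth
      exact ((𝓕 Φ).hasTemperateGrowth.comp h1).sub (.const 1)
    -- For r < 1 the dilate Φ̂(r ·) equals 1 on an open set containing C, because rC lies in the
    -- interior of C. So the support of u misses C, which could fail at r = 1.
    let u : 𝓢(V, ℂ) := SchwartzMap.smulLeftCLM ℂ (fun w => (𝓕 Φ : 𝓢(V, ℂ)) (r • w) - 1) (𝓕⁻ ψ)
    have hu : (u : V → ℂ) = fun w => 𝓕 (Φ : V → ℂ) (r • w) * (𝓕⁻ ψ : 𝓢(V, ℂ)) w +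
        (-1) * (𝓕⁻ ψ : 𝓢(V, ℂ)) w := by
      funext w
      refine (SchwartzMap.smulLeftCLM_apply_apply hg (𝓕⁻ ψ) w).trans ?_
      rw [smul_eq_mul, SchwartzMap.fourier_coe]
      ring
    have hdisj : Disjoint (tsupport (u : V → ℂ)) C := by
      have ho : IsOpen ((fun w : V => r • w) ⁻¹' interior C) :=
        isOpen_interior.preimage (by fun_prop)
      have hd : Disjoint (tsupport (u : V → ℂ)) ((fun w : V => r • w) ⁻¹' interior C) := by
        refine Disjoint.closure_left ?_ ho
        refine Set.disjoint_left.2 fun w hw hw' => hw ?_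
        rw [hu]
        simp only
        rw [hΦ _ (interior_subset hw')]
        ring
      exact hd.mono_right fun w hw => hC r hr0 hr1 w hw
    have hz := integral_mul_fourier_eq_zero σ (hdisj.mono_right hσ)
    have hi1 : Integrable fun w => 𝓕 (Φ : V → ℂ) (r • w) * (𝓕⁻ ψ : 𝓢(V, ℂ)) w := by
      refine ((𝓕⁻ ψ : 𝓢(V, ℂ)).integrable).bdd_mul (c := ∫ x, ‖Φ x‖) ?_
        (ae_of_all _ fun w => norm_fourier_le _ _)
      exact ((continuous_fourier Φ.integrable).comp (continuous_const_smul r)).aestronglyMeasurable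
    rw [hu, fourier_add' hi1 ((𝓕⁻ ψ : 𝓢(V, ℂ)).integrable.const_mul _),
      fourier_const_mul', hfi] at hz
    simp only [fourier_mul_dilate Φ.integrable (𝓕⁻ ψ : 𝓢(V, ℂ)).integrable, hfi, mul_add] at hz
    have hA : Integrable fun y => σ y * ∫ t, Φ t * ψ (y + r • t) := by
      have := (integrable_prod_schwartz_add hm hN Φ ψ (c := r)
        (by rw [abs_of_pos hr0]; exact hr1.le)).integral_prod_left
      simpa only [integral_const_mul] using this
    have hB : Integrable fun y => σ y * (-1 * ψ y) := by
      have := integrable_mul_schwartz_sub hm hN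
        (SchwartzMap.compCLMOfContinuousLinearEquiv ℂ (ContinuousLinearEquiv.neg ℝ) ψ) 0
      have h2 : Integrable fun y => σ y * ψ y := by simpa using this
      refine (h2.const_mul (-1)).congr (ae_of_all _ fun y => ?_)
      simp only; ring
    rw [integral_add hA hB] at hz
    have h3 : ∫ y, σ y * (-1 * ψ y) = - ∫ y, σ y * ψ y := by
      rw [← integral_neg]
      refine integral_congr_ae (ae_of_all _ fun y => ?_)
      simp only; ring
    rw [h3] at hz
    linear_combination hz
  simp only [hstage] at hlim
  rw [tendsto_nhds_unique tendsto_const_nhds hlim]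
  have hint := integrable_prod_schwartz_add hm hN Φ ψ (c := 1) (by simp)
  simp only [one_smul] at hint ⊢
  have hint2 : Integrable (fun q : V × V => σ q.1 * (Φ (q.2 - q.1) * ψ q.2))
      (volume.prod volume) := by
    -- The shear z = y + t turns the correlation with ψ into the convolution with Φ.
    have hmp : MeasurePreserving (fun q : V × V => (q.1, q.2 - q.1))
        (volume.prod volume) (volume.prod volume) := by
      refine MeasurePreserving.skew_product (f := id) (g := fun x y => y - x)
        (MeasurePreserving.id _) (by fun_prop) (ae_of_all _ fun x => ?_)
      exact (measurePreserving_sub_right volume x).map_eq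
    have := hmp.integrable_comp_of_integrable hint
    simpa [Function.comp_def] using this
  calc ∫ y, σ y * ∫ t, Φ t * ψ (y + t) = ∫ y, ∫ z, σ y * (Φ (z - y) * ψ z) := by
        refine integral_congr_ae (ae_of_all _ fun y => ?_)
        simp only
        rw [integral_const_mul]
        congr 1
        rw [← integral_sub_right_eq_self (fun t => Φ t * ψ (y + t)) y]
        simp
    _ = ∫ z, ∫ y, σ y * (Φ (z - y) * ψ z) := integral_integral_swap hint2
    _ = _ := by
        refine integral_congr_ae (ae_of_all _ fun z => ?_)
        simp only
        rw [← integral_mul_const]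
        refine integral_congr_ae (ae_of_all _ fun y => ?_)
        simp only; ring

end Bandlimited


/-! ### The pointwise inequality behind M. Riesz' theorem. -/

section RieszPointwise

/-- Near |θ| = π/2 one has π/2 < p|θ| ≤ π, thanks to 1 < p ≤ 2, so cos(pθ) is negative and -B
cos(pθ) exceeds 1. Away from π/2 the cosine of θ is bounded below and the term with A dominates. -/
theorem exists_abs_sin_rpow_le {p : ℝ} (hp1 : 1 < p) (hp2 : p ≤ 2) : ∃ A B : ℝ, 0 ≤ A ∧
    ∀ θ : ℝ, |θ| ≤ Real.pi / 2 →
      |Real.sin θ| ^ p ≤ A * Real.cos θ ^ p - B * Real.cos (θ * p) := by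
  have hpi := Real.pi_pos
  have hp0 : 0 < p := by linarith
  -- Midpoint between π/(2p), where cos(pθ) changes sign, and π/2.
  set θ₁ := (Real.pi / (2 * p) + Real.pi / 2) / 2 with hθ₁
  have h1 : Real.pi / (2 * p) < Real.pi / 2 := by
    apply div_lt_div_of_pos_left hpi (by norm_num); linarith
  have h1' : 0 < Real.pi / (2 * p) := by positivity
  have hθ1lt : θ₁ < Real.pi / 2 := by rw [hθ₁]; linarith
  have hθ1pos : 0 < θ₁ := by rw [hθ₁]; linarith
  have h2 : Real.pi / 2 < θ₁ * p := by
    have : Real.pi / (2 * p) < θ₁ := by rw [hθ₁]; linarith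
    calc Real.pi / 2 = Real.pi / (2 * p) * p := by field_simp
      _ < θ₁ * p := by gcongr
  have h3 : θ₁ * p ≤ Real.pi := by
    calc θ₁ * p ≤ Real.pi / 2 * 2 := by gcongr
      _ = Real.pi := by ring
  set η := -Real.cos (θ₁ * p) with hη
  have hηpos : 0 < η := by
    have := Real.cos_neg_of_pi_div_two_lt_of_lt h2 (by linarith)
    rw [hη]; linarith
  set m := Real.cos θ₁ with hm
  have hmpos : 0 < m := Real.cos_pos_of_mem_Ioo ⟨by linarith, hθ1lt⟩
  -- B = 1/η gives -B cos(pθ) ≥ 1 beyond θ₁; up to θ₁, where cos θ ≥ m, the constant A pays for 1 +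
  -- B.
  refine ⟨(1 + 1 / η) / m ^ p, 1 / η, by positivity, fun θ hθ => ?_⟩
  have hcos : Real.cos θ = Real.cos |θ| := (Real.cos_abs θ).symm
  have hcosp : Real.cos (θ * p) = Real.cos (|θ| * p) := by
    rw [← Real.cos_abs (θ * p), abs_mul, abs_of_pos hp0]
  have hsin : |Real.sin θ| ^ p ≤ 1 := Real.rpow_le_one (abs_nonneg _) (Real.abs_sin_le_one _) hp0.le
  have hc0 : 0 ≤ Real.cos |θ| := Real.cos_nonneg_of_mem_Icc ⟨by linarith [abs_nonneg θ], hθ⟩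
  rw [hcos, hcosp]
  rcases le_total θ₁ |θ| with h | h
  · have h4 : Real.cos (|θ| * p) ≤ -η := by
      rw [hη, neg_neg]
      refine Real.cos_le_cos_of_nonneg_of_le_pi (by positivity) ?_ (by gcongr)
      calc |θ| * p ≤ Real.pi / 2 * 2 := by gcongr
        _ = Real.pi := by ring
    have h5 : 1 ≤ -(1 / η * Real.cos (|θ| * p)) := by
      have : 1 / η * Real.cos (|θ| * p) ≤ 1 / η * (-η) := by gcongr
      have h6 : 1 / η * (-η) = -1 := by field_simp
      linarith
    have h7 : 0 ≤ (1 + 1 / η) / m ^ p * Real.cos |θ| ^ p := by positivity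
    linarith
  · have h4 : m ≤ Real.cos |θ| :=
      Real.cos_le_cos_of_nonneg_of_le_pi (abs_nonneg _) (by linarith) h
    have h5 : 1 + 1 / η ≤ (1 + 1 / η) / m ^ p * Real.cos |θ| ^ p := by
      rw [div_mul_eq_mul_div, le_div_iff₀ (by positivity)]
      gcongr
    have h6 : 1 / η * Real.cos (|θ| * p) ≤ 1 / η * 1 := by
      gcongr
      exact Real.cos_le_one _
    linarith

/-- The trigonometric inequality in polar coordinates. The point of the last term is that it is the
real part of an analytic function, whose integral along a horizontal line will vanish. -/
theorem exists_abs_im_rpow_le {p : ℝ} (hp1 : 1 < p) (hp2 : p ≤ 2) : ∃ A B : ℝ, 0 ≤ A ∧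
    ∀ z : ℂ, 0 < z.re → |z.im| ^ p ≤ A * z.re ^ p - B * (z ^ (p : ℂ)).re := by
  obtain ⟨A, B, hA, h⟩ := exists_abs_sin_rpow_le hp1 hp2
  refine ⟨A, B, hA, fun z hz => ?_⟩
  have harg := Complex.abs_arg_le_pi_div_two_iff.2 hz.le
  have := h _ harg
  have hcos : 0 ≤ Real.cos z.arg := Real.cos_nonneg_of_mem_Icc (abs_le.1 harg)
  have hn : (0 : ℝ) ≤ ‖z‖ ^ p := by positivity
  rw [Complex.cpow_ofReal_re]
  have hre : z.re ^ p = ‖z‖ ^ p * Real.cos z.arg ^ p := by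
    rw [← Real.mul_rpow (norm_nonneg _) hcos, Complex.norm_mul_cos_arg]
  have him : |z.im| ^ p = ‖z‖ ^ p * |Real.sin z.arg| ^ p := by
    rw [← Real.mul_rpow (norm_nonneg _) (abs_nonneg _), ← Complex.norm_mul_sin_arg z, abs_mul,
      abs_of_nonneg (norm_nonneg z)]
  rw [hre, him]
  nlinarith [mul_le_mul_of_nonneg_left this hn]

end RieszPointwise

/-! ### M. Riesz' inequality by a contour integral. -/

section RieszContour

variable (S : Finset ℤ) (d : ℤ → ℝ)

/-- The function `∑ k ∈ S, i d k / (z - k)`, analytic in the upper half plane. -/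
noncomputable def cauchySum (z : ℂ) : ℂ := ∑ k ∈ S, (d k : ℂ) * (Complex.I / (z - k))

variable {S d}

theorem sub_intCast_ne_zero {z : ℂ} (hz : 0 < z.im) (k : ℤ) : z - k ≠ 0 := by
  intro h
  have := congrArg Complex.im h
  simp at this
  linarith

theorem cauchySum_add_I_re (x : ℝ) :
    (cauchySum S d (x + Complex.I)).re = ∑ k ∈ S, d k * (1 + (x - k) ^ 2)⁻¹ := by
  rw [cauchySum, Complex.re_sum]
  refine Finset.sum_congr rfl fun k _ => ?_
  rw [Complex.re_ofReal_mul, Complex.div_re]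
  simp [Complex.normSq_apply]
  left
  ring

theorem cauchySum_add_I_im (x : ℝ) :
    (cauchySum S d (x + Complex.I)).im = ∑ k ∈ S, d k * ((x - k) * (1 + (x - k) ^ 2)⁻¹) := by
  rw [cauchySum, Complex.im_sum]
  refine Finset.sum_congr rfl fun k _ => ?_
  rw [Complex.im_ofReal_mul, Complex.div_im]
  simp [Complex.normSq_apply]
  left
  rw [div_eq_mul_inv]
  congr 2
  ring

/-- Each i/(z - k) maps the upper half plane to the right half plane. Hence the principal p-th power
of the sum is analytic there. -/
theorem cauchySum_re_pos (hd : ∀ k ∈ S, 0 ≤ d k) (hpos : ∃ k ∈ S, 0 < d k) {z : ℂ}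
    (hz : 0 < z.im) : 0 < (cauchySum S d z).re := by
  have hterm : ∀ k : ℤ, 0 < (Complex.I / (z - k)).re := by
    intro k
    rw [Complex.div_re]
    have := Complex.normSq_pos.2 (sub_intCast_ne_zero hz k)
    simp
    positivity
  rw [cauchySum, Complex.re_sum]
  obtain ⟨k, hk, hk0⟩ := hpos
  refine Finset.sum_pos' (fun k hk => ?_) ⟨k, hk, ?_⟩
  · rw [Complex.re_ofReal_mul]; exact mul_nonneg (hd k hk) (hterm k).le
  · rw [Complex.re_ofReal_mul]; exact mul_pos hk0 (hterm k)

theorem differentiableAt_cauchySum {z : ℂ} (hz : 0 < z.im) :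
    DifferentiableAt ℂ (cauchySum S d) z := by
  unfold cauchySum
  refine DifferentiableAt.fun_sum fun k _ => ?_
  refine DifferentiableAt.const_mul ?_ _
  exact DifferentiableAt.div (by fun_prop) (by fun_prop) (sub_intCast_ne_zero hz k)

theorem norm_cauchySum_le (hd : ∀ k ∈ S, 0 ≤ d k) {z : ℂ} {r : ℝ} (hr : 0 < r)
    (hz : ∀ k ∈ S, r ≤ ‖z - k‖) : ‖cauchySum S d z‖ ≤ (∑ k ∈ S, d k) / r := by
  rw [cauchySum, Finset.sum_div]
  refine norm_sum_le_of_le _ fun k hk => ?_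
  rw [norm_mul, norm_div, Complex.norm_I, Complex.norm_real, Real.norm_of_nonneg (hd k hk),
    mul_one_div]
  exact div_le_div_of_nonneg_left (hd k hk) hr (hz k hk)

theorem exists_norm_cauchySum_le : ∃ C : ℝ, 0 ≤ C ∧ ∀ x : ℝ,
    ‖cauchySum S d (x + Complex.I)‖ ≤ C * (1 + ‖x‖) ^ (-1 : ℝ) := by
  refine ⟨∑ k ∈ S, |d k| * (2 * (1 + |(k : ℝ)|)),
    Finset.sum_nonneg fun k _ => by positivity, fun x => ?_⟩
  rw [cauchySum, Finset.sum_mul]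
  refine norm_sum_le_of_le _ fun k hk => ?_
  rw [norm_mul, norm_div, Complex.norm_I, Complex.norm_real, Real.norm_eq_abs, mul_assoc]
  gcongr
  have h1 : |x - k| ≤ ‖(x : ℂ) + Complex.I - k‖ := by
    have := Complex.abs_re_le_norm ((x : ℂ) + Complex.I - k)
    simpa using this
  have h2 : 1 ≤ ‖(x : ℂ) + Complex.I - k‖ := by
    have := Complex.abs_im_le_norm ((x : ℂ) + Complex.I - k)
    simpa using this
  have h3 : 1 + ‖x‖ ≤ (1 + ‖x - k‖) * (1 + ‖(k : ℝ)‖) := one_add_norm_le_mul x (k : ℝ)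
  simp only [Real.norm_eq_abs] at h3 ⊢
  rw [Real.rpow_neg_one, ← div_eq_mul_inv, div_le_div_iff₀ (by linarith) (by positivity), one_mul]
  nlinarith [abs_nonneg (k : ℝ)]

theorem integrable_norm_cauchySum_rpow {p : ℝ} (hp : 1 < p) :
    Integrable fun x : ℝ => ‖cauchySum S d (x + Complex.I)‖ ^ p := by
  obtain ⟨C, hC, h⟩ := exists_norm_cauchySum_le (S := S) (d := d)
  have hint : Integrable fun x : ℝ => (1 + ‖x‖) ^ (-p) :=
    integrable_one_add_norm (by simpa using hp)
  refine Integrable.mono' (hint.const_mul (C ^ p)) ?_ (ae_of_all _ fun x => ?_)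
  · have hc : Continuous fun x : ℝ => cauchySum S d (x + Complex.I) := by
      refine continuous_iff_continuousAt.2 fun x => ?_
      have := (differentiableAt_cauchySum (S := S) (d := d) (z := x + Complex.I)
        (by simp)).continuousAt
      exact this.comp (f := fun x : ℝ => (x : ℂ) + Complex.I) (by fun_prop)
    exact (hc.norm.rpow_const fun x => Or.inr (by linarith)).aestronglyMeasurable
  · rw [Real.norm_of_nonneg (by positivity)]
    calc _ ≤ (C * (1 + ‖x‖) ^ (-1 : ℝ)) ^ p := by
          gcongr; exact h x
      _ = _ := by
          rw [Real.mul_rpow hC (by positivity), ← Real.rpow_mul (by positivity)]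
          congr 2
          ring

theorem continuous_cauchySum_add_I : Continuous fun x : ℝ => cauchySum S d (x + Complex.I) := by
  refine continuous_iff_continuousAt.2 fun x => ?_
  have := (differentiableAt_cauchySum (S := S) (d := d) (z := x + Complex.I) (by simp)).continuousAt
  exact this.comp (f := fun x : ℝ => (x : ℂ) + Complex.I) (by fun_prop)

theorem integrable_cauchySum_cpow (hd : ∀ k ∈ S, 0 ≤ d k) (hpos : ∃ k ∈ S, 0 < d k) {p : ℝ}
    (hp : 1 < p) : Integrable fun x : ℝ => cauchySum S d (x + Complex.I) ^ (p : ℂ) := by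
  refine Integrable.mono' (integrable_norm_cauchySum_rpow (S := S) (d := d) hp) ?_
    (ae_of_all _ fun x => ?_)
  · refine Continuous.aestronglyMeasurable ?_
    refine Continuous.cpow continuous_cauchySum_add_I continuous_const fun x => Or.inl ?_
    exact cauchySum_re_pos hd hpos (by simp)
  · rw [Complex.norm_cpow_real]

/-- Cauchy's theorem on the rectangle [-R, R] × [1, 1 + R]: on the three remaining sides, of total
length 4R, the integrand is O(R^{-p}), and p > 1. -/
theorem integral_cauchySum_cpow (hd : ∀ k ∈ S, 0 ≤ d k) (hpos : ∃ k ∈ S, 0 < d k) {p : ℝ}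
    (hp : 1 < p) : ∫ x : ℝ, cauchySum S d (x + Complex.I) ^ (p : ℂ) = 0 := by
  set G : ℂ → ℂ := fun z => cauchySum S d z ^ (p : ℂ) with hG
  set D := ∑ k ∈ S, d k
  have hD : 0 ≤ D := Finset.sum_nonneg hd
  have hdiff : ∀ z : ℂ, 0 < z.im → DifferentiableAt ℂ G z := fun z hz =>
    (differentiableAt_cauchySum hz).cpow_const (Or.inl (cauchySum_re_pos hd hpos hz))
  have hGn : ∀ z : ℂ, ‖G z‖ = ‖cauchySum S d z‖ ^ p := fun z => Complex.norm_cpow_real _ _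
  obtain ⟨R₀, hR₀⟩ : ∃ R₀ : ℝ, ∀ k ∈ S, |(k : ℝ)| ≤ R₀ :=
    ⟨∑ k ∈ S, |(k : ℝ)|, fun k hk => Finset.single_le_sum (f := fun k : ℤ => |(k : ℝ)|)
      (fun _ _ => abs_nonneg _) hk⟩
  have hlim1 : Tendsto (fun R : ℝ => ∫ x in (-R)..R, G (x + Complex.I)) atTop
      (𝓝 (∫ x : ℝ, G (x + Complex.I))) :=
    intervalIntegral_tendsto_integral (integrable_cauchySum_cpow hd hpos hp)
      tendsto_neg_atTop_atBot tendsto_id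
  have hbound : ∀ᶠ R : ℝ in atTop, ‖∫ x in (-R)..R, G (x + Complex.I)‖ ≤
      (4 * (2 * D) ^ p) * R ^ (-(p - 1)) := by
    -- For R ≥ 2R₀ the vertical sides stay at distance at least R/2 from every pole k in S; the top
    -- side does so in any case.
    filter_upwards [eventually_ge_atTop (2 * R₀), eventually_ge_atTop 1] with R hR hR1
    have hRpos : 0 < R := by linarith
    have hB : ∀ z : ℂ, (∀ k ∈ S, R / 2 ≤ ‖z - k‖) → ‖G z‖ ≤ (2 * D / R) ^ p := by
      intro z hz
      rw [hGn]
      have := norm_cauchySum_le hd (by positivity) hz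
      calc _ ≤ (D / (R / 2)) ^ p := by gcongr
        _ = _ := by congr 1; field_simp
    have hrect := Complex.integral_boundary_rect_eq_zero_of_differentiableOn G
      (⟨-R, 1⟩ : ℂ) (⟨R, 1 + R⟩ : ℂ) (fun z hz => by
        refine (hdiff z ?_).differentiableWithinAt
        have := (Complex.mem_reProdIm.1 hz).2
        rw [Set.uIcc_of_le (by simp; linarith)] at this
        have := this.1
        simp at this
        linarith)
    simp only [Complex.ofReal_one, one_mul] at hrect
    have e1 : ‖∫ x in (-R)..R, G (x + (↑(1 + R) : ℂ) * Complex.I)‖ ≤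
        (2 * D / R) ^ p * |R - (-R)| := by
      refine intervalIntegral.norm_integral_le_of_norm_le_const fun x _ => hB _ fun k hk => ?_
      have := Complex.abs_im_le_norm ((x : ℂ) + (↑(1 + R) : ℂ) * Complex.I - k)
      simp at this
      rw [abs_of_pos (by linarith)] at this
      push_cast
      linarith
    have e2 : ‖∫ y in (1 : ℝ)..(1 + R), G ((R : ℂ) + y * Complex.I)‖ ≤
        (2 * D / R) ^ p * |1 + R - 1| := by
      refine intervalIntegral.norm_integral_le_of_norm_le_const fun x _ => hB _ fun k hk => ?_
      have := Complex.abs_re_le_norm ((R : ℂ) + x * Complex.I - k)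
      simp at this
      have h2 := hR₀ k hk
      have h3 := (abs_le.1 h2).2
      have h4 := le_abs_self (R - (k : ℝ))
      linarith
    have e3 : ‖∫ y in (1 : ℝ)..(1 + R), G ((↑(-R) : ℂ) + y * Complex.I)‖ ≤
        (2 * D / R) ^ p * |1 + R - 1| := by
      refine intervalIntegral.norm_integral_le_of_norm_le_const fun x _ => hB _ fun k hk => ?_
      have := Complex.abs_re_le_norm ((↑(-R) : ℂ) + x * Complex.I - k)
      simp at this
      have h2 := hR₀ k hk
      have h3 := (abs_le.1 h2).1
      have h4 := neg_le_abs (-R - (k : ℝ))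
      push_cast
      linarith
    have heq : ∫ x in (-R)..R, G (x + Complex.I) =
        (∫ x in (-R)..R, G (x + (↑(1 + R) : ℂ) * Complex.I)) -
        Complex.I • (∫ y in (1 : ℝ)..(1 + R), G ((R : ℂ) + y * Complex.I)) +
        Complex.I • ∫ y in (1 : ℝ)..(1 + R), G ((↑(-R) : ℂ) + y * Complex.I) := by
      linear_combination hrect
    rw [heq]
    refine (norm_add_le _ _).trans ((add_le_add (norm_sub_le _ _) le_rfl).trans ?_)
    rw [norm_smul, norm_smul, Complex.norm_I, one_mul, one_mul]
    have hpow : (2 * D / R) ^ p * R = (2 * D) ^ p * R ^ (-(p - 1)) := by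
      rw [Real.div_rpow (by positivity) hRpos.le, neg_sub, Real.rpow_sub hRpos, Real.rpow_one]
      ring
    have a1 : |R - (-R)| = 2 * R := by rw [abs_of_pos (by linarith)]; ring
    have a2 : |1 + R - 1| = R := by rw [add_sub_cancel_left, abs_of_pos hRpos]
    rw [a1] at e1
    rw [a2] at e2 e3
    calc _ ≤ (2 * D / R) ^ p * (2 * R) + (2 * D / R) ^ p * R + (2 * D / R) ^ p * R := by
          gcongr
      _ = 4 * ((2 * D / R) ^ p * R) := by ring
      _ = _ := by rw [hpow]; ring
  have hlim0 : Tendsto (fun R : ℝ => ∫ x in (-R)..R, G (x + Complex.I)) atTop (𝓝 0) := by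
    refine squeeze_zero_norm' hbound ?_
    have := (tendsto_rpow_neg_atTop (y := p - 1) (by linarith)).const_mul (4 * (2 * D) ^ p)
    simpa using this
  exact tendsto_nhds_unique hlim1 hlim0

/-- **M. Riesz' inequality** for conjugate Poisson sums. -/
theorem exists_integral_abs_im_cauchySum_le {p : ℝ} (hp1 : 1 < p) (hp2 : p ≤ 2) :
    ∃ A : ℝ, 0 ≤ A ∧ ∀ (S : Finset ℤ) (d : ℤ → ℝ), (∀ k ∈ S, 0 ≤ d k) →
      ∫ x : ℝ, |(cauchySum S d (x + Complex.I)).im| ^ p ≤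
        A * ∫ x : ℝ, (cauchySum S d (x + Complex.I)).re ^ p := by
  obtain ⟨A, B, hA, h⟩ := exists_abs_im_rpow_le hp1 hp2
  refine ⟨A, hA, fun S d hd => ?_⟩
  -- If all coefficients vanish the real part is 0 and not positive, so the pointwise inequality
  -- does not apply; both integrals are then 0.
  by_cases hpos : ∃ k ∈ S, 0 < d k
  · have hre : ∀ x : ℝ, 0 < (cauchySum S d (x + Complex.I)).re := fun x =>
      cauchySum_re_pos hd hpos (by simp)
    have hG := integrable_cauchySum_cpow hd hpos hp1
    have hn := integrable_norm_cauchySum_rpow (S := S) (d := d) hp1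
    have hc := continuous_cauchySum_add_I (S := S) (d := d)
    have hp0 : 0 ≤ p := by linarith
    have i1 : Integrable fun x : ℝ => |(cauchySum S d (x + Complex.I)).im| ^ p := by
      refine hn.mono' (Continuous.aestronglyMeasurable ?_) (ae_of_all _ fun x => ?_)
      · exact (Complex.continuous_im.comp hc).abs.rpow_const fun x => Or.inr hp0
      · rw [Real.norm_of_nonneg (by positivity)]
        gcongr
        exact Complex.abs_im_le_norm _
    have i2 : Integrable fun x : ℝ => (cauchySum S d (x + Complex.I)).re ^ p := by
      refine hn.mono' (Continuous.aestronglyMeasurable ?_) (ae_of_all _ fun x => ?_)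
      · exact (Complex.continuous_re.comp hc).rpow_const fun x => Or.inr hp0
      · have := (hre x).le
        rw [Real.norm_of_nonneg (by positivity)]
        gcongr
        exact Complex.re_le_norm _
    have i3 : Integrable fun x : ℝ => (cauchySum S d (x + Complex.I) ^ (p : ℂ)).re := hG.re
    have h0 : ∫ x : ℝ, (cauchySum S d (x + Complex.I) ^ (p : ℂ)).re = 0 := by
      have := integral_re hG
      simp only [RCLike.re_eq_complex_re] at this
      rw [this, integral_cauchySum_cpow hd hpos hp1]
      simp
    calc _ ≤ ∫ x : ℝ, (A * (cauchySum S d (x + Complex.I)).re ^ p -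
          B * (cauchySum S d (x + Complex.I) ^ (p : ℂ)).re) :=
          integral_mono i1 ((i2.const_mul A).sub (i3.const_mul B)) fun x => h _ (hre x)
      _ = _ := by
          rw [integral_sub (i2.const_mul A) (i3.const_mul B), integral_const_mul,
            integral_const_mul, h0]
          ring
  · have hz : ∀ z, cauchySum S d z = 0 := by
      intro z
      refine Finset.sum_eq_zero fun k hk => ?_
      have : d k = 0 := le_antisymm (not_lt.1 fun h => hpos ⟨k, hk, h⟩) (hd k hk)
      simp [this]
    have hp0 : p ≠ 0 := by linarith
    simp [hz, Real.zero_rpow hp0]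

end RieszContour


/-! ### Uniform bounds for sums over integer translates. -/

section LatticeSums

theorem summable_one_add_abs_int_rpow {q : ℝ} (hq : 1 < q) :
    Summable fun n : ℤ => (1 + |(n : ℝ)|) ^ (-q) := by
  have h : Summable fun n : ℕ => (1 + (n : ℝ)) ^ (-q) := by
    have := (summable_nat_add_iff 1).2 (Real.summable_nat_rpow (p := -q) |>.2 (by linarith))
    refine this.congr fun n => ?_
    push_cast
    rw [add_comm]
  refine Summable.of_nat_of_neg ?_ ?_
  · simpa using h
  · simpa using h

/-- Recentring at the nearest integer `round x` changes each base by at most a factor 2, so all x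
are controlled by the single series at the origin. -/
theorem exists_sum_one_add_abs_sub_rpow_le {q : ℝ} (hq : 1 < q) : ∃ C : ℝ, 0 < C ∧
    ∀ (x : ℝ) (S : Finset ℤ), ∑ k ∈ S, (1 + |x - k|) ^ (-q) ≤ C := by
  have hs := summable_one_add_abs_int_rpow hq
  refine ⟨2 ^ q * ∑' n : ℤ, (1 + |(n : ℝ)|) ^ (-q), ?_, fun x S => ?_⟩
  · have := hs.tsum_pos (fun n => by positivity) 0 (by simp)
    positivity
  · have hterm : ∀ k : ℤ, (1 + |x - k|) ^ (-q) ≤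
        2 ^ q * (1 + |((round x - k : ℤ) : ℝ)|) ^ (-q) := by
      intro k
      have h1 : |((round x - k : ℤ) : ℝ)| ≤ |x - k| + 1 / 2 := by
        have h2 := abs_sub_round x
        push_cast
        have : (round x : ℝ) - k = (x - k) - (x - round x) := by ring
        rw [this]
        exact (abs_sub _ _).trans (by linarith)
      have h2 : (1 + |((round x - k : ℤ) : ℝ)|) / 2 ≤ 1 + |x - k| := by
        linarith [abs_nonneg (x - k)]
      have h3 := Real.rpow_le_rpow_of_nonpos (by positivity) h2 (by linarith : -q ≤ 0)
      refine h3.trans (le_of_eq ?_)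
      rw [Real.div_rpow (by positivity) (by norm_num), Real.rpow_neg (x := 2) (by norm_num)]
      field_simp
    calc _ ≤ ∑ k ∈ S, 2 ^ q * (1 + |((round x - k : ℤ) : ℝ)|) ^ (-q) :=
          Finset.sum_le_sum fun k _ => hterm k
      _ = 2 ^ q * ∑ k ∈ S, (1 + |((round x - k : ℤ) : ℝ)|) ^ (-q) := by rw [Finset.mul_sum]
      _ = 2 ^ q * ∑ n ∈ S.image (fun k => round x - k), (1 + |(n : ℝ)|) ^ (-q) := by
          rw [Finset.sum_image fun a _ b _ h => by simpa using h]
      _ ≤ _ := by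
          gcongr
          exact hs.sum_le_tsum _ fun n _ => by positivity

theorem inv_one_add_sq_le (t : ℝ) : (1 + t ^ 2)⁻¹ ≤ 2 * (1 + |t|) ^ (-2 : ℝ) := by
  rw [Real.rpow_neg (by positivity), Real.rpow_two, ← div_eq_mul_inv, le_div_iff₀ (by positivity),
    ← div_eq_inv_mul, div_le_iff₀ (by positivity), ← sq_abs t]
  nlinarith [sq_nonneg (1 - |t|)]

theorem exists_sum_inv_one_add_sq_le : ∃ C : ℝ, 0 < C ∧
    ∀ (x : ℝ) (S : Finset ℤ), ∑ k ∈ S, (1 + (x - k) ^ 2)⁻¹ ≤ C := by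
  obtain ⟨C, hC, h⟩ := exists_sum_one_add_abs_sub_rpow_le (q := 2) (by norm_num)
  refine ⟨2 * C, by positivity, fun x S => ?_⟩
  calc _ ≤ ∑ k ∈ S, 2 * (1 + |x - k|) ^ (-2 : ℝ) :=
        Finset.sum_le_sum fun k _ => inv_one_add_sq_le _
    _ ≤ _ := by rw [← Finset.mul_sum]; gcongr; exact h x S

/-- Jensen's inequality for finite weighted sums. -/
theorem sum_mul_rpow_le {ι : Type*} (S : Finset ι) {w f : ι → ℝ} (hw : ∀ i ∈ S, 0 ≤ w i)
    (hf : ∀ i ∈ S, 0 ≤ f i) {p W : ℝ} (hp : 1 ≤ p) (hW : ∑ i ∈ S, w i ≤ W) :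
    (∑ i ∈ S, w i * f i) ^ p ≤ W ^ (p - 1) * ∑ i ∈ S, w i * f i ^ p := by
  classical
  have hp0 : 0 < p := by linarith
  -- The weights and values are extended by zero, since the weighted Hölder inequality asks for
  -- nonnegativity at every index.
  set w' : ι → ℝ := fun i => if i ∈ S then w i else 0
  set f' : ι → ℝ := fun i => if i ∈ S then f i else 0
  have h := Real.inner_le_weight_mul_Lp_of_nonneg S hp w' f'
    (fun i => by by_cases h : i ∈ S <;> simp [w', h, hw])
    (fun i => by by_cases h : i ∈ S <;> simp [f', h, hf])
  have e1 : ∑ i ∈ S, w' i * f' i = ∑ i ∈ S, w i * f i :=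
    Finset.sum_congr rfl fun i hi => by simp [w', f', hi]
  have e2 : ∑ i ∈ S, w' i = ∑ i ∈ S, w i :=
    Finset.sum_congr rfl fun i hi => by simp [w', hi]
  have e3 : ∑ i ∈ S, w' i * f' i ^ p = ∑ i ∈ S, w i * f i ^ p :=
    Finset.sum_congr rfl fun i hi => by simp [w', f', hi]
  rw [e1, e2, e3] at h
  have h0 : 0 ≤ ∑ i ∈ S, w i * f i := Finset.sum_nonneg fun i hi => mul_nonneg (hw i hi) (hf i hi)
  have h1 : 0 ≤ ∑ i ∈ S, w i := Finset.sum_nonneg hw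
  have h2 : 0 ≤ ∑ i ∈ S, w i * f i ^ p :=
    Finset.sum_nonneg fun i hi => mul_nonneg (hw i hi) (Real.rpow_nonneg (hf i hi) _)
  calc (∑ i ∈ S, w i * f i) ^ p
      ≤ ((∑ i ∈ S, w i) ^ (1 - p⁻¹) * (∑ i ∈ S, w i * f i ^ p) ^ p⁻¹) ^ p := by gcongr
    _ = (∑ i ∈ S, w i) ^ (p - 1) * ∑ i ∈ S, w i * f i ^ p := by
        rw [Real.mul_rpow (by positivity) (by positivity), ← Real.rpow_mul h1, ← Real.rpow_mul h2,
          inv_mul_cancel₀ hp0.ne', Real.rpow_one, sub_mul, one_mul, inv_mul_cancel₀ hp0.ne']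
    _ ≤ _ := by gcongr

theorem add_rpow_le_two_rpow_mul {a b p : ℝ} (ha : 0 ≤ a) (hb : 0 ≤ b) (hp : 0 ≤ p) :
    (a + b) ^ p ≤ 2 ^ p * (a ^ p + b ^ p) := by
  have h : (a + b) ^ p ≤ (2 * max a b) ^ p := by
    have h1 := le_max_left a b
    have h2 := le_max_right a b
    refine Real.rpow_le_rpow (by positivity) (by linarith) hp
  refine h.trans ?_
  rw [Real.mul_rpow (by norm_num) (le_max_of_le_left ha)]
  gcongr
  rcases max_choice a b with h | h <;> rw [h]
  · linarith [Real.rpow_nonneg hb p]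
  · linarith [Real.rpow_nonneg ha p]

end LatticeSums


/-! ### The discrete Hilbert transform on ℓ^p. -/

section DiscreteHilbert

/-- A Schur test: the Poisson kernels have sum over k at most W and integral π, so Jensen with these
weights and integration give W^{p-1} π. -/
theorem exists_integral_sum_inv_rpow_le {p : ℝ} (hp : 1 < p) : ∃ C : ℝ, 0 ≤ C ∧
    ∀ (S : Finset ℤ) (d : ℤ → ℝ), (∀ k ∈ S, 0 ≤ d k) →
      ∫ x : ℝ, (∑ k ∈ S, d k * (1 + (x - k) ^ 2)⁻¹) ^ p ≤ C * ∑ k ∈ S, d k ^ p := by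
  obtain ⟨W, hW, hsum⟩ := exists_sum_inv_one_add_sq_le
  refine ⟨W ^ (p - 1) * Real.pi, by positivity, fun S d hd => ?_⟩
  have hi : ∀ k : ℤ, Integrable fun x : ℝ => (1 + (x - k) ^ 2)⁻¹ := fun k =>
    integrable_inv_one_add_sq.comp_sub_right (k : ℝ)
  have hle : ∀ x : ℝ, (∑ k ∈ S, d k * (1 + (x - k) ^ 2)⁻¹) ^ p ≤
      W ^ (p - 1) * ∑ k ∈ S, (1 + (x - k) ^ 2)⁻¹ * d k ^ p := by
    intro x
    have := sum_mul_rpow_le S (w := fun k : ℤ => (1 + (x - k) ^ 2)⁻¹) (f := d)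
      (fun k _ => by positivity) hd hp.le (hsum x S)
    simpa only [mul_comm (d _)] using this
  have hib : Integrable fun x : ℝ => W ^ (p - 1) * ∑ k ∈ S, (1 + (x - k) ^ 2)⁻¹ * d k ^ p :=
    (integrable_finsetSum _ fun k _ => (hi k).mul_const _).const_mul _
  calc _ ≤ ∫ x : ℝ, W ^ (p - 1) * ∑ k ∈ S, (1 + (x - k) ^ 2)⁻¹ * d k ^ p := by
        refine integral_mono_of_nonneg (ae_of_all _ fun x => ?_) hib (ae_of_all _ hle)
        exact Real.rpow_nonneg (Finset.sum_nonneg fun k hk =>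
          mul_nonneg (hd k hk) (by positivity)) _
    _ = _ := by
        rw [integral_const_mul, integral_finsetSum _ fun k _ => (hi k).mul_const _]
        have : ∀ k : ℤ, ∫ x : ℝ, (1 + (x - k) ^ 2)⁻¹ * d k ^ p = Real.pi * d k ^ p := by
          intro k
          rw [integral_mul_const, integral_sub_right_eq_self (fun x : ℝ => (1 + x ^ 2)⁻¹) (k : ℝ),
            integral_univ_inv_one_add_sq]
        simp only [this]
        rw [← Finset.mul_sum, mul_assoc]

/-- The same Schur test with a sum over m in place of the integral; it absorbs the error terms made
when x is moved to an integer. -/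
theorem exists_sum_sum_inv_rpow_le {p : ℝ} (hp : 1 < p) : ∃ C : ℝ, 0 ≤ C ∧
    ∀ (S M : Finset ℤ) (d : ℤ → ℝ), (∀ k ∈ S, 0 ≤ d k) →
      ∑ m ∈ M, (∑ k ∈ S, d k * (1 + ((m : ℝ) - k) ^ 2)⁻¹) ^ p ≤ C * ∑ k ∈ S, d k ^ p := by
  obtain ⟨W, hW, hsum⟩ := exists_sum_inv_one_add_sq_le
  refine ⟨W ^ (p - 1) * W, by positivity, fun S M d hd => ?_⟩
  calc _ ≤ ∑ m ∈ M, W ^ (p - 1) * ∑ k ∈ S, (1 + ((m : ℝ) - k) ^ 2)⁻¹ * d k ^ p := by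
        refine Finset.sum_le_sum fun m _ => ?_
        have := sum_mul_rpow_le S (w := fun k : ℤ => (1 + ((m : ℝ) - k) ^ 2)⁻¹) (f := d)
          (fun k _ => by positivity) hd hp.le (hsum m S)
        simpa only [mul_comm (d _)] using this
    _ = W ^ (p - 1) * ∑ k ∈ S, (∑ m ∈ M, (1 + ((k : ℝ) - m) ^ 2)⁻¹) * d k ^ p := by
        rw [← Finset.mul_sum, Finset.sum_comm]
        congr 1
        refine Finset.sum_congr rfl fun k _ => ?_
        rw [Finset.sum_mul]
        refine Finset.sum_congr rfl fun m _ => ?_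
        congr 3
        ring
    _ ≤ W ^ (p - 1) * ∑ k ∈ S, W * d k ^ p := by
        gcongr with k hk
        · exact Real.rpow_nonneg (hd k hk) _
        · exact hsum k M
    _ = _ := by rw [← Finset.mul_sum, mul_assoc]

/-- The conjugate kernel is not summable, but its variation over half a unit is bounded by the
summable Poisson kernel. This allows passing between real points and the nearest integers. -/
theorem abs_conj_kernel_sub_le {s t : ℝ} (h : |t - s| ≤ 1 / 2) :
    |t * (1 + t ^ 2)⁻¹ - s * (1 + s ^ 2)⁻¹| ≤ (1 + s ^ 2)⁻¹ := by
  have ht : (0 : ℝ) < 1 + t ^ 2 := by positivity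
  have hs : (0 : ℝ) < 1 + s ^ 2 := by positivity
  have he : t * (1 + t ^ 2)⁻¹ - s * (1 + s ^ 2)⁻¹ =
      ((t - s) * (1 - t * s)) * ((1 + t ^ 2)⁻¹ * (1 + s ^ 2)⁻¹) := by
    field_simp
    ring
  rw [he, abs_mul, abs_of_pos (show (0 : ℝ) < (1 + t ^ 2)⁻¹ * (1 + s ^ 2)⁻¹ by positivity),
    ← mul_assoc]
  refine mul_le_of_le_one_left (by positivity) ?_
  rw [← div_eq_mul_inv, div_le_one ht, abs_mul]
  have h1 : |1 - t * s| ≤ 1 + |t| * |s| := by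
    rw [← abs_mul]
    refine (abs_sub _ _).trans ?_
    rw [abs_one]
  have h2 : |s| ≤ |t| + 1 / 2 := by
    have := abs_sub_abs_le_abs_sub s t
    rw [abs_sub_comm] at h
    linarith
  have h3 : |t| * |s| ≤ |t| * (|t| + 1 / 2) := by gcongr
  calc |t - s| * |1 - t * s| ≤ 1 / 2 * (1 + |t| * |s|) := by gcongr
    _ ≤ 1 / 2 * (1 + |t| * (|t| + 1 / 2)) := by gcongr
    _ ≤ 1 + t ^ 2 := by
        rw [← sq_abs t]
        nlinarith [sq_nonneg (|t| - 1 / 4)]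

theorem abs_sub_le_of_mem_Ioc {x : ℝ} {m : ℤ}
    (hx : x ∈ Set.Ioc ((-(1 / 2) : ℝ) + m) (-(1 / 2) + m + 1)) :
    |x - m| ≤ 1 / 2 := by
  rw [abs_le]
  constructor <;> linarith [hx.1, hx.2]

theorem sum_le_integral_of_le_on_Ioc {G : ℝ → ℝ} (hG : Integrable G) (hG0 : ∀ x, 0 ≤ G x)
    {a : ℤ → ℝ} (M : Finset ℤ)
    (h : ∀ m ∈ M, ∀ x ∈ Set.Ioc ((-(1 / 2) : ℝ) + m) (-(1 / 2) + m + 1), a m ≤ G x) :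
    ∑ m ∈ M, a m ≤ ∫ x, G x := by
  have hdis := Set.pairwise_disjoint_Ioc_add_intCast (-(1 / 2) : ℝ)
  calc ∑ m ∈ M, a m ≤ ∑ m ∈ M, ∫ x in Set.Ioc ((-(1 / 2) : ℝ) + m) (-(1 / 2) + m + 1), G x := by
        refine Finset.sum_le_sum fun m hm => ?_
        have h1 : ∫ x in Set.Ioc ((-(1 / 2) : ℝ) + m) (-(1 / 2) + m + 1), a m = a m := by
          rw [setIntegral_const]
          simp [Measure.real]
        rw [← h1]
        refine setIntegral_mono_on (by simp) hG.integrableOn measurableSet_Ioc fun x hx => h m hm x hx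
    _ = ∫ x in ⋃ m ∈ M, Set.Ioc ((-(1 / 2) : ℝ) + m) (-(1 / 2) + m + 1), G x := by
        rw [integral_biUnion_finset M (fun _ _ => measurableSet_Ioc)
          (fun i _ j _ hij => hdis hij) fun _ _ => hG.integrableOn]
    _ ≤ ∫ x, G x := setIntegral_le_integral hG (ae_of_all _ hG0)

/-- The discrete Hilbert transform, with the kernel `n / (1 + n²)`. -/
noncomputable def discreteHilbert (S : Finset ℤ) (d : ℤ → ℝ) (x : ℝ) : ℝ :=
  ∑ k ∈ S, d k * ((x - k) * (1 + (x - k) ^ 2)⁻¹)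

theorem abs_discreteHilbert_sub_le (S : Finset ℤ) (d : ℤ → ℝ) {x : ℝ} {m : ℤ}
    (hx : |x - m| ≤ 1 / 2) :
    |discreteHilbert S d x - discreteHilbert S d m| ≤
      ∑ k ∈ S, |d k| * (1 + ((m : ℝ) - k) ^ 2)⁻¹ := by
  rw [discreteHilbert, discreteHilbert, ← Finset.sum_sub_distrib]
  refine (Finset.abs_sum_le_sum_abs _ _).trans (Finset.sum_le_sum fun k _ => ?_)
  rw [← mul_sub, abs_mul]
  gcongr
  exact abs_conj_kernel_sub_le (by simpa using hx)

/-- The imaginary part of the Cauchy sum at x + i is the discrete transform extended to real x.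
Riesz' inequality bounds it on the line by the Poisson sums, and moving from x to the nearest
integer m costs only E m, which is bounded in ℓ^p. -/
theorem exists_sum_discreteHilbert_nonneg_le {p : ℝ} (hp1 : 1 < p) (hp2 : p ≤ 2) :
    ∃ C : ℝ, 0 ≤ C ∧ ∀ (S M : Finset ℤ) (d : ℤ → ℝ), (∀ k ∈ S, 0 ≤ d k) →
      ∑ m ∈ M, |discreteHilbert S d m| ^ p ≤ C * ∑ k ∈ S, d k ^ p := by
  obtain ⟨A, hA, hR⟩ := exists_integral_abs_im_cauchySum_le hp1 hp2
  obtain ⟨C₁, hC₁, h1⟩ := exists_integral_sum_inv_rpow_le hp1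
  obtain ⟨C₂, hC₂, h2⟩ := exists_sum_sum_inv_rpow_le hp1
  have hp0 : 0 ≤ p := by linarith
  refine ⟨2 ^ p * (A * C₁ + C₂), by positivity, fun S M d hd => ?_⟩
  set E : ℤ → ℝ := fun m => ∑ k ∈ S, d k * (1 + ((m : ℝ) - k) ^ 2)⁻¹ with hE
  have hE0 : ∀ m, 0 ≤ E m := fun m =>
    Finset.sum_nonneg fun k hk => mul_nonneg (hd k hk) (by positivity)
  have hv : ∀ x : ℝ, (cauchySum S d (x + Complex.I)).im = discreteHilbert S d x :=
    fun x => cauchySum_add_I_im x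
  have hi : Integrable fun x : ℝ => |discreteHilbert S d x| ^ p := by
    refine (integrable_norm_cauchySum_rpow (S := S) (d := d) hp1).mono'
      (Continuous.aestronglyMeasurable ?_) (ae_of_all _ fun x => ?_)
    · simp only [← hv]
      exact (Complex.continuous_im.comp continuous_cauchySum_add_I).abs.rpow_const
        fun x => Or.inr hp0
    · rw [Real.norm_of_nonneg (by positivity), ← hv]
      gcongr
      exact Complex.abs_im_le_norm _
  -- The error is kept on the left so that the left side is constant on the unit interval around m
  -- and can be compared with an integral.
  have hpt : ∀ m : ℤ, ∀ x ∈ Set.Ioc ((-(1 / 2) : ℝ) + m) (-(1 / 2) + m + 1),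
      |discreteHilbert S d m| ^ p - 2 ^ p * E m ^ p ≤ 2 ^ p * |discreteHilbert S d x| ^ p := by
    intro m x hx
    have h3 := abs_discreteHilbert_sub_le S d (abs_sub_le_of_mem_Ioc hx)
    have h4 : ∑ k ∈ S, |d k| * (1 + ((m : ℝ) - k) ^ 2)⁻¹ = E m :=
      Finset.sum_congr rfl fun k hk => by rw [abs_of_nonneg (hd k hk)]
    rw [h4] at h3
    have h5 : |discreteHilbert S d m| ≤ |discreteHilbert S d x| + E m := by
      have := abs_sub_abs_le_abs_sub (discreteHilbert S d m) (discreteHilbert S d x)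
      rw [abs_sub_comm] at h3
      linarith
    have h6 := (Real.rpow_le_rpow (abs_nonneg _) h5 hp0).trans
      (add_rpow_le_two_rpow_mul (abs_nonneg _) (hE0 m) hp0)
    linarith
  have hmain := sum_le_integral_of_le_on_Ioc (hi.const_mul (2 ^ p)) (fun x => by positivity) M
    fun m _ => hpt m
  rw [Finset.sum_sub_distrib, ← Finset.mul_sum, integral_const_mul] at hmain
  have h7 := hR S d hd
  simp only [hv, cauchySum_add_I_re] at h7
  have h8 := h1 S d hd
  have h9 := h2 S M d hd
  calc ∑ m ∈ M, |discreteHilbert S d m| ^ p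
      ≤ 2 ^ p * (∫ x : ℝ, |discreteHilbert S d x| ^ p) + 2 ^ p * ∑ m ∈ M, E m ^ p := by linarith
    _ ≤ 2 ^ p * (A * (C₁ * ∑ k ∈ S, d k ^ p)) + 2 ^ p * (C₂ * ∑ k ∈ S, d k ^ p) := by
        gcongr
        exact h7.trans (by gcongr)
    _ = _ := by ring

/-- Nonnegative coefficients were needed to stay in the right half plane; real ones are split into
positive and negative parts. -/
theorem exists_sum_discreteHilbert_le_of_le_two {p : ℝ} (hp1 : 1 < p) (hp2 : p ≤ 2) :
    ∃ C : ℝ, 0 ≤ C ∧ ∀ (S M : Finset ℤ) (d : ℤ → ℝ),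
      ∑ m ∈ M, |discreteHilbert S d m| ^ p ≤ C * ∑ k ∈ S, |d k| ^ p := by
  obtain ⟨C, hC, h⟩ := exists_sum_discreteHilbert_nonneg_le hp1 hp2
  have hp0 : 0 ≤ p := by linarith
  refine ⟨2 ^ p * (C + C), by positivity, fun S M d => ?_⟩
  have hsplit : ∀ x, discreteHilbert S d x =
      discreteHilbert S (fun k => max (d k) 0) x - discreteHilbert S (fun k => max (-d k) 0) x := by
    intro x
    rw [discreteHilbert, discreteHilbert, discreteHilbert, ← Finset.sum_sub_distrib]
    refine Finset.sum_congr rfl fun k _ => ?_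
    rw [← sub_mul, max_zero_sub_max_neg_zero_eq_self]
  have hb : ∀ e : ℤ → ℝ, (∀ k, 0 ≤ e k ∧ e k ≤ |d k|) →
      ∑ m ∈ M, |discreteHilbert S e m| ^ p ≤ C * ∑ k ∈ S, |d k| ^ p := by
    intro e he
    refine (h S M e fun k _ => (he k).1).trans ?_
    gcongr with k
    · exact (he k).1
    · exact (he k).2
  calc _ ≤ ∑ m ∈ M, 2 ^ p * (|discreteHilbert S (fun k => max (d k) 0) m| ^ p +
        |discreteHilbert S (fun k => max (-d k) 0) m| ^ p) := by
        refine Finset.sum_le_sum fun m _ => ?_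
        rw [hsplit]
        exact (Real.rpow_le_rpow (abs_nonneg _) (abs_sub _ _) hp0).trans
          (add_rpow_le_two_rpow_mul (abs_nonneg _) (abs_nonneg _) hp0)
    _ ≤ 2 ^ p * (C * ∑ k ∈ S, |d k| ^ p + C * ∑ k ∈ S, |d k| ^ p) := by
        rw [← Finset.mul_sum, Finset.sum_add_distrib]
        gcongr
        · exact hb _ fun k => ⟨le_max_right _ _, max_le (le_abs_self _) (abs_nonneg _)⟩
        · exact hb _ fun k => ⟨le_max_right _ _, max_le (neg_le_abs _) (abs_nonneg _)⟩
    _ = _ := by ring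

/-- The kernel is odd, so the transform is skew-adjoint; this is what the duality argument for p > 2
uses. -/
theorem sum_mul_discreteHilbert (S M : Finset ℤ) (d e : ℤ → ℝ) :
    ∑ m ∈ M, e m * discreteHilbert S d m = -∑ k ∈ S, d k * discreteHilbert M e k := by
  simp only [discreteHilbert, Finset.mul_sum]
  rw [Finset.sum_comm, ← Finset.sum_neg_distrib]
  refine Finset.sum_congr rfl fun k _ => ?_
  rw [← Finset.sum_neg_distrib]
  refine Finset.sum_congr rfl fun m _ => ?_
  have : ((m : ℝ) - k) ^ 2 = ((k : ℝ) - m) ^ 2 := by ring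
  rw [this]
  ring

/-- The discrete Hilbert transform is bounded on `ℓ^p` for `1 < p < ∞`. -/
theorem exists_sum_discreteHilbert_le {p : ℝ} (hp1 : 1 < p) :
    ∃ C : ℝ, 0 ≤ C ∧ ∀ (S M : Finset ℤ) (d : ℤ → ℝ),
      ∑ m ∈ M, |discreteHilbert S d m| ^ p ≤ C * ∑ k ∈ S, |d k| ^ p := by
  rcases le_total p 2 with hp2 | hp2
  · exact exists_sum_discreteHilbert_le_of_le_two hp1 hp2
  have hpq : p.HolderConjugate p.conjExponent := Real.HolderConjugate.conjExponent hp1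
  set q := p.conjExponent with hq
  have hq2 : q ≤ 2 := by
    rw [hq, Real.conjExponent, div_le_iff₀ (by linarith)]
    linarith
  obtain ⟨C, hC, h⟩ := exists_sum_discreteHilbert_le_of_le_two hpq.symm.lt hq2
  have hp0 : 0 < p := by linarith
  have hq0 : 0 < q := hpq.symm.pos
  refine ⟨(C ^ (1 / q)) ^ p, by positivity, fun S M d => ?_⟩
  set X := ∑ m ∈ M, |discreteHilbert S d m| ^ p with hX
  set D := ∑ k ∈ S, |d k| ^ p with hD
  have hX0 : 0 ≤ X := Finset.sum_nonneg fun m _ => by positivity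
  have hD0 : 0 ≤ D := Finset.sum_nonneg fun m _ => by positivity
  rcases hX0.eq_or_lt with hX1 | hX1
  · rw [← hX1]; positivity
  -- The extremal sequence for the duality between ℓ^p and ℓ^q: its pairing with the transform is X,
  -- and its q-th power sum is at most X since (p - 1)q = p.
  set e : ℤ → ℝ := fun m => SignType.sign (discreteHilbert S d m) *
    |discreteHilbert S d m| ^ (p - 1) with he
  have hXe : X = ∑ m ∈ M, e m * discreteHilbert S d m := by
    refine Finset.sum_congr rfl fun m _ => ?_
    rw [he]
    simp only
    rw [mul_right_comm, sign_mul_self]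
    rcases eq_or_ne (discreteHilbert S d m) 0 with h0 | h0
    · rw [h0]; simp [hp0.ne']
    · conv_rhs => rw [mul_comm, ← Real.rpow_add_one (abs_ne_zero.2 h0)]
      rw [sub_add_cancel]
  have heq : ∑ m ∈ M, |e m| ^ q ≤ X := by
    refine Finset.sum_le_sum fun m _ => ?_
    have h1 : |e m| ≤ |discreteHilbert S d m| ^ (p - 1) := by
      rw [he]
      simp only
      rw [abs_mul, abs_of_nonneg (Real.rpow_nonneg (abs_nonneg _) _)]
      refine mul_le_of_le_one_left (by positivity) ?_
      rcases lt_trichotomy (discreteHilbert S d m) 0 with h | h | h <;> simp [h]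
    calc |e m| ^ q ≤ (|discreteHilbert S d m| ^ (p - 1)) ^ q := by gcongr
      _ = |discreteHilbert S d m| ^ p := by
          rw [← Real.rpow_mul (abs_nonneg _), hpq.sub_one_mul_conj]
  have hH := Real.inner_le_Lp_mul_Lq S d (fun k => -discreteHilbert M e k) hpq
  have h2 : X ≤ D ^ (1 / p) * (C * X) ^ (1 / q) := by
    calc X = ∑ k ∈ S, d k * -discreteHilbert M e k := by
          rw [hXe, sum_mul_discreteHilbert, ← Finset.sum_neg_distrib]
          simp only [mul_neg]
      _ ≤ _ := hH
      _ ≤ D ^ (1 / p) * (C * X) ^ (1 / q) := by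
          simp only [abs_neg]
          gcongr
          exact (h M S e).trans (by gcongr)
  have h3 : X ^ (1 / p) ≤ D ^ (1 / p) * C ^ (1 / q) := by
    have h4 : X ^ (1 / p) * X ^ (1 / q) = X := by
      rw [← Real.rpow_add hX1, one_div, one_div, hpq.inv_add_inv_eq_one, Real.rpow_one]
    rw [Real.mul_rpow hC hX0, ← mul_assoc] at h2
    nth_rewrite 1 [← h4] at h2
    exact le_of_mul_le_mul_right h2 (by positivity)
  calc X = (X ^ (1 / p)) ^ p := by
        rw [← Real.rpow_mul hX0, one_div_mul_cancel hp0.ne', Real.rpow_one]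
    _ ≤ (D ^ (1 / p) * C ^ (1 / q)) ^ p := by gcongr
    _ = _ := by
        rw [Real.mul_rpow (by positivity) (by positivity), ← Real.rpow_mul hD0,
          one_div_mul_cancel hp0.ne', Real.rpow_one, mul_comm]

end DiscreteHilbert


/-! ### Boundedness of the cardinal series from ℓ^p to L^p. -/

section SincSeries

/-- Since 1/t - t/(1 + t²) = 1/(t(1 + t²)), the difference is sinc(πt)/(1 + t²). So up to a Poisson
kernel sinc is sin(πt)/π times the kernel of the discrete Hilbert transform. -/
theorem abs_sinc_pi_mul_sub_le (t : ℝ) :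
    |Real.sinc (Real.pi * t) - Real.sin (Real.pi * t) / Real.pi * (t * (1 + t ^ 2)⁻¹)| ≤
      (1 + t ^ 2)⁻¹ := by
  have hpi := Real.pi_pos
  have h1 : (0 : ℝ) < 1 + t ^ 2 := by positivity
  rcases eq_or_ne t 0 with rfl | ht
  · simp
  · have hne : Real.pi * t ≠ 0 := by positivity
    have he : Real.sinc (Real.pi * t) - Real.sin (Real.pi * t) / Real.pi * (t * (1 + t ^ 2)⁻¹) =
        Real.sinc (Real.pi * t) * (1 + t ^ 2)⁻¹ := by
      rw [Real.sinc_of_ne_zero hne]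
      field_simp
      ring
    rw [he, abs_mul, abs_of_pos (show (0 : ℝ) < (1 + t ^ 2)⁻¹ by positivity)]
    exact mul_le_of_le_one_left (by positivity) (Real.abs_sinc_le_one _)

theorem inv_one_add_sq_le_two_mul {s t : ℝ} (h : |t - s| ≤ 1 / 2) :
    (1 + t ^ 2)⁻¹ ≤ 2 * (1 + s ^ 2)⁻¹ := by
  rw [← div_eq_mul_inv, le_div_iff₀ (by positivity), ← div_eq_inv_mul, div_le_iff₀ (by positivity)]
  have := abs_le.1 h
  nlinarith [sq_nonneg (t - (s - t)), sq_nonneg (t - s)]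

/-- As sin(π(x - k)) = (-1)^k sin(πx), the sine leaves the sum and a discrete Hilbert transform of
(-1)^k c_k remains. The constant 4 collects one error for each of the real and imaginary parts in
moving x to m, and two from replacing sinc by the kernel. -/
theorem norm_sum_mul_sinc_le (S : Finset ℤ) (c : ℤ → ℂ) {x : ℝ} {m : ℤ} (hx : |x - m| ≤ 1 / 2) :
    ‖∑ k ∈ S, c k * (Real.sinc (Real.pi * (x - k)) : ℂ)‖ ≤
      |discreteHilbert S (fun k => ((-1) ^ k * c k).re) m| +
      |discreteHilbert S (fun k => ((-1) ^ k * c k).im) m| +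
      4 * ∑ k ∈ S, ‖c k‖ * (1 + ((m : ℝ) - k) ^ 2)⁻¹ := by
  have hpi := Real.pi_pos
  set e : ℤ → ℂ := fun k => (-1) ^ k * c k with he
  have hen : ∀ k, ‖e k‖ = ‖c k‖ := fun k => by simp [he]
  set E := ∑ k ∈ S, ‖c k‖ * (1 + ((m : ℝ) - k) ^ 2)⁻¹ with hE
  set h : ℤ → ℝ := fun k => (x - k) * (1 + (x - k) ^ 2)⁻¹ with hh
  have hsin : ∀ k : ℤ, Real.sin (Real.pi * (x - k)) = (-1) ^ k * Real.sin (Real.pi * x) := by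
    intro k
    rw [mul_sub, mul_comm Real.pi (k : ℝ), Real.sin_sub_int_mul_pi]
  have hsplit : ∑ k ∈ S, c k * (Real.sinc (Real.pi * (x - k)) : ℂ) =
      ((Real.sin (Real.pi * x) / Real.pi : ℝ) : ℂ) * ∑ k ∈ S, e k * (h k : ℂ) +
      ∑ k ∈ S, c k * ((Real.sinc (Real.pi * (x - k)) -
        Real.sin (Real.pi * (x - k)) / Real.pi * h k : ℝ) : ℂ) := by
    rw [Finset.mul_sum, ← Finset.sum_add_distrib]
    refine Finset.sum_congr rfl fun k _ => ?_
    rw [hsin, he]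
    push_cast
    ring
  have hre : (∑ k ∈ S, e k * (h k : ℂ)).re = discreteHilbert S (fun k => (e k).re) x := by
    rw [Complex.re_sum, discreteHilbert]
    exact Finset.sum_congr rfl fun k _ => Complex.re_mul_ofReal _ _
  have him : (∑ k ∈ S, e k * (h k : ℂ)).im = discreteHilbert S (fun k => (e k).im) x := by
    rw [Complex.im_sum, discreteHilbert]
    exact Finset.sum_congr rfl fun k _ => Complex.im_mul_ofReal _ _
  have hcmp : ∀ d : ℤ → ℝ, (∀ k, |d k| ≤ ‖c k‖) →
      |discreteHilbert S d x| ≤ |discreteHilbert S d m| + E := by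
    intro d hd
    have h1 := abs_discreteHilbert_sub_le S d hx
    have h2 : ∑ k ∈ S, |d k| * (1 + ((m : ℝ) - k) ^ 2)⁻¹ ≤ E := by
      refine Finset.sum_le_sum fun k _ => ?_
      gcongr
      exact hd k
    have := abs_sub_abs_le_abs_sub (discreteHilbert S d x) (discreteHilbert S d m)
    linarith
  have h1 : ‖((Real.sin (Real.pi * x) / Real.pi : ℝ) : ℂ) * ∑ k ∈ S, e k * (h k : ℂ)‖ ≤
      |discreteHilbert S (fun k => (e k).re) m| + |discreteHilbert S (fun k => (e k).im) m| +
        2 * E := by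
    rw [norm_mul, Complex.norm_real, Real.norm_eq_abs]
    have h3 : |Real.sin (Real.pi * x) / Real.pi| ≤ 1 := by
      rw [abs_div, abs_of_pos hpi, div_le_one hpi]
      linarith [Real.abs_sin_le_one (Real.pi * x), Real.pi_gt_three]
    refine (mul_le_of_le_one_left (norm_nonneg _) h3).trans
      ((Complex.norm_le_abs_re_add_abs_im _).trans ?_)
    rw [hre, him]
    have a := hcmp (fun k => (e k).re) fun k => (Complex.abs_re_le_norm _).trans (hen k).le
    have b := hcmp (fun k => (e k).im) fun k => (Complex.abs_im_le_norm _).trans (hen k).le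
    linarith
  have h2 : ‖∑ k ∈ S, c k * ((Real.sinc (Real.pi * (x - k)) -
        Real.sin (Real.pi * (x - k)) / Real.pi * h k : ℝ) : ℂ)‖ ≤ 2 * E := by
    rw [hE, Finset.mul_sum]
    refine norm_sum_le_of_le _ fun k _ => ?_
    rw [norm_mul, Complex.norm_real, Real.norm_eq_abs,
      show 2 * (‖c k‖ * (1 + ((m : ℝ) - k) ^ 2)⁻¹) = ‖c k‖ * (2 * (1 + ((m : ℝ) - k) ^ 2)⁻¹) by ring]
    refine mul_le_mul_of_nonneg_left ?_ (norm_nonneg _)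
    exact (abs_sinc_pi_mul_sub_le _).trans (inv_one_add_sq_le_two_mul (by simpa using hx))
  rw [hsplit]
  refine (norm_add_le _ _).trans ?_
  linarith

/-- The cardinal series is bounded from `ℓ^p` to `L^p(ℝ)`. -/
theorem exists_lintegral_sum_mul_sinc_le {p : ℝ} (hp : 1 < p) : ∃ C : NNReal,
    ∀ (S : Finset ℤ) (c : ℤ → ℂ),
      ∫⁻ x : ℝ, ‖∑ k ∈ S, c k * (Real.sinc (Real.pi * (x - k)) : ℂ)‖ₑ ^ p ≤
        C * ∑ k ∈ S, ‖c k‖ₑ ^ p := by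
  obtain ⟨C₁, hC₁, h1⟩ := exists_sum_discreteHilbert_le hp
  obtain ⟨C₂, hC₂, h2⟩ := exists_sum_sum_inv_rpow_le hp
  have hp0 : 0 ≤ p := by linarith
  set K := 2 ^ p * (2 ^ p * (C₁ + C₁) + 4 ^ p * C₂) with hK
  have hK0 : 0 ≤ K := by positivity
  refine ⟨⟨K, hK0⟩, fun S c => ?_⟩
  set a : ℤ → ℝ := fun m => |discreteHilbert S (fun k => ((-1) ^ k * c k).re) m|
  set b : ℤ → ℝ := fun m => |discreteHilbert S (fun k => ((-1) ^ k * c k).im) m|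
  set E : ℤ → ℝ := fun m => ∑ k ∈ S, ‖c k‖ * (1 + ((m : ℝ) - k) ^ 2)⁻¹
  have ha : ∀ m, 0 ≤ a m := fun m => abs_nonneg _
  have hb : ∀ m, 0 ≤ b m := fun m => abs_nonneg _
  have hE : ∀ m, 0 ≤ E m := fun m => Finset.sum_nonneg fun k _ => by positivity
  set D := ∑ k ∈ S, ‖c k‖ ^ p with hD
  have hsum : ∀ M : Finset ℤ, ∑ m ∈ M, (a m + b m + 4 * E m) ^ p ≤ K * D := by
    intro M
    have hd : ∀ d : ℤ → ℝ, (∀ k, |d k| ≤ ‖c k‖) → C₁ * ∑ k ∈ S, |d k| ^ p ≤ C₁ * D := by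
      intro d hd
      rw [hD]
      gcongr
      exact hd _
    have A := (h1 S M (fun k => ((-1) ^ k * c k).re)).trans
      (hd _ fun k => (Complex.abs_re_le_norm _).trans (by simp))
    have B := (h1 S M (fun k => ((-1) ^ k * c k).im)).trans
      (hd _ fun k => (Complex.abs_im_le_norm _).trans (by simp))
    have G := h2 S M (fun k => ‖c k‖) fun _ _ => norm_nonneg _
    calc _ ≤ ∑ m ∈ M, 2 ^ p * (2 ^ p * (a m ^ p + b m ^ p) + 4 ^ p * E m ^ p) := by
          refine Finset.sum_le_sum fun m _ => ?_
          have := hE m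
          refine (add_rpow_le_two_rpow_mul (add_nonneg (ha m) (hb m)) (by positivity) hp0).trans ?_
          rw [Real.mul_rpow (by norm_num) (hE m)]
          gcongr
          exact add_rpow_le_two_rpow_mul (ha m) (hb m) hp0
      _ = 2 ^ p * (2 ^ p * (∑ m ∈ M, a m ^ p + ∑ m ∈ M, b m ^ p) +
            4 ^ p * ∑ m ∈ M, E m ^ p) := by
          rw [← Finset.mul_sum, Finset.sum_add_distrib, ← Finset.mul_sum, ← Finset.mul_sum,
            Finset.sum_add_distrib]
      _ ≤ 2 ^ p * (2 ^ p * (C₁ * D + C₁ * D) + 4 ^ p * (C₂ * D)) := by gcongr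
      _ = _ := by rw [hK]; ring
  have hcov := iUnion_Ioc_add_intCast (-(1 / 2) : ℝ)
  have hdis := Set.pairwise_disjoint_Ioc_add_intCast (-(1 / 2) : ℝ)
  calc _ = ∑' m : ℤ, ∫⁻ x in Set.Ioc ((-(1 / 2) : ℝ) + m) (-(1 / 2) + m + 1),
          ‖∑ k ∈ S, c k * (Real.sinc (Real.pi * (x - k)) : ℂ)‖ₑ ^ p := by
        rw [← lintegral_iUnion (fun _ => measurableSet_Ioc) hdis, hcov, Measure.restrict_univ]
    _ ≤ ∑' m : ℤ, ENNReal.ofReal ((a m + b m + 4 * E m) ^ p) := by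
        refine ENNReal.tsum_le_tsum fun m => ?_
        calc _ ≤ ∫⁻ x in Set.Ioc ((-(1 / 2) : ℝ) + m) (-(1 / 2) + m + 1),
              ENNReal.ofReal ((a m + b m + 4 * E m) ^ p) := by
              refine setLIntegral_mono measurable_const fun x hx => ?_
              have := norm_sum_mul_sinc_le S c (abs_sub_le_of_mem_Ioc hx)
              rw [← ofReal_norm, ENNReal.ofReal_rpow_of_nonneg (norm_nonneg _) hp0]
              exact ENNReal.ofReal_le_ofReal (Real.rpow_le_rpow (norm_nonneg _) this hp0)
          _ = _ := by
              rw [setLIntegral_const, Real.volume_Ioc]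
              simp
    _ ≤ ENNReal.ofReal (K * D) := by
        refine ENNReal.summable.tsum_le_of_sum_le fun M => ?_
        rw [← ENNReal.ofReal_sum_of_nonneg fun m _ => Real.rpow_nonneg
          (add_nonneg (add_nonneg (ha m) (hb m)) (mul_nonneg (by norm_num) (hE m))) _]
        exact ENNReal.ofReal_le_ofReal (hsum M)
    _ = _ := by
        rw [ENNReal.ofReal_mul hK0, hD, ENNReal.ofReal_sum_of_nonneg fun k _ => by positivity]
        congr 1
        · exact ENNReal.ofReal_eq_coe_nnreal hK0
        · refine Finset.sum_congr rfl fun k _ => ?_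
          rw [← ofReal_norm, ENNReal.ofReal_rpow_of_nonneg (norm_nonneg _) hp0]

theorem exists_lintegral_sum_mul_sinc_scaled_le {p : ℝ} (hp : 1 < p) : ∃ C : NNReal,
    ∀ {a : ℝ}, 0 < a → ∀ (S : Finset ℤ) (c : ℤ → ℂ),
      ∫⁻ x : ℝ, ‖∑ k ∈ S, c k * (Real.sinc (Real.pi * (x - a * k) / a) : ℂ)‖ₑ ^ p ≤
        ENNReal.ofReal a * C * ∑ k ∈ S, ‖c k‖ₑ ^ p := by
  obtain ⟨C, h⟩ := exists_lintegral_sum_mul_sinc_le hp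
  refine ⟨C, fun {a} ha S c => ?_⟩
  have hmeas : Measurable fun x : ℝ =>
      ‖∑ k ∈ S, c k * (Real.sinc (Real.pi * (x - k)) : ℂ)‖ₑ ^ p := by
    have := Real.continuous_sinc
    have h1 : Continuous fun x : ℝ => ∑ k ∈ S, c k * (Real.sinc (Real.pi * (x - k)) : ℂ) := by
      fun_prop
    exact h1.measurable.enorm.pow_const p
  have h2 := lintegral_map hmeas (measurable_const_mul (a⁻¹)) (μ := (volume : Measure ℝ))
  rw [Real.map_volume_mul_left (inv_ne_zero ha.ne'), inv_inv, abs_of_pos ha,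
    lintegral_smul_measure] at h2
  calc _ = ∫⁻ x : ℝ, ‖∑ k ∈ S, c k * (Real.sinc (Real.pi * (a⁻¹ * x - k)) : ℂ)‖ₑ ^ p := by
        refine lintegral_congr fun x => ?_
        congr 2
        refine Finset.sum_congr rfl fun k _ => ?_
        congr 3
        field_simp
    _ = _ := h2.symm
    _ ≤ _ := by
        rw [smul_eq_mul, mul_assoc]
        gcongr
        exact h S c

theorem sum_piFinset_fin_succ {n : ℕ} (t : Finset ℤ) {M : Type*} [AddCommMonoid M]
    (F : (Fin (n + 1) → ℤ) → M) :
    ∑ k ∈ Fintype.piFinset (fun _ : Fin (n + 1) => t), F k =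
      ∑ i ∈ t, ∑ k ∈ Fintype.piFinset (fun _ : Fin n => t), F (Fin.cons i k) := by
  rw [← Finset.sum_product']
  refine Finset.sum_nbij' (fun k => (k 0, Fin.tail k)) (fun q => Fin.cons q.1 q.2) ?_ ?_ ?_ ?_ ?_
  · intro k hk
    rw [Fintype.mem_piFinset] at hk
    simp only [Finset.mem_product, Fintype.mem_piFinset]
    exact ⟨hk 0, fun i => hk i.succ⟩
  · intro q hq
    simp only [Finset.mem_product, Fintype.mem_piFinset] at hq
    rw [Fintype.mem_piFinset]
    intro i
    refine Fin.cases ?_ (fun j => ?_) i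
    · simpa using hq.1
    · simpa using hq.2 j
  · intro k _
    exact Fin.cons_self_tail k
  · intro q _
    simp
  · intro k _
    simp

/-- Iteration over the coordinates: with the others frozen, the one-dimensional bound applies in the
first one with the inner sums as coefficients, and these are bounded by induction. -/
theorem lintegral_sum_mul_prod_sinc_fin_le {p : ℝ} {C : NNReal}
    (hC : ∀ {a : ℝ}, 0 < a → ∀ (S : Finset ℤ) (c : ℤ → ℂ),
      ∫⁻ x : ℝ, ‖∑ k ∈ S, c k * (Real.sinc (Real.pi * (x - a * k) / a) : ℂ)‖ₑ ^ p ≤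
        ENNReal.ofReal a * C * ∑ k ∈ S, ‖c k‖ₑ ^ p)
    (n : ℕ) (A : Fin n → ℝ) (hA : ∀ i, 0 < A i) (t : Finset ℤ) (c : (Fin n → ℤ) → ℂ) :
    ∫⁻ x : Fin n → ℝ, ‖∑ k ∈ Fintype.piFinset (fun _ : Fin n => t), c k *
      ∏ i, (Real.sinc (Real.pi * (x i - A i * k i) / A i) : ℂ)‖ₑ ^ p ≤
      (∏ i, ENNReal.ofReal (A i) * C) *
        ∑ k ∈ Fintype.piFinset (fun _ : Fin n => t), ‖c k‖ₑ ^ p := by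
  have hsinc := Real.continuous_sinc
  induction n with
  | zero =>
    have : Fintype.piFinset (fun _ : Fin 0 => t) = {default} := by
      refine Finset.eq_singleton_iff_unique_mem.2 ⟨?_, fun k _ => Subsingleton.elim _ _⟩
      rw [Fintype.mem_piFinset]
      exact fun i => i.elim0
    rw [this]
    simp [volume_pi]
  | succ n ih =>
    set P := Fintype.piFinset (fun _ : Fin n => t) with hP
    have hmp := (volume_preserving_piFinSuccAbove (fun _ : Fin (n + 1) => ℝ) 0).symm
    set F : (Fin (n + 1) → ℝ) → ℝ≥0∞ := fun x =>
      ‖∑ k ∈ Fintype.piFinset (fun _ : Fin (n + 1) => t), c k *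
        ∏ i, (Real.sinc (Real.pi * (x i - A i * k i) / A i) : ℂ)‖ₑ ^ p with hF
    have hFm : Measurable F := by
      have h1 : Continuous fun x : Fin (n + 1) → ℝ =>
          ∑ k ∈ Fintype.piFinset (fun _ : Fin (n + 1) => t), c k *
            ∏ i, (Real.sinc (Real.pi * (x i - A i * k i) / A i) : ℂ) := by
        fun_prop
      exact h1.measurable.enorm.pow_const p
    rw [← hmp.lintegral_comp hFm]
    rw [Measure.volume_eq_prod, lintegral_prod_symm (fun q => F
      ((MeasurableEquiv.piFinSuccAbove (fun _ : Fin (n + 1) => ℝ) 0).symm q))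
      (hFm.comp hmp.measurable).aemeasurable]
    set G : ℤ → (Fin n → ℝ) → ℂ := fun j x' => ∑ k ∈ P, c (Fin.cons j k) *
      ∏ i, (Real.sinc (Real.pi * (x' i - A i.succ * k i) / A i.succ) : ℂ) with hG
    have hFG : ∀ (y : ℝ) (x' : Fin n → ℝ),
        F ((MeasurableEquiv.piFinSuccAbove (fun _ : Fin (n + 1) => ℝ) 0).symm (y, x')) =
          ‖∑ j ∈ t, G j x' * (Real.sinc (Real.pi * (y - A 0 * j) / A 0) : ℂ)‖ₑ ^ p := by
      intro y x'
      have e : (MeasurableEquiv.piFinSuccAbove (fun _ : Fin (n + 1) => ℝ) 0).symm (y, x') =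
          Fin.cons y x' := by
        simp [MeasurableEquiv.piFinSuccAbove, Fin.consEquiv]
      rw [e, hF]
      simp only
      rw [sum_piFinset_fin_succ]
      congr 2
      refine Finset.sum_congr rfl fun j _ => ?_
      rw [hG]
      simp only
      rw [Finset.sum_mul]
      refine Finset.sum_congr rfl fun k _ => ?_
      rw [Fin.prod_univ_succ]
      simp only [Fin.cons_zero, Fin.cons_succ]
      ring
    simp only [hFG]
    calc _ ≤ ∫⁻ x' : Fin n → ℝ, ENNReal.ofReal (A 0) * C * ∑ j ∈ t, ‖G j x'‖ₑ ^ p :=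
          lintegral_mono fun x' => hC (hA 0) t fun j => G j x'
      _ = ENNReal.ofReal (A 0) * C * ∑ j ∈ t, ∫⁻ x' : Fin n → ℝ, ‖G j x'‖ₑ ^ p := by
          have hGm : ∀ j, Measurable fun x' => ‖G j x'‖ₑ ^ p := by
            intro j
            have h1 : Continuous (G j) := by rw [hG]; fun_prop
            exact h1.measurable.enorm.pow_const p
          rw [lintegral_const_mul _ (Finset.measurable_fun_sum _ fun j _ => hGm j),
            lintegral_finsetSum _ fun j _ => hGm j]
      _ ≤ ENNReal.ofReal (A 0) * C * ∑ j ∈ t, (∏ i : Fin n, ENNReal.ofReal (A i.succ) * C) *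
            ∑ k ∈ P, ‖c (Fin.cons j k)‖ₑ ^ p := by
          gcongr with j _
          exact ih (fun i => A i.succ) (fun i => hA _) fun k => c (Fin.cons j k)
      _ = _ := by
          rw [← Finset.mul_sum, Fin.prod_univ_succ, sum_piFinset_fin_succ]
          simp only [mul_assoc, hP]

variable {ι : Type*} [Fintype ι]

/-- The cardinal sine of the lattice with steps `A i`. -/
noncomputable def gridSinc (A : ι → ℝ) (z : EuclideanSpace ℝ ι) : ℂ :=
  ∏ i, (Real.sinc (Real.pi * z i / A i) : ℂ)

/-- The points of the lattice with steps `A i`. -/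
noncomputable def gridPoint (A : ι → ℝ) (k : ι → ℤ) : EuclideanSpace ℝ ι :=
  WithLp.toLp 2 fun i => A i * k i

theorem continuous_gridSinc (A : ι → ℝ) : Continuous (gridSinc A) := by
  have := Real.continuous_sinc
  unfold gridSinc
  fun_prop

/-- The cardinal series is bounded from `ℓ^p` to `L^p`. -/
theorem exists_lintegral_sum_mul_gridSinc_le {A : ι → ℝ} (hA : ∀ i, 0 < A i) {p : ℝ} (hp : 1 < p) :
    ∃ C : NNReal, ∀ (S : Finset (ι → ℤ)) (c : (ι → ℤ) → ℂ),
      ∫⁻ z : EuclideanSpace ℝ ι, ‖∑ k ∈ S, c k * gridSinc A (z - gridPoint A k)‖ₑ ^ p ≤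
        C * ∑ k ∈ S, ‖c k‖ₑ ^ p := by
  classical
  obtain ⟨C, hC⟩ := exists_lintegral_sum_mul_sinc_scaled_le hp
  have hp0 : 0 < p := by linarith
  set e := (Fintype.equivFin ι).symm
  refine ⟨∏ i : Fin (Fintype.card ι), (A (e i)).toNNReal * C, fun S c => ?_⟩
  -- The index set is enclosed in a cube t^n, as the induction over coordinates needs a product set;
  -- the coefficients are extended by zero.
  set t : Finset ℤ := S.biUnion fun k => Finset.univ.image k with ht
  set P := Fintype.piFinset (fun _ : Fin (Fintype.card ι) => t) with hP
  set b : (Fin (Fintype.card ι) → ℤ) → ℂ := fun k =>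
    if (fun i => k (e.symm i)) ∈ S then c fun i => k (e.symm i) else 0 with hb
  have hsum : ∀ {M : Type} [AddCommMonoid M] (F : (Fin (Fintype.card ι) → ℤ) → ℂ → M),
      (∀ k, F k 0 = 0) → ∑ k ∈ P, F k (b k) = ∑ k ∈ S, F (fun i => k (e i)) (c k) := by
    intro M _ F hF
    symm
    refine Finset.sum_of_injOn (fun k i => k (e i)) ?_ ?_ ?_ ?_
    · intro k _ l _ hkl
      funext i
      have := congrFun hkl (e.symm i)
      simpa using this
    · intro k hk
      simp only [hP, Finset.mem_coe, Fintype.mem_piFinset]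
      intro i
      rw [ht, Finset.mem_biUnion]
      exact ⟨k, hk, Finset.mem_image_of_mem _ (Finset.mem_univ _)⟩
    · intro k _ hk
      have : b k = 0 := by
        rw [hb]
        simp only
        rw [if_neg]
        intro h
        exact hk ⟨_, h, by funext i; simp⟩
      rw [this, hF]
    · intro k hk
      have : b (fun i => k (e i)) = c k := by
        rw [hb]
        simp [hk]
      rw [this]
  have hmain := lintegral_sum_mul_prod_sinc_fin_le hC (Fintype.card ι) (fun i => A (e i))
    (fun i => hA _) t b
  have h2 := hsum (fun _ z => ‖z‖ₑ ^ p) (fun _ => by simp [hp0])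
  rw [← hP, h2] at hmain
  have hmp1 := volume_measurePreserving_piCongrLeft (fun _ : ι => ℝ) e
  have hmp2 := PiLp.volume_preserving_toLp ι
  have hmp := hmp2.comp hmp1
  have hmeas : Measurable fun z : EuclideanSpace ℝ ι =>
      ‖∑ k ∈ S, c k * gridSinc A (z - gridPoint A k)‖ₑ ^ p := by
    have := continuous_gridSinc A
    have h1 : Continuous fun z : EuclideanSpace ℝ ι =>
      ∑ k ∈ S, c k * gridSinc A (z - gridPoint A k) := by fun_prop
    exact h1.measurable.enorm.pow_const p
  rw [← hmp.lintegral_comp hmeas]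
  refine (le_of_eq ?_).trans (hmain.trans (le_of_eq ?_))
  · refine lintegral_congr fun x => ?_
    have h3 := hsum (fun k z => z * ∏ i, (Real.sinc (Real.pi * (x i - A (e i) * k i) / A (e i)) : ℂ))
      (fun _ => by simp)
    rw [h3]
    congr 2
    refine Finset.sum_congr rfl fun k _ => ?_
    congr 1
    rw [gridSinc, ← e.prod_comp]
    refine Finset.prod_congr rfl fun i _ => ?_
    simp [gridPoint, MeasurableEquiv.piCongrLeft]
  · congr 1
    push_cast
    rfl

end SincSeries


/-! ### Lattice sums in several variables. -/

section LatticeSums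

variable {ι : Type*} [Fintype ι]

/-- Enlarging S to the product of its coordinate projections makes the sum factor into
one-dimensional sums. -/
theorem exists_sum_prod_one_add_abs_sub_rpow_le {q : ℝ} (hq : 1 < q) : ∃ C : ℝ, 0 < C ∧
    ∀ (x : ι → ℝ) (S : Finset (ι → ℤ)), ∑ k ∈ S, ∏ i, (1 + |x i - k i|) ^ (-q) ≤ C := by
  classical
  obtain ⟨C, hC, h⟩ := exists_sum_one_add_abs_sub_rpow_le hq
  refine ⟨C ^ Fintype.card ι, by positivity, fun x S => ?_⟩
  have hsub : S ⊆ Fintype.piFinset fun i => S.image fun k => k i := by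
    intro k hk
    rw [Fintype.mem_piFinset]
    exact fun i => Finset.mem_image_of_mem _ hk
  calc _ ≤ ∑ k ∈ Fintype.piFinset fun i => S.image fun k => k i, ∏ i, (1 + |x i - k i|) ^ (-q) :=
        Finset.sum_le_sum_of_subset_of_nonneg hsub fun k _ _ =>
          Finset.prod_nonneg fun i _ => by positivity
    _ = ∏ i, ∑ j ∈ S.image fun k => k i, (1 + |x i - j|) ^ (-q) :=
        (Finset.prod_univ_sum (fun i => S.image fun k => k i)
          fun i (j : ℤ) => (1 + |x i - j|) ^ (-q)).symm
    _ ≤ ∏ _i : ι, C := Finset.prod_le_prod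
        (fun i _ => Finset.sum_nonneg fun j _ => by positivity) fun i _ => h _ _
    _ = _ := by simp

theorem abs_sinc_pi_mul_le (t : ℝ) : |Real.sinc (Real.pi * t)| ≤ 2 * (1 + |t|)⁻¹ := by
  have hpi := Real.pi_gt_three
  have h0 := abs_nonneg t
  rw [← div_eq_mul_inv, le_div_iff₀ (by positivity)]
  have h1 := Real.abs_sinc_le_one (Real.pi * t)
  have h2 : |Real.sinc (Real.pi * t)| * |t| ≤ 1 := by
    rcases eq_or_ne t 0 with rfl | ht
    · simp
    · have ht' : 0 < |t| := abs_pos.2 ht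
      rw [Real.sinc_of_ne_zero (by positivity), abs_div, abs_mul, abs_of_pos Real.pi_pos,
        div_mul_eq_mul_div, div_le_one (by positivity)]
      have := Real.abs_sin_le_one (Real.pi * t)
      nlinarith
  linarith

theorem norm_gridSinc_rpow_le {A : ι → ℝ} (hA : ∀ i, 0 < A i) {q : ℝ} (hq : 0 ≤ q)
    (z : EuclideanSpace ℝ ι) (k : ι → ℤ) :
    ‖gridSinc A (z - gridPoint A k)‖ ^ q ≤
      (2 ^ q) ^ Fintype.card ι * ∏ i, (1 + |z i / A i - k i|) ^ (-q) := by
  have h1 : ‖gridSinc A (z - gridPoint A k)‖ ^ q =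
      ∏ i, |Real.sinc (Real.pi * (z i / A i - k i))| ^ q := by
    rw [gridSinc, norm_prod, Real.finsetProd_rpow _ _ fun i _ => abs_nonneg _]
    congr 1
    refine Finset.prod_congr rfl fun i _ => ?_
    rw [Complex.norm_real, Real.norm_eq_abs]
    congr 2
    have := (hA i).ne'
    simp only [gridPoint, PiLp.sub_apply]
    field_simp
  rw [h1, ← Finset.card_univ, ← Finset.prod_const, ← Finset.prod_mul_distrib]
  refine Finset.prod_le_prod (fun i _ => by positivity) fun i _ => ?_
  rw [Real.rpow_neg (by positivity), ← Real.inv_rpow (by positivity),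
    ← Real.mul_rpow (by norm_num) (by positivity)]
  exact Real.rpow_le_rpow (abs_nonneg _) (abs_sinc_pi_mul_le _) hq

theorem exists_sum_norm_gridSinc_rpow_le {A : ι → ℝ} (hA : ∀ i, 0 < A i) {q : ℝ} (hq : 1 < q) :
    ∃ C : ℝ, 0 < C ∧ ∀ (z : EuclideanSpace ℝ ι) (S : Finset (ι → ℤ)),
      ∑ k ∈ S, ‖gridSinc A (z - gridPoint A k)‖ ^ q ≤ C := by
  obtain ⟨C, hC, h⟩ := exists_sum_prod_one_add_abs_sub_rpow_le (ι := ι) hq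
  refine ⟨(2 ^ q) ^ Fintype.card ι * C, by positivity, fun z S => ?_⟩
  calc _ ≤ ∑ k ∈ S, (2 ^ q) ^ Fintype.card ι * ∏ i, (1 + |z i / A i - k i|) ^ (-q) :=
        Finset.sum_le_sum fun k _ => norm_gridSinc_rpow_le hA (by linarith) z k
    _ ≤ _ := by
        rw [← Finset.mul_sum]
        gcongr
        exact h _ S

theorem norm_gridSinc_le_one (A : ι → ℝ) (z : EuclideanSpace ℝ ι) : ‖gridSinc A z‖ ≤ 1 := by
  rw [gridSinc, norm_prod]
  refine Finset.prod_le_one (fun i _ => norm_nonneg _) fun i _ => ?_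
  rw [Complex.norm_real, Real.norm_eq_abs]
  exact Real.abs_sinc_le_one _

/-- The sums of a Schwartz function over the translates of a lattice are bounded, uniformly for
bounded dilations of the lattice. -/
theorem exists_sum_norm_schwartz_le {A : ι → ℝ} (hA : ∀ i, 0 < A i)
    (Φ : 𝓢(EuclideanSpace ℝ ι, ℂ)) : ∃ C : ℝ, 0 < C ∧ ∀ (r : ℝ), 1 / 2 ≤ r → r ≤ 1 →
      ∀ (y : EuclideanSpace ℝ ι) (S : Finset (ι → ℤ)),
        ∑ k ∈ S, ‖Φ (r • gridPoint A k - y)‖ ≤ C := by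
  classical
  obtain ⟨C, hC, h⟩ := exists_sum_prod_one_add_abs_sub_rpow_le (ι := ι) (q := 2) (by norm_num)
  -- Two powers of decay for each coordinate, so that the radial bound dominates a summable product.
  obtain ⟨D, hD, hΦ⟩ := exists_schwartz_decay Φ (2 * Fintype.card ι)
  -- Because r ≥ 1/2, this choice gives c i (1 + t) ≤ 1 + r (A i) t for all t ≥ 0, uniformly in r.
  set c : ι → ℝ := fun i => min 1 (A i / 2) with hc
  have hc0 : ∀ i, 0 < c i := fun i => lt_min one_pos (half_pos (hA i))
  have hP : 0 < ∏ i, c i ^ (-2 : ℝ) := Finset.prod_pos fun i _ => Real.rpow_pos_of_pos (hc0 i) _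
  refine ⟨D * ((∏ i, c i ^ (-2 : ℝ)) * C), by positivity, fun r hr hr1 y S => ?_⟩
  have hterm : ∀ k : ι → ℤ, ‖Φ (r • gridPoint A k - y)‖ ≤
      D * ((∏ i, c i ^ (-2 : ℝ)) * ∏ i, (1 + |y i / (r * A i) - k i|) ^ (-2 : ℝ)) := by
    intro k
    refine (hΦ _).trans ?_
    gcongr
    set x := r • gridPoint A k - y with hx
    rw [← Finset.prod_mul_distrib]
    push_cast
    have h1 : (1 + ‖x‖) ^ (-(2 * (Fintype.card ι : ℝ))) = ∏ _i : ι, (1 + ‖x‖) ^ (-2 : ℝ) := by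
      rw [Finset.prod_const, Finset.card_univ, ← Real.rpow_natCast, ← Real.rpow_mul (by positivity)]
      congr 1
      ring
    rw [h1]
    refine Finset.prod_le_prod (fun i _ => by positivity) fun i _ => ?_
    rw [← Real.mul_rpow (hc0 i).le (by positivity)]
    refine Real.rpow_le_rpow_of_nonpos (mul_pos (hc0 i) (by positivity)) ?_ (by norm_num)
    have hxi : |x i| ≤ ‖x‖ := PiLp.norm_apply_le x i
    have hrA : 0 < r * A i := mul_pos (by linarith) (hA i)
    have h2 : |x i| = r * A i * |y i / (r * A i) - k i| := by
      rw [← abs_of_pos hrA, ← abs_mul, abs_of_pos hrA, ← abs_neg]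
      congr 1
      rw [hx]
      simp only [gridPoint, PiLp.sub_apply, PiLp.smul_apply, smul_eq_mul]
      have := (hA i).ne'
      have : r ≠ 0 := by linarith
      field_simp
      ring
    have h3 : c i ≤ 1 := min_le_left _ _
    have h4 : c i ≤ r * A i := (min_le_right _ _).trans (by nlinarith [hA i])
    have h5 := abs_nonneg (y i / (r * A i) - k i)
    nlinarith
  calc _ ≤ ∑ k ∈ S, D * ((∏ i, c i ^ (-2 : ℝ)) *
          ∏ i, (1 + |y i / (r * A i) - k i|) ^ (-2 : ℝ)) := Finset.sum_le_sum fun k _ => hterm k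
    _ ≤ _ := by
        rw [← Finset.mul_sum, ← Finset.mul_sum]
        have := h (fun i => y i / (r * A i)) S
        gcongr

end LatticeSums

/-! ### Weighted Jensen and Young inequalities. -/

section WeightedJensen

variable {α : Type*} [MeasurableSpace α] {μ : Measure α}

/-- Hölder for the splitting f k = (f k^{1/p}) k^{1/q}. -/
theorem lintegral_mul_rpow_le {p : ℝ} (hp : 1 ≤ p) {f k : α → ℝ≥0∞} (hf : AEMeasurable f μ)
    (hk : AEMeasurable k μ) :
    (∫⁻ x, f x * k x ∂μ) ^ p ≤ (∫⁻ x, k x ∂μ) ^ (p - 1) * ∫⁻ x, f x ^ p * k x ∂μ := by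
  rcases hp.eq_or_lt with rfl | hp1
  · simp
  have hp0 : 0 < p := by linarith
  have hpq := Real.HolderConjugate.conjExponent hp1
  set q := p.conjExponent
  have h := ENNReal.lintegral_mul_le_Lp_mul_Lq μ hpq (f := fun x => f x * k x ^ (1 / p))
    (g := fun x => k x ^ (1 / q)) (hf.mul (hk.pow_const _)) (hk.pow_const _)
  have h1 : ∀ x, ((fun x => f x * k x ^ (1 / p)) * fun x => k x ^ (1 / q)) x = f x * k x := by
    intro x
    simp only [Pi.mul_apply]
    rw [mul_assoc, ← ENNReal.rpow_add_of_nonneg _ _ hpq.one_div_nonneg hpq.symm.one_div_nonneg,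
      hpq.one_div_add_one_div, div_one, ENNReal.rpow_one]
  have h2 : ∀ x, (f x * k x ^ (1 / p)) ^ p = f x ^ p * k x := by
    intro x
    rw [ENNReal.mul_rpow_of_nonneg _ _ hp0.le, ← ENNReal.rpow_mul, one_div_mul_cancel hp0.ne',
      ENNReal.rpow_one]
  have h3 : ∀ x, (k x ^ (1 / q)) ^ q = k x := by
    intro x
    rw [← ENNReal.rpow_mul, one_div_mul_cancel hpq.symm.ne_zero, ENNReal.rpow_one]
  simp only [h1, h2, h3] at h
  calc _ ≤ ((∫⁻ x, f x ^ p * k x ∂μ) ^ (1 / p) * (∫⁻ x, k x ∂μ) ^ (1 / q)) ^ p := by gcongr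
    _ = _ := by
        rw [ENNReal.mul_rpow_of_nonneg _ _ hp0.le, ← ENNReal.rpow_mul, ← ENNReal.rpow_mul,
          one_div_mul_cancel hp0.ne', ENNReal.rpow_one, mul_comm]
        congr 2
        rw [one_div_mul_eq_div, hpq.div_conj_eq_sub_one]

/-- Young's inequality for the convolution with an integrable kernel. -/
theorem lintegral_lintegral_mul_sub_rpow_le {V : Type*} [NormedAddCommGroup V]
    [InnerProductSpace ℝ V] [FiniteDimensional ℝ V] [MeasurableSpace V] [BorelSpace V]
    {p : ℝ} (hp : 1 ≤ p) {f k : V → ℝ≥0∞} (hf : AEMeasurable f) (hk : AEMeasurable k) :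
    ∫⁻ z, (∫⁻ y, f (z - y) * k y) ^ p ≤ (∫⁻ y, k y) ^ p * ∫⁻ y, f y ^ p := by
  have hfs : ∀ z, AEMeasurable fun y => f (z - y) := fun z =>
    hf.comp_quasiMeasurePreserving (Measure.measurePreserving_sub_left volume z).quasiMeasurePreserving
  have hprod : AEMeasurable (fun q : V × V => f (q.1 - q.2) ^ p * k q.2) (volume.prod volume) := by
    refine AEMeasurable.mul (AEMeasurable.pow_const ?_ _) hk.comp_snd
    exact hf.comp_quasiMeasurePreserving (quasiMeasurePreserving_sub volume volume)
  calc _ ≤ ∫⁻ z, (∫⁻ y, k y) ^ (p - 1) * ∫⁻ y, f (z - y) ^ p * k y :=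
        lintegral_mono fun z => lintegral_mul_rpow_le hp (hfs z) hk
    _ = (∫⁻ y, k y) ^ (p - 1) * ∫⁻ z, ∫⁻ y, f (z - y) ^ p * k y :=
        lintegral_const_mul'' _ hprod.lintegral_prod_right'
    _ = (∫⁻ y, k y) ^ (p - 1) * ∫⁻ y, ∫⁻ z, f (z - y) ^ p * k y := by
        rw [lintegral_lintegral_swap hprod]
    _ = (∫⁻ y, k y) ^ (p - 1) * ∫⁻ y, (∫⁻ z, f z ^ p) * k y := by
        congr 1
        refine lintegral_congr fun y => ?_
        have hfy : AEMeasurable fun z => f (z - y) := hf.comp_quasiMeasurePreserving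
          (measurePreserving_sub_right volume y).quasiMeasurePreserving
        rw [lintegral_mul_const'' _ (hfy.pow_const _)]
        congr 1
        exact lintegral_sub_right_eq_self (fun z => f z ^ p) y
    _ = _ := by
        rw [lintegral_const_mul'' _ hk, mul_comm (∫⁻ z, f z ^ p), ← mul_assoc]
        congr 1
        nth_rewrite 2 [← ENNReal.rpow_one (∫⁻ y, k y)]
        rw [← ENNReal.rpow_add_of_nonneg _ _ (by linarith) (by norm_num)]
        congr 1
        ring

end WeightedJensen


/-! ### Parseval and Shannon on the unit cube. -/

section CubeParseval

set_option linter.unusedSectionVars false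

variable {ι : Type*} [Fintype ι]

/-- The unit cube centred at the origin. -/
def unitCube (ι : Type*) : Set (ι → ℝ) := {u | ∀ i, u i ∈ Set.Ioc (-(1 / 2) : ℝ) (-(1 / 2) + 1)}

theorem measurableSet_unitCube : MeasurableSet (unitCube ι) :=
  MeasurableSet.univ_pi' fun _ => measurableSet_Ioc

attribute [local instance] instMeasureSpaceUnitAddCircle

instance isProbabilityMeasure_unitAddCircle :
    IsProbabilityMeasure (volume : Measure UnitAddCircle) :=
  inferInstanceAs (IsProbabilityMeasure AddCircle.haarAddCircle)

/-- The representative in the unit cube of a point of the torus. -/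
noncomputable def cubeRep (x : UnitAddTorus ι) : ι → ℝ := fun i =>
  (AddCircle.equivIoc 1 (-(1 / 2) : ℝ) (x i)).1

theorem measurable_cubeRep : Measurable (cubeRep : UnitAddTorus ι → ι → ℝ) :=
  measurable_pi_lambda _ fun i => measurable_subtype_coe.comp
    ((AddCircle.measurableEquivIoc 1 (-(1 / 2))).measurable.comp (measurable_pi_apply i))

theorem cubeRep_coe {u : ι → ℝ} (hu : u ∈ unitCube ι) :
    cubeRep (fun i => (u i : UnitAddCircle)) = u := by
  funext i
  simp only [cubeRep]
  rw [AddCircle.equivIoc_coe_eq (hu i)]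

theorem mFourier_coe (n : ι → ℤ) (u : ι → ℝ) :
    UnitAddTorus.mFourier n (fun i => (u i : UnitAddCircle)) =
      Complex.exp (2 * Real.pi * Complex.I * ∑ i, (n i : ℂ) * u i) := by
  simp only [UnitAddTorus.mFourier, ContinuousMap.coe_mk]
  rw [Finset.mul_sum, Complex.exp_sum]
  refine Finset.prod_congr rfl fun i _ => ?_
  rw [fourier_coe_apply]
  congr 1
  push_cast
  ring

theorem integral_comp_cubeRep (G : (ι → ℝ) → ℂ) :
    ∫ x : UnitAddTorus ι, G (cubeRep x) = ∫ u in unitCube ι, G u := by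
  rw [UnitAddTorus.integral_preimage _ fun _ => (-(1 / 2) : ℝ)]
  exact setIntegral_congr_fun measurableSet_unitCube fun u hu => by
    simp only [cubeRep_coe (show u ∈ unitCube ι from hu)]

theorem mFourierCoeff_comp_cubeRep (G : (ι → ℝ) → ℂ) (n : ι → ℤ) :
    UnitAddTorus.mFourierCoeff (fun x => G (cubeRep x)) n = ∫ u in unitCube ι,
      Complex.exp (-(2 * Real.pi * Complex.I * ∑ i, (n i : ℂ) * u i)) * G u := by
  rw [UnitAddTorus.mFourierCoeff_eq_integral _ _ fun _ => (-(1 / 2) : ℝ)]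
  refine setIntegral_congr_fun measurableSet_unitCube fun u hu => ?_
  simp only [cubeRep_coe (show u ∈ unitCube ι from hu), mFourier_coe, smul_eq_mul]
  congr 2
  simp

/-- Parseval's identity on the unit cube. -/
theorem hasSum_unitCube_parseval {F G : (ι → ℝ) → ℂ} (hF : Measurable F) (hG : Measurable G)
    {C : ℝ} (hFC : ∀ u ∈ unitCube ι, ‖F u‖ ≤ C) (hGC : ∀ u ∈ unitCube ι, ‖G u‖ ≤ C) :
    HasSum (fun n : ι → ℤ =>
      conj (∫ u in unitCube ι, Complex.exp (-(2 * Real.pi * Complex.I * ∑ i, (n i : ℂ) * u i)) * F u)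
      * ∫ u in unitCube ι, Complex.exp (-(2 * Real.pi * Complex.I * ∑ i, (n i : ℂ) * u i)) * G u)
      (∫ u in unitCube ι, conj (F u) * G u) := by
  have hmem : ∀ x : UnitAddTorus ι, cubeRep x ∈ unitCube ι := fun x i =>
    (AddCircle.equivIoc 1 (-(1 / 2) : ℝ) (x i)).2
  have hL : ∀ {H : (ι → ℝ) → ℂ}, Measurable H → (∀ u ∈ unitCube ι, ‖H u‖ ≤ C) →
      MemLp (fun x : UnitAddTorus ι => H (cubeRep x)) 2 volume := fun hH hC =>
    MemLp.of_bound (hH.comp measurable_cubeRep).aestronglyMeasurable C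
      (ae_of_all _ fun x => hC _ (hmem x))
  have hF2 := hL hF hFC
  have hG2 := hL hG hGC
  have h := UnitAddTorus.hasSum_prod_mFourierCoeff hF2.toLp hG2.toLp
  have hc : ∀ {H : (ι → ℝ) → ℂ} (hH : MemLp (fun x : UnitAddTorus ι => H (cubeRep x)) 2 volume)
      (n : ι → ℤ), UnitAddTorus.mFourierCoeff hH.toLp n = ∫ u in unitCube ι,
        Complex.exp (-(2 * Real.pi * Complex.I * ∑ i, (n i : ℂ) * u i)) * H u := by
    intro H hH n
    rw [← mFourierCoeff_comp_cubeRep]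
    refine integral_congr_ae ?_
    filter_upwards [hH.coeFn_toLp] with x hx
    rw [hx]
  simp only [hc] at h
  convert h using 1
  rw [← integral_comp_cubeRep fun u => conj (F u) * G u]
  refine integral_congr_ae ?_
  filter_upwards [hF2.coeFn_toLp, hG2.coeFn_toLp] with x h1 h2
  rw [h1, h2]

theorem integral_Ioc_exp_eq_sinc (t : ℝ) :
    ∫ x in Set.Ioc (-(1 / 2) : ℝ) (-(1 / 2) + 1), Complex.exp (2 * Real.pi * Complex.I * (t * x)) =
      (Real.sinc (Real.pi * t) : ℂ) := by
  rw [← intervalIntegral.integral_of_le (by norm_num)]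
  rcases eq_or_ne t 0 with rfl | ht
  · simp
  · have hc : 2 * Real.pi * Complex.I * (t : ℂ) ≠ 0 := by
      have := Real.pi_ne_zero
      simp [ht]
    have := integral_exp_mul_complex (a := (-(1 / 2) : ℝ)) (b := (-(1 / 2) + 1 : ℝ)) hc
    simp only [mul_assoc] at this ⊢
    rw [this, Real.sinc_of_ne_zero (mul_ne_zero Real.pi_ne_zero ht)]
    have e1 : 2 * ((Real.pi : ℂ) * (Complex.I * (t * ((-(1 / 2) + 1 : ℝ) : ℂ)))) =
      (Real.pi * t : ℝ) * Complex.I := by push_cast; ring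
    have e2 : 2 * ((Real.pi : ℂ) * (Complex.I * (t * ((-(1 / 2) : ℝ) : ℂ)))) =
      -((Real.pi * t : ℝ) * Complex.I) := by push_cast; ring
    rw [e1, e2, Complex.ofReal_div, Complex.ofReal_sin, Complex.sin]
    have hpt : ((Real.pi * t : ℝ) : ℂ) ≠ 0 := by
      exact_mod_cast mul_ne_zero Real.pi_ne_zero ht
    have e3 : 2 * ((Real.pi : ℂ) * (Complex.I * t)) = 2 * Complex.I * (Real.pi * t : ℝ) := by
      push_cast; ring
    rw [e3, neg_mul]
    field_simp
    rw [Complex.I_sq]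
    ring

theorem integral_unitCube_exp (s : ι → ℝ) :
    ∫ u in unitCube ι, Complex.exp (2 * Real.pi * Complex.I * ∑ i, (s i : ℂ) * u i) =
      ∏ i, (Real.sinc (Real.pi * s i) : ℂ) := by
  have h1 : (volume : Measure (ι → ℝ)).restrict (unitCube ι) =
      Measure.pi fun _ => (volume : Measure ℝ).restrict (Set.Ioc (-(1 / 2)) (-(1 / 2) + 1)) := by
    rw [← Measure.restrict_pi_pi]
    congr 1
    ext u
    simp [unitCube]
  rw [h1]
  have h2 : ∀ u : ι → ℝ, Complex.exp (2 * Real.pi * Complex.I * ∑ i, (s i : ℂ) * u i) =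
      ∏ i, Complex.exp (2 * Real.pi * Complex.I * ((s i : ℂ) * u i)) := by
    intro u
    rw [Finset.mul_sum, Complex.exp_sum]
  simp only [h2]
  rw [integral_fintype_prod_eq_prod
    (fun i (x : ℝ) => Complex.exp (2 * Real.pi * Complex.I * ((s i : ℂ) * x)))]
  exact Finset.prod_congr rfl fun i _ => integral_Ioc_exp_eq_sinc (s i)

/-- Shannon's sampling theorem, on the unit cube. -/
theorem hasSum_unitCube_shannon {G : (ι → ℝ) → ℂ} (hG : Measurable G) {C : ℝ}
    (hGC : ∀ u ∈ unitCube ι, ‖G u‖ ≤ C) (x : ι → ℝ) :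
    HasSum (fun n : ι → ℤ =>
      (∫ u in unitCube ι, Complex.exp (2 * Real.pi * Complex.I * ∑ i, (n i : ℂ) * u i) * G u) *
        ∏ i, (Real.sinc (Real.pi * (x i - n i)) : ℂ))
      (∫ u in unitCube ι, Complex.exp (2 * Real.pi * Complex.I * ∑ i, (x i : ℂ) * u i) * G u) := by
  have hconj : ∀ y : ι → ℝ, ∀ u : ι → ℝ,
      conj (Complex.exp (-(2 * Real.pi * Complex.I * ∑ i, (y i : ℂ) * u i))) =
        Complex.exp (2 * Real.pi * Complex.I * ∑ i, (y i : ℂ) * u i) := by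
    intro y u
    rw [← Complex.exp_conj]
    congr 1
    simp only [map_neg, map_mul, map_sum, Complex.conj_ofReal, Complex.conj_I, map_ofNat]
    ring
  -- Parseval against the exponential u ↦ e^{-2πi x·u}, whose Fourier coefficients are products of
  -- values of sinc; the reindexing n ↦ -n then gives sinc at x - n.
  have h := hasSum_unitCube_parseval
    (F := fun u => Complex.exp (-(2 * Real.pi * Complex.I * ∑ i, (x i : ℂ) * u i))) (G := G)
    (C := max 1 C) (by fun_prop) hG (fun u _ => ?_) fun u hu => (hGC u hu).trans (le_max_right _ _)
  · rw [← (Equiv.neg (ι → ℤ)).hasSum_iff] at h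
    convert h using 1
    · funext n
      simp only [Function.comp, Equiv.neg_apply]
      rw [mul_comm]
      congr 1
      · rw [← integral_unitCube_exp, ← integral_conj]
        refine integral_congr_ae (ae_of_all _ fun u => ?_)
        simp only [map_mul]
        rw [hconj, mul_comm, ← Complex.exp_conj, ← Complex.exp_add]
        congr 1
        simp only [map_neg, map_mul, map_sum, Complex.conj_ofReal, Complex.conj_I, map_ofNat,
          Pi.neg_apply, map_intCast, Int.cast_neg]
        have hs : ∑ i, ((x i - n i : ℝ) : ℂ) * u i =
            ∑ i, (x i : ℂ) * u i - ∑ i, (n i : ℂ) * u i := by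
          rw [← Finset.sum_sub_distrib]
          refine Finset.sum_congr rfl fun i _ => ?_
          push_cast
          ring
        rw [hs]
        simp only [neg_mul, Finset.sum_neg_distrib]
        ring
      · refine integral_congr_ae (ae_of_all _ fun u => ?_)
        simp
    · refine integral_congr_ae (ae_of_all _ fun u => ?_)
      simp only [hconj]
  · have := congrArg norm (hconj x u)
    rw [Complex.norm_conj] at this
    rw [this, Complex.norm_exp]
    refine le_max_of_le_left (le_of_eq ?_)
    rw [Real.exp_eq_one_iff, show ∑ i, (x i : ℂ) * u i = ((∑ i, x i * u i : ℝ) : ℂ) by push_cast; rfl]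
    simp

end CubeParseval


/-! ### Shannon's theorem for integrable functions on a rectangular lattice. -/

section Shannon

set_option linter.unusedSectionVars false

variable {ι : Type*} [Fintype ι]

/-- The centred box dual to the lattice with steps `A i`. -/
def gridBox (A : ι → ℝ) : Set (EuclideanSpace ℝ ι) := {w | ∀ i, |w i| ≤ 1 / (2 * A i)}

theorem isCompact_gridBox (A : ι → ℝ) : IsCompact (gridBox A) := by
  have h : gridBox A = (EuclideanSpace.equiv ι ℝ).toHomeomorph ⁻¹'
      (Set.univ.pi fun i => Set.Icc (-(1 / (2 * A i))) (1 / (2 * A i))) := by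
    ext w
    simp only [gridBox, Set.mem_ofPred_eq, abs_le, Set.mem_preimage, Set.mem_pi, Set.mem_univ,
      true_implies, Set.mem_Icc]
    rfl
  rw [h, Homeomorph.isCompact_preimage]
  exact isCompact_univ_pi fun i => isCompact_Icc

theorem smul_mem_interior_gridBox {A : ι → ℝ} (hA : ∀ i, 0 < A i) {r : ℝ} (hr : 0 < r) (hr1 : r < 1)
    {x : EuclideanSpace ℝ ι} (hx : x ∈ gridBox A) : r • x ∈ interior (gridBox A) := by
  have ho : IsOpen {w : EuclideanSpace ℝ ι | ∀ i, |w i| < 1 / (2 * A i)} := by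
    simp only [Set.ofPred_forall]
    exact isOpen_iInter_of_finite fun i => isOpen_lt (by fun_prop) continuous_const
  refine interior_mono (fun w hw i => (hw i).le) (ho.interior_eq.symm ▸ fun i => ?_ :
    r • x ∈ interior {w : EuclideanSpace ℝ ι | ∀ i, |w i| < 1 / (2 * A i)})
  have h1 : 0 < 1 / (2 * A i) := by have := hA i; positivity
  rw [PiLp.smul_apply, smul_eq_mul, abs_mul, abs_of_pos hr]
  nlinarith [hx i, abs_nonneg (x i)]

/-- The Jacobian is taken from the uniqueness of Haar measure. Its value is never needed, because
the same constant stands on both sides of the sampling formula. -/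
theorem exists_integral_eq_mul_integral_scaled {A : ι → ℝ} (hA : ∀ i, 0 < A i) :
    ∃ c : ℂ, ∀ f : EuclideanSpace ℝ ι → ℂ,
      ∫ w, f w = c * ∫ u : ι → ℝ, f (WithLp.toLp 2 fun i => u i / A i) := by
  let D : (ι → ℝ) ≃L[ℝ] (ι → ℝ) := ContinuousLinearEquiv.piCongrRight fun i =>
    ContinuousLinearEquiv.unitsEquivAut ℝ (Units.mk0 (A i)⁻¹ (inv_ne_zero (hA i).ne'))
  let e : (ι → ℝ) ≃L[ℝ] EuclideanSpace ℝ ι := D.trans (EuclideanSpace.equiv ι ℝ).symm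
  have he : ∀ u, e u = WithLp.toLp 2 fun i => u i / A i := by
    intro u
    ext i
    simp [e, D, div_eq_mul_inv]
  have := e.isAddHaarMeasure_map (volume : Measure (ι → ℝ))
  obtain ⟨c, hc⟩ : ∃ c : NNReal, (volume : Measure (EuclideanSpace ℝ ι)) =
      c • Measure.map e volume := ⟨_, Measure.isAddLeftInvariant_eq_smul _ _⟩
  refine ⟨((c : ℝ) : ℂ), fun f => ?_⟩
  have hme : MeasurableEmbedding e := e.toHomeomorph.measurableEmbedding
  rw [hc, integral_smul_nnreal_measure, hme.integral_map]
  simp only [he, NNReal.smul_def, Complex.real_smul]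

/-- **Shannon's sampling theorem** for integrable functions with spectrum in the box. -/
theorem hasSum_mul_gridSinc {A : ι → ℝ} (hA : ∀ i, 0 < A i) {h : EuclideanSpace ℝ ι → ℂ}
    (hi : Integrable h) (hc : Continuous h) (h0 : ∀ w, w ∉ gridBox A → 𝓕 h w = 0)
    (z : EuclideanSpace ℝ ι) :
    HasSum (fun k => h (gridPoint A k) * gridSinc A (z - gridPoint A k)) (h z) := by
  have hF : Integrable (𝓕 h) := (continuous_fourier hi).integrable_of_hasCompactSupport
    (HasCompactSupport.of_support_subset_isCompact (isCompact_gridBox A) fun w hw => by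
      by_contra hn
      exact hw (h0 w hn))
  obtain ⟨c, hcint⟩ := exists_integral_eq_mul_integral_scaled hA
  set G : (ι → ℝ) → ℂ := fun u => 𝓕 h (WithLp.toLp 2 fun i => u i / A i) with hG
  have hGm : Measurable G := by
    have := continuous_fourier hi
    have : Continuous G := by rw [hG]; fun_prop
    exact this.measurable
  have hG0 : ∀ u, u ∉ Set.Icc (fun _ : ι => (-(1 / 2) : ℝ)) (fun _ => -(1 / 2) + 1) → G u = 0 := by
    intro u hu
    refine h0 _ fun hw => hu ?_
    have h2 : ∀ i, |u i| ≤ 1 / 2 := by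
      intro i
      have := hw i
      have hAi := hA i
      simp only [abs_div, abs_of_pos hAi] at this
      rw [div_le_iff₀ hAi] at this
      refine this.trans (le_of_eq ?_)
      field_simp
    exact ⟨fun i => (abs_le.1 (h2 i)).1, fun i => (abs_le.1 (h2 i)).2.trans (by norm_num)⟩
  have hrep : ∀ x : EuclideanSpace ℝ ι, h x = c * ∫ u in unitCube ι,
      Complex.exp (2 * Real.pi * Complex.I * ∑ i, ((x i / A i : ℝ) : ℂ) * u i) * G u := by
    intro x
    conv_lhs => rw [← hc.fourierInv_fourier_eq hi hF]
    rw [Real.fourierInv_eq, hcint]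
    congr 1
    have hcube : unitCube ι =ᵐ[volume]
        Set.Icc (fun _ : ι => (-(1 / 2) : ℝ)) (fun _ => -(1 / 2) + 1) := by
      have := Measure.univ_pi_Ioc_ae_eq_Icc (μ := fun _ : ι => (volume : Measure ℝ))
        (f := fun _ => (-(1 / 2) : ℝ)) (g := fun _ => -(1 / 2) + 1)
      rwa [show Set.univ.pi (fun _ : ι => Set.Ioc (-(1 / 2) : ℝ) (-(1 / 2) + 1)) = unitCube ι by
        ext u; simp [unitCube]] at this
    rw [setIntegral_congr_set hcube, setIntegral_eq_integral_of_forall_compl_eq_zero fun u hu => by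
      rw [hG0 u hu, mul_zero]]
    refine integral_congr_ae (ae_of_all _ fun u => ?_)
    simp only [hG, Circle.smul_def, smul_eq_mul, Real.fourierChar_apply]
    congr 2
    rw [PiLp.inner_apply]
    push_cast
    rw [mul_right_comm]
    congr 1
    refine Finset.sum_congr rfl fun i _ => ?_
    simp
    ring
  have key := (hasSum_unitCube_shannon hGm (C := ∫ x, ‖h x‖)
    (fun u _ => norm_fourier_le h _) (fun i => z i / A i)).mul_left c
  rw [← hrep z] at key
  refine key.congr_fun fun k => ?_
  rw [hrep (gridPoint A k), mul_assoc]
  congr 2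
  · refine integral_congr_ae (ae_of_all _ fun u => ?_)
    simp only
    congr 3
    refine Finset.sum_congr rfl fun i _ => ?_
    have := (hA i).ne'
    simp [gridPoint, this]
  · rw [gridSinc]
    refine Finset.prod_congr rfl fun i _ => ?_
    have := (hA i).ne'
    congr 2
    simp only [gridPoint, PiLp.sub_apply]
    field_simp

end Shannon


/-! ### Limits of pairings between ℓ^p and ℓ^q. -/

section WeakConvergence

variable {κ : Type*}

theorem norm_sum_mul_le_Lp_mul_Lq {p q : ℝ} (hpq : p.HolderConjugate q) (S : Finset κ)
    (a s : κ → ℂ) :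
    ∑ k ∈ S, ‖a k‖ * ‖s k‖ ≤ (∑ k ∈ S, ‖a k‖ ^ p) ^ (1 / p) * (∑ k ∈ S, ‖s k‖ ^ q) ^ (1 / q) := by
  simpa using Real.inner_le_Lp_mul_Lq S (fun k => ‖a k‖) (fun k => ‖s k‖) hpq

/-- Pairing a fixed `ℓ^q` sequence with a bounded, pointwise convergent sequence in `ℓ^p`. -/
theorem hasSum_mul_of_tendsto {p q : ℝ} (hpq : p.HolderConjugate q) {a : ℕ → κ → ℂ} {b s : κ → ℂ}
    {C : ℝ} (ha : ∀ j (S : Finset κ), ∑ k ∈ S, ‖a j k‖ ^ p ≤ C)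
    (hs : Summable fun k => ‖s k‖ ^ q) (hab : ∀ k, Tendsto (fun j => a j k) atTop (𝓝 (b k)))
    {v : ℕ → ℂ} {V : ℂ} (hv : ∀ j, HasSum (fun k => a j k * s k) (v j))
    (hvV : Tendsto v atTop (𝓝 V)) : HasSum (fun k => b k * s k) V := by
  classical
  have hp := hpq.pos
  have hq := hpq.symm.pos
  have hC : 0 ≤ C := by simpa using ha 0 ∅
  rw [HasSum, SummationFilter.unconditional_filter, Metric.tendsto_atTop]
  intro ε hε
  -- Chosen so that C^{1/p} δ^{1/q} ≤ ε/2; the added 1 covers C = 0.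
  set δ : ℝ := (ε / 2 / (C ^ (1 / p) + 1)) ^ q with hδ
  have hC1 : 0 ≤ C ^ (1 / p) := by positivity
  have hδ0 : 0 < δ := by positivity
  obtain ⟨T₀, hT₀⟩ := summable_iff_vanishing_norm.1 hs δ hδ0
  refine ⟨T₀, fun T hT => ?_⟩
  -- By Hölder the tail beyond T is controlled by the tail of s alone, hence uniformly in j, so the
  -- bound survives j → ∞.
  have hj : ∀ j, ‖v j - ∑ k ∈ T, a j k * s k‖ ≤ ε / 2 := by
    intro j
    have h1 : Tendsto (fun S : Finset κ => ‖∑ k ∈ S, a j k * s k - ∑ k ∈ T, a j k * s k‖) atTop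
        (𝓝 ‖v j - ∑ k ∈ T, a j k * s k‖) := ((hv j).sub_const _).norm
    refine le_of_tendsto h1 ?_
    filter_upwards [eventually_ge_atTop T] with S hS
    rw [← Finset.sum_sdiff hS, add_sub_cancel_right]
    refine (norm_sum_le _ _).trans ?_
    simp only [norm_mul]
    refine (norm_sum_mul_le_Lp_mul_Lq hpq _ _ _).trans ?_
    have h2 : ∑ k ∈ S \ T, ‖s k‖ ^ q ≤ δ := by
      refine (le_abs_self _).trans (hT₀ (S \ T) ?_).le
      exact Finset.disjoint_of_subset_right hT Finset.sdiff_disjoint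
    calc _ ≤ C ^ (1 / p) * δ ^ (1 / q) := by
          have hn : ∀ k ∈ S \ T, 0 ≤ ‖s k‖ ^ q := fun k _ => by positivity
          have := Finset.sum_nonneg hn
          gcongr
          exact ha j _
      _ = C ^ (1 / p) * (ε / 2 / (C ^ (1 / p) + 1)) := by
          rw [hδ, ← Real.rpow_mul (by positivity), mul_one_div_cancel hq.ne', Real.rpow_one]
      _ ≤ ε / 2 := by
          rw [mul_div_assoc', div_le_iff₀ (by positivity)]
          nlinarith
  have hlim : Tendsto (fun j => ‖v j - ∑ k ∈ T, a j k * s k‖) atTop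
      (𝓝 ‖V - ∑ k ∈ T, b k * s k‖) :=
    (hvV.sub (tendsto_finsetSum _ fun k _ => (hab k).mul_const _)).norm
  rw [dist_comm, dist_eq_norm]
  linarith [le_of_tendsto hlim (Eventually.of_forall hj)]

end WeakConvergence

/-! ### Smooth cutoff functions. -/

section Cutoff

variable {V : Type*} [NormedAddCommGroup V] [InnerProductSpace ℝ V] [FiniteDimensional ℝ V]

theorem exists_contDiff_eq_one_tsupport_subset {K U : Set V} (hK : IsCompact K) (hU : IsOpen U)
    (hKU : K ⊆ U) : ∃ φ : V → ℂ, ContDiff ℝ ∞ φ ∧ HasCompactSupport φ ∧ tsupport φ ⊆ U ∧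
      ∀ w ∈ K, φ w = 1 := by
  obtain ⟨δ, hδ, hδU⟩ := hK.exists_cthickening_subset_open hU hKU
  obtain ⟨f, hf, -, hs, h1⟩ := exists_contMDiff_support_eq_eq_one_iff (n := (⊤ : ℕ∞))
    (modelWithCornersSelf ℝ V) (Metric.isOpen_thickening (δ := δ) (E := K)) hK.isClosed
    (Metric.self_subset_thickening hδ K)
  have hsupp : Function.support (fun w => (f w : ℂ)) = Metric.thickening δ K := by
    rw [← hs]
    ext w
    simp
  have ht : tsupport (fun w => (f w : ℂ)) ⊆ Metric.cthickening δ K := by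
    rw [tsupport, hsupp]
    exact Metric.closure_thickening_subset_cthickening δ K
  refine ⟨fun w => (f w : ℂ), Complex.ofRealCLM.contDiff.comp hf.contDiff, ?_,
    ht.trans hδU, fun w hw => ?_⟩
  · exact hK.cthickening.of_isClosed_subset (isClosed_tsupport _) ht
  · simp only [(h1 w).1 hw, Complex.ofReal_one]

end Cutoff

/-! ### The Plancherel-Pólya inequality. -/

section PlancherelPolya

variable {ι : Type*} [Fintype ι]

/-- The Plancherel-Pólya inequality: the samples of a bandlimited function in `L^p` are in `ℓ^p`,
uniformly for bounded dilations of the lattice. -/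
theorem exists_sum_norm_sample_rpow_le {A : ι → ℝ} (hA : ∀ i, 0 < A i) {p : ℝ} (hp : 1 ≤ p)
    {F : EuclideanSpace ℝ ι → ℂ} (hF : MemLp F (ENNReal.ofReal p))
    {Φ : 𝓢(EuclideanSpace ℝ ι, ℂ)} (hrep : ∀ z, F z = ∫ y, F y * Φ (z - y)) :
    ∃ C : ℝ, ∀ r : ℝ, 1 / 2 ≤ r → r ≤ 1 → ∀ S : Finset (ι → ℤ),
      ∑ k ∈ S, ‖F (r • gridPoint A k)‖ ^ p ≤ C := by
  have hp0 : 0 < p := by linarith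
  obtain ⟨C, hC, hsum⟩ := exists_sum_norm_schwartz_le hA Φ
  have hΦc := Φ.continuous
  set M : ℝ≥0∞ := ∫⁻ y, ‖Φ y‖ₑ with hM
  have hMtop : M ≠ ⊤ := Φ.integrable.2.ne
  set N : ℝ≥0∞ := ∫⁻ y, ‖F y‖ₑ ^ p with hN
  have hNtop : N ≠ ⊤ := by
    have := lintegral_rpow_enorm_lt_top_of_eLpNorm_lt_top (by simpa using hp0) (by simp) hF.2
    rw [ENNReal.toReal_ofReal hp0.le] at this
    exact this.ne
  have hFm : AEMeasurable (fun y => ‖F y‖ₑ) := hF.1.enorm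
  -- Jensen for the reproducing formula: a point value is bounded by a local average of |F|^p with
  -- weight |Φ|, and these weights have bounded sum over the lattice.
  have hpt : ∀ z, ‖F z‖ₑ ^ p ≤ M ^ (p - 1) * ∫⁻ y, ‖F y‖ₑ ^ p * ‖Φ (z - y)‖ₑ := by
    intro z
    have h1 : ‖F z‖ₑ ≤ ∫⁻ y, ‖F y‖ₑ * ‖Φ (z - y)‖ₑ := by
      conv_lhs => rw [hrep z]
      refine (enorm_integral_le_lintegral_enorm _).trans (le_of_eq ?_)
      simp only [enorm_mul]
    have hk : AEMeasurable fun y => ‖Φ (z - y)‖ₑ := by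
      have : Continuous fun y => Φ (z - y) := by fun_prop
      exact this.measurable.enorm.aemeasurable
    refine (ENNReal.rpow_le_rpow h1 hp0.le).trans ((lintegral_mul_rpow_le hp hFm hk).trans_eq ?_)
    congr 2
    exact lintegral_sub_left_eq_self (fun y => ‖Φ y‖ₑ) z
  refine ⟨(M ^ (p - 1) * (N * ENNReal.ofReal C)).toReal, fun r hr hr1 S => ?_⟩
  have hfin : M ^ (p - 1) * (N * ENNReal.ofReal C) ≠ ⊤ :=
    ENNReal.mul_ne_top (ENNReal.rpow_ne_top_of_nonneg (by linarith) hMtop)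
      (ENNReal.mul_ne_top hNtop ENNReal.ofReal_ne_top)
  rw [← ENNReal.ofReal_le_iff_le_toReal hfin, ENNReal.ofReal_sum_of_nonneg fun k _ => by positivity]
  calc _ = ∑ k ∈ S, ‖F (r • gridPoint A k)‖ₑ ^ p := by
        refine Finset.sum_congr rfl fun k _ => ?_
        rw [← ENNReal.ofReal_rpow_of_nonneg (norm_nonneg _) hp0.le, ofReal_norm]
    _ ≤ ∑ k ∈ S, M ^ (p - 1) * ∫⁻ y, ‖F y‖ₑ ^ p * ‖Φ (r • gridPoint A k - y)‖ₑ :=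
        Finset.sum_le_sum fun k _ => hpt _
    _ = M ^ (p - 1) * ∫⁻ y, ∑ k ∈ S, ‖F y‖ₑ ^ p * ‖Φ (r • gridPoint A k - y)‖ₑ := by
        rw [← Finset.mul_sum, lintegral_finsetSum' _ fun k _ => ?_]
        have : Continuous fun y => Φ (r • gridPoint A k - y) := by fun_prop
        exact (hFm.pow_const p).mul this.measurable.enorm.aemeasurable
    _ ≤ M ^ (p - 1) * ∫⁻ y, ‖F y‖ₑ ^ p * ENNReal.ofReal C := by
        gcongr with y
        rw [← Finset.mul_sum]
        gcongr
        refine le_trans (le_of_eq ?_) (ENNReal.ofReal_le_ofReal (hsum r hr hr1 y S))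
        rw [ENNReal.ofReal_sum_of_nonneg fun k _ => norm_nonneg _]
        simp only [ofReal_norm]
    _ = _ := by rw [lintegral_mul_const'' _ (hFm.pow_const p)]

end PlancherelPolya

/-! ### The critical sampling theorem in L^p. -/

section Sampling

variable {ι : Type*} [Fintype ι]

/-- Dilation by r < 1 pushes the spectrum of Φ into a compact part of the interior of the box. The
margin δ is the room for multiplying by a function with spectrum in a small ball. -/
theorem exists_schwartz_dilate_spectrum {A : ι → ℝ} (hA : ∀ i, 0 < A i) {r : ℝ} (hr : 0 < r)
    (hr1 : r < 1) : ∃ Φ : 𝓢(EuclideanSpace ℝ ι, ℂ), (∀ w ∈ gridBox A, 𝓕 (Φ : _ → ℂ) w = 1) ∧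
      ∃ δ : ℝ, 0 < δ ∧ ∀ w v, 𝓕 (Φ : _ → ℂ) w ≠ 0 → ‖v‖ ≤ δ → r • w + v ∈ gridBox A := by
  obtain ⟨φ, hφ, hc, hsub, h1⟩ := exists_contDiff_eq_one_tsupport_subset
    (U := (fun w => r • w) ⁻¹' interior (gridBox A)) (isCompact_gridBox A)
    (isOpen_interior.preimage (by fun_prop)) fun w hw => smul_mem_interior_gridBox hA hr hr1 hw
  obtain ⟨Φ, hΦ⟩ := exists_schwartz_fourier_eq hφ hc
  have hK : IsCompact ((fun w => r • w) '' tsupport φ) := hc.isCompact.image (by fun_prop)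
  obtain ⟨δ, hδ, hδQ⟩ := hK.exists_cthickening_subset_open isOpen_interior
    (Set.image_subset_iff.2 hsub)
  refine ⟨Φ, fun w hw => by rw [hΦ, h1 w hw], δ, hδ, fun w v hw hv => ?_⟩
  refine interior_subset (hδQ (Metric.mem_cthickening_of_dist_le _ (r • w) δ _ ?_ ?_))
  · exact ⟨w, subset_tsupport _ (by rwa [hΦ] at hw), rfl⟩
  · simpa using hv

theorem fourier_comp_smul_sub_eq_zero {V : Type*} [NormedAddCommGroup V] [InnerProductSpace ℝ V]
    [FiniteDimensional ℝ V] [MeasurableSpace V] [BorelSpace V] (f : V → ℂ) {r : ℝ} (hr : 0 < r)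
    (y w : V) (h : 𝓕 f (r⁻¹ • w) = 0) : 𝓕 (fun z => f (r • z - y)) w = 0 := by
  have h1 : ∀ z, 𝐞 (-inner ℝ z w) • f (r • z - y) =
      (fun x => 𝐞 (-inner ℝ (r⁻¹ • x) w) • f (x - y)) (r • z) := by
    intro z
    simp only [smul_smul, inv_mul_cancel₀ hr.ne', one_smul]
  have h2 : 𝓕 (fun x => f (x - y)) (r⁻¹ • w) = 0 := by
    have := VectorFourier.fourierIntegral_comp_add_right 𝐞 volume (innerₗ V) f (-y)
    have := congrFun this (r⁻¹ • w)
    simp only [Function.comp_def, ← sub_eq_add_neg] at this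
    refine this.trans ?_
    change _ • 𝓕 f (r⁻¹ • w) = 0
    rw [h, smul_zero]
  rw [Real.fourier_eq]
  rw [integral_congr_ae (ae_of_all _ h1), Measure.integral_comp_smul volume
    (fun x => 𝐞 (-inner ℝ (r⁻¹ • x) w) • f (x - y)) r]
  rw [Real.fourier_eq] at h2
  have h3 : ∀ x, inner ℝ (r⁻¹ • x) w = inner ℝ x (r⁻¹ • w) := fun x => by
    rw [inner_smul_left, inner_smul_right]; rfl
  simp only [h3, h2, smul_zero]

/-- The approximate sampling formula for a bounded bandlimited function, after a dilation and the
multiplication with a rapidly decreasing function. -/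
theorem hasSum_sample_dilate {A : ι → ℝ} (hA : ∀ i, 0 < A i) {F : EuclideanSpace ℝ ι → ℂ}
    (hFc : Continuous F) {B : ℝ} (hB : ∀ z, ‖F z‖ ≤ B)
    (hrep : ∀ Φ : 𝓢(EuclideanSpace ℝ ι, ℂ), (∀ w ∈ gridBox A, 𝓕 (Φ : _ → ℂ) w = 1) →
      ∀ z, F z = ∫ y, F y * Φ (z - y)) {κ : 𝓢(EuclideanSpace ℝ ι, ℂ)}
    (hκ : ∀ t, κ t ≠ 0 → ‖t‖ ≤ 1) {r : ℝ} (hr : 0 < r) (hr1 : r < 1) :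
    ∃ δ : ℝ, 0 < δ ∧ ∀ ε : ℝ, 0 < ε → ε ≤ δ → ∀ z,
      HasSum (fun k => F (r • gridPoint A k) * 𝓕 (κ : _ → ℂ) (ε • gridPoint A k) *
        gridSinc A (z - gridPoint A k)) (F (r • z) * 𝓕 (κ : _ → ℂ) (ε • z)) := by
  obtain ⟨Φ, hΦ1, δ, hδ, hΦ⟩ := exists_schwartz_dilate_spectrum hA hr hr1
  refine ⟨δ, hδ, fun ε hε hεδ z => ?_⟩
  have hΦc := Φ.continuous
  have hκc : Continuous (𝓕 (κ : _ → ℂ)) := continuous_fourier κ.integrable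
  have hv : ∀ y, Integrable fun z => Φ (r • z - y) := fun y =>
    (Φ.integrable.comp_sub_right y).comp_smul hr.ne'
  -- Shannon's theorem needs integrability, which F lacks. It is applied for each y to z ↦ κ̂(εz)
  -- Φ(rz - y), and the result is integrated against F(y).
  have hspec : ∀ y w, w ∉ gridBox A →
      𝓕 (fun z => 𝓕 (κ : _ → ℂ) (ε • z) * Φ (r • z - y)) w = 0 := by
    intro y w hw
    rw [fourier_mul_dilate κ.integrable (hv y)]
    refine integral_eq_zero_of_ae (ae_of_all _ fun t => ?_)
    simp only [Pi.zero_apply]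
    by_cases ht : κ t = 0
    · rw [ht, zero_mul]
    rw [fourier_comp_smul_sub_eq_zero _ hr, mul_zero]
    by_contra hne
    refine hw ?_
    have := hΦ _ (-(ε • t)) hne (by
      rw [norm_neg, norm_smul, Real.norm_of_nonneg hε.le]
      nlinarith [hκ t ht, norm_nonneg t])
    rwa [smul_smul, mul_inv_cancel₀ hr.ne', one_smul, add_neg_cancel_right] at this
  have hshan : ∀ y, HasSum (fun k => 𝓕 (κ : _ → ℂ) (ε • gridPoint A k) *
      Φ (r • gridPoint A k - y) * gridSinc A (z - gridPoint A k))
      (𝓕 (κ : _ → ℂ) (ε • z) * Φ (r • z - y)) := by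
    intro y
    refine hasSum_mul_gridSinc hA ?_ (by fun_prop) (hspec y) z
    refine (hv y).bdd_mul (c := ∫ t, ‖κ t‖) ?_ (ae_of_all _ fun z => norm_fourier_le _ _)
    exact (by fun_prop : Continuous fun z => 𝓕 (κ : _ → ℂ) (ε • z)).aestronglyMeasurable
  have hint : ∀ x, Integrable fun y => F y * Φ (x - y) := fun x =>
    (Φ.integrable.comp_sub_left x).bdd_mul hFc.aestronglyMeasurable (ae_of_all _ hB)
  set ψ : 𝓢(EuclideanSpace ℝ ι, ℂ) := SchwartzMap.compCLMOfContinuousLinearEquiv ℂ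
    (ContinuousLinearEquiv.smulLeft (R₁ := ℝ) (Units.mk0 ε hε.ne')) (𝓕 κ) with hψ
  have hψe : ∀ x, 𝓕 (κ : _ → ℂ) (ε • x) = ψ x := by
    intro x
    rw [hψ, SchwartzMap.compCLMOfContinuousLinearEquiv_apply, SchwartzMap.fourier_coe]
    rfl
  have hψs : Summable fun k => ‖ψ (gridPoint A k)‖ := by
    obtain ⟨C, -, hC⟩ := exists_sum_norm_schwartz_le hA ψ
    refine summable_of_sum_le (fun _ => norm_nonneg _) (c := C) fun S => ?_
    simpa using hC 1 (by norm_num) le_rfl 0 S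
  -- The exchange of sum and integral is paid for by the decay of κ̂(ε ·) along the lattice.
  have hfub := hasSum_integral_of_summable_integral_norm (μ := volume)
    (F := fun (k : ι → ℤ) y => F y * (𝓕 (κ : _ → ℂ) (ε • gridPoint A k) *
      Φ (r • gridPoint A k - y) * gridSinc A (z - gridPoint A k))) ?_ ?_
  · have hval : F (r • z) * 𝓕 (κ : _ → ℂ) (ε • z) = ∫ y, ∑' k : ι → ℤ, F y *
        (𝓕 (κ : _ → ℂ) (ε • gridPoint A k) * Φ (r • gridPoint A k - y) *
          gridSinc A (z - gridPoint A k)) := by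
      rw [hrep Φ hΦ1 (r • z), ← integral_mul_const]
      refine integral_congr_ae (ae_of_all _ fun y => ?_)
      simp only
      rw [((hshan y).mul_left (F y)).tsum_eq]
      ring
    rw [hval]
    refine hfub.congr_fun fun k => ?_
    · rw [hrep Φ hΦ1 (r • gridPoint A k), ← integral_mul_const, ← integral_mul_const]
      refine integral_congr_ae (ae_of_all _ fun y => ?_)
      ring
  · intro k
    refine ((hint (r • gridPoint A k)).const_mul (𝓕 (κ : _ → ℂ) (ε • gridPoint A k) *
      gridSinc A (z - gridPoint A k))).congr (ae_of_all _ fun y => ?_)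
    simp only
    ring
  · refine Summable.of_nonneg_of_le (fun k => integral_nonneg fun y => norm_nonneg _) (fun k => ?_)
      (hψs.mul_left (B * ∫ y, ‖Φ y‖))
    have hB0 : 0 ≤ B := (norm_nonneg _).trans (hB 0)
    calc _ ≤ ∫ y, B * ‖Φ (r • gridPoint A k - y)‖ * ‖ψ (gridPoint A k)‖ := by
          refine integral_mono_of_nonneg (ae_of_all _ fun y => norm_nonneg _) ?_
            (ae_of_all _ fun y => ?_)
          · exact ((Φ.integrable.comp_sub_left _).norm.const_mul B).mul_const _
          · simp only [norm_mul, hψe]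
            have h1 := norm_gridSinc_le_one A (z - gridPoint A k)
            calc _ ≤ B * (‖ψ (gridPoint A k)‖ * ‖Φ (r • gridPoint A k - y)‖ * 1) := by
                  gcongr
                  exact hB y
              _ = _ := by ring
      _ = _ := by
          rw [integral_mul_const, integral_const_mul]
          congr 2
          exact integral_sub_left_eq_self (fun y => ‖Φ y‖) volume _

/-- The sampling theorem for bounded bandlimited functions in `L^p`, `1 < p < ∞`. -/
theorem hasSum_sample_mul_gridSinc {A : ι → ℝ} (hA : ∀ i, 0 < A i) {F : EuclideanSpace ℝ ι → ℂ}
    (hFc : Continuous F) {B : ℝ} (hB : ∀ z, ‖F z‖ ≤ B)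
    (hrep : ∀ Φ : 𝓢(EuclideanSpace ℝ ι, ℂ), (∀ w ∈ gridBox A, 𝓕 (Φ : _ → ℂ) w = 1) →
      ∀ z, F z = ∫ y, F y * Φ (z - y)) {p : ℝ} (hp : 1 < p) (hF : MemLp F (ENNReal.ofReal p)) :
    (Summable fun k => ‖F (gridPoint A k)‖ ^ p) ∧
      ∀ z, HasSum (fun k => F (gridPoint A k) * gridSinc A (z - gridPoint A k)) (F z) := by
  have hpq := Real.HolderConjugate.conjExponent hp
  set q := p.conjExponent
  have hp0 := hpq.pos
  -- Any Φ₀ reproducing F will do here; the value 1/2 is immaterial.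
  obtain ⟨Φ₀, hΦ₀, -⟩ := exists_schwartz_dilate_spectrum hA (r := 1 / 2) (by norm_num) (by norm_num)
  obtain ⟨C, hC⟩ := exists_sum_norm_sample_rpow_le hA hp.le hF (hrep Φ₀ hΦ₀)
  refine ⟨summable_of_sum_le (fun _ => by positivity) (c := C) fun S => by
    simpa using hC 1 (by norm_num) le_rfl S, fun z => ?_⟩
  -- A nonnegative bump of mass one: κ̂(0) = 1 makes the factor disappear as ε → 0, and |κ̂| ≤ 1
  -- keeps the ℓ^p bound on the samples.
  obtain ⟨κ, hκ, hκ0, hκ1⟩ : ∃ κ : 𝓢(EuclideanSpace ℝ ι, ℂ), (∀ t, κ t ≠ 0 → ‖t‖ ≤ 1) ∧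
      𝓕 (κ : _ → ℂ) 0 = 1 ∧ ∀ x, ‖𝓕 (κ : _ → ℂ) x‖ ≤ 1 := by
    let b : ContDiffBump (0 : EuclideanSpace ℝ ι) := ⟨1 / 2, 1, by norm_num, by norm_num⟩
    have hcs : HasCompactSupport fun t => ((b.normed volume t : ℝ) : ℂ) :=
      b.hasCompactSupport_normed.comp_left (g := ((↑) : ℝ → ℂ)) rfl
    refine ⟨hcs.toSchwartzMap (Complex.ofRealCLM.contDiff.comp b.contDiff_normed), ?_, ?_, ?_⟩
    · intro t ht
      have h1 : t ∈ Function.support (b.normed volume) := fun h0 => ht (by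
        change ((b.normed volume t : ℝ) : ℂ) = 0
        rw [h0, Complex.ofReal_zero])
      rw [b.support_normed_eq] at h1
      simpa using (mem_ball_zero_iff.1 h1).le
    · rw [Real.fourier_eq]
      simp only [inner_zero_right, neg_zero, AddChar.map_zero_eq_one, one_smul]
      change ∫ t, ((b.normed volume t : ℝ) : ℂ) = 1
      rw [integral_complex_ofReal, b.integral_normed, Complex.ofReal_one]
    · intro x
      refine (norm_fourier_le _ _).trans (le_of_eq ?_)
      change ∫ t, ‖((b.normed volume t : ℝ) : ℂ)‖ = 1
      simp only [Complex.norm_real, Real.norm_of_nonneg (b.nonneg_normed _)]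
      exact b.integral_normed
  have hκc : Continuous (𝓕 (κ : _ → ℂ)) := continuous_fourier κ.integrable
  set r : ℕ → ℝ := fun j => 1 - 1 / (j + 2) with hr
  have hr0 : ∀ j, 1 / 2 ≤ r j := fun j => by
    have : (1 : ℝ) / (j + 2) ≤ 1 / 2 := one_div_le_one_div_of_le (by norm_num) (by
      have := j.cast_nonneg (α := ℝ); linarith)
    simp only [hr]
    linarith
  have hr1 : ∀ j, r j < 1 := fun j => by
    have : (0 : ℝ) < 1 / (j + 2) := by positivity
    simp only [hr]
    linarith
  have hrt : Tendsto r atTop (𝓝 1) := by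
    have h1 : Tendsto (fun j : ℕ => 1 / ((j : ℝ) + 2)) atTop (𝓝 0) := by
      have := (tendsto_add_atTop_iff_nat 1).2 (tendsto_one_div_add_atTop_nhds_zero_nat (𝕜 := ℝ))
      refine this.congr fun j => ?_
      push_cast
      ring
    simpa only [sub_zero] using (tendsto_const_nhds (x := (1 : ℝ))).sub h1
  choose δ hδ hsamp using fun j => hasSum_sample_dilate hA hFc hB hrep hκ
    (lt_of_lt_of_le (by norm_num) (hr0 j)) (hr1 j)
  -- The margin δ j may shrink as r j → 1, so ε j is bounded by it and by a null sequence.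
  set ε : ℕ → ℝ := fun j => min (δ j) (1 / (j + 1)) with hε
  have hε0 : ∀ j, 0 < ε j := fun j => lt_min (hδ j) (by positivity)
  have hεt : Tendsto ε atTop (𝓝 0) := squeeze_zero (fun j => (hε0 j).le) (fun j => min_le_right _ _)
    tendsto_one_div_add_atTop_nhds_zero_nat
  have hlim : ∀ x, Tendsto (fun j => F (r j • x) * 𝓕 (κ : _ → ℂ) (ε j • x)) atTop (𝓝 (F x)) := by
    intro x
    have h1 : Tendsto (fun j => r j • x) atTop (𝓝 x) := by simpa using hrt.smul_const x
    have h2 : Tendsto (fun j => ε j • x) atTop (𝓝 0) := by simpa using hεt.smul_const x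
    have h3 := ((hFc.tendsto x).comp h1).mul ((hκc.tendsto 0).comp h2)
    rwa [hκ0, mul_one] at h3
  refine hasSum_mul_of_tendsto hpq
    (a := fun j k => F (r j • gridPoint A k) * 𝓕 (κ : _ → ℂ) (ε j • gridPoint A k)) (C := C)
    (fun j S => ?_) ?_ (fun k => hlim _) (fun j => hsamp j _ (hε0 j) (min_le_left _ _) z) (hlim z)
  · refine le_trans (Finset.sum_le_sum fun k _ => ?_) (hC (r j) (hr0 j) (hr1 j).le S)
    refine Real.rpow_le_rpow (norm_nonneg _) ?_ hp0.le
    rw [norm_mul]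
    exact mul_le_of_le_one_right (norm_nonneg _) (hκ1 _)
  · obtain ⟨D, -, hD⟩ := exists_sum_norm_gridSinc_rpow_le hA hpq.symm.lt
    exact summable_of_sum_le (fun _ => by positivity) (hD z)

end Sampling


/-! ### Convolution of bounded continuous with integrable functions. -/

section BoundedConvolution

set_option linter.unusedSectionVars false

variable {V : Type*} [NormedAddCommGroup V] [InnerProductSpace ℝ V] [FiniteDimensional ℝ V]
  [MeasurableSpace V] [BorelSpace V]

/-- The convolution of complex-valued functions. -/
noncomputable abbrev cconv (f g : V → ℂ) : V → ℂ :=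
  convolution f g (ContinuousLinearMap.mul ℂ ℂ) volume

theorem cconv_apply (f g : V → ℂ) (z : V) : cconv f g z = ∫ y, f (z - y) * g y :=
  convolution_mul_swap

theorem cconv_comm (f g : V → ℂ) : cconv f g = cconv g f := by
  funext z
  rw [cconv_apply]
  exact integral_congr_ae (ae_of_all _ fun y => mul_comm _ _)

variable {s f g : V → ℂ} {B : ℝ}

theorem integrable_bounded_mul_sub (hs : Continuous s) (hB : ∀ z, ‖s z‖ ≤ B) (hf : Integrable f)
    (z : V) : Integrable fun y => s y * f (z - y) :=
  (hf.comp_sub_left z).bdd_mul hs.aestronglyMeasurable (ae_of_all _ hB)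

theorem integrable_bounded_sub_mul (hs : Continuous s) (hB : ∀ z, ‖s z‖ ≤ B) (hf : Integrable f)
    (z : V) : Integrable fun y => s (z - y) * f y :=
  hf.bdd_mul (hs.comp (continuous_const.sub continuous_id)).aestronglyMeasurable
    (ae_of_all _ fun _ => hB _)

theorem norm_cconv_le (hB : ∀ z, ‖s z‖ ≤ B) (hf : Integrable f) (z : V) :
    ‖cconv s f z‖ ≤ B * ∫ y, ‖f y‖ := by
  rw [cconv_apply, ← integral_const_mul]
  refine norm_integral_le_of_norm_le (hf.norm.const_mul B) (ae_of_all _ fun y => ?_)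
  rw [norm_mul]
  exact mul_le_mul_of_nonneg_right (hB _) (norm_nonneg _)

theorem continuous_cconv (hs : Continuous s) (hB : ∀ z, ‖s z‖ ≤ B) (hf : Integrable f) :
    Continuous (cconv s f) :=
  BddAbove.continuous_convolution_left_of_integrable _
    ⟨B, by rintro _ ⟨x, rfl⟩; exact hB x⟩ hs hf

theorem cconv_assoc (hs : Continuous s) (hB : ∀ z, ‖s z‖ ≤ B) (hf : Integrable f)
    (hg : Integrable g) : cconv (cconv s f) g = cconv s (cconv f g) := by
  funext z
  refine convolution_assoc _ _ _ _ (fun x y z => mul_assoc x y z) hs.aestronglyMeasurable hf.1 hg.1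
    (ae_of_all _ fun y => integrable_bounded_mul_sub hs hB hf y)
    (hf.norm.ae_convolution_exists _ hg.norm) ?_
  refine ((hf.norm.integrable_convolution (ContinuousLinearMap.mul ℝ ℝ)
    hg.norm).comp_sub_left z).bdd_mul (c := B) ?_ (ae_of_all _ fun x => by simpa using hB x)
  exact hs.norm.aestronglyMeasurable

theorem lintegral_cconv_rpow_le (hs : AEStronglyMeasurable s) (hf : Integrable f) {p : ℝ}
    (hp : 1 ≤ p) :
    ∫⁻ z, ‖cconv s f z‖ₑ ^ p ≤ (∫⁻ y, ‖f y‖ₑ) ^ p * ∫⁻ y, ‖s y‖ₑ ^ p := by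
  refine le_trans (lintegral_mono fun z => ?_)
    (lintegral_lintegral_mul_sub_rpow_le hp hs.enorm hf.1.enorm)
  refine ENNReal.rpow_le_rpow ?_ (by linarith)
  rw [cconv_apply]
  refine (enorm_integral_le_lintegral_enorm _).trans (le_of_eq ?_)
  simp only [enorm_mul]

theorem memLp_cconv (hs : Continuous s) (hB : ∀ z, ‖s z‖ ≤ B) (hf : Integrable f) {p : ℝ}
    (hp : 1 ≤ p) (hsp : MemLp s (ENNReal.ofReal p)) : MemLp (cconv s f) (ENNReal.ofReal p) := by
  have hp0 : 0 < p := by linarith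
  have hp' : ENNReal.ofReal p ≠ 0 := by simpa using hp0
  refine ⟨(continuous_cconv hs hB hf).aestronglyMeasurable, ?_⟩
  have h1 := hsp.2
  rw [eLpNorm_lt_top_iff_lintegral_rpow_enorm_lt_top hp' ENNReal.ofReal_ne_top,
    ENNReal.toReal_ofReal hp0.le] at h1 ⊢
  refine (lintegral_cconv_rpow_le hsp.1 hf hp).trans_lt ?_
  exact ENNReal.mul_lt_top (ENNReal.rpow_lt_top_of_nonneg hp0.le hf.2.ne) h1

/-- The values of the convolution of an `L^p` function with a Schwartz function are bounded. -/
theorem exists_norm_integral_mul_schwartz_sub_le {p : ℝ} (hp : 1 ≤ p) {σ : V → ℂ}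
    (hσ : MemLp σ (ENNReal.ofReal p)) (Φ : 𝓢(V, ℂ)) :
    ∃ B : ℝ, ∀ z, ‖∫ y, σ y * Φ (z - y)‖ ≤ B := by
  have hp0 : 0 < p := by linarith
  have hΦc := Φ.continuous
  obtain ⟨D, hD, hΦ⟩ := exists_schwartz_decay Φ 0
  have hΦD : ∀ x, ‖Φ x‖ ≤ D := fun x => by simpa using hΦ x
  have h1 := hσ.2
  rw [eLpNorm_lt_top_iff_lintegral_rpow_enorm_lt_top (by simpa using hp0) ENNReal.ofReal_ne_top,
    ENNReal.toReal_ofReal hp0.le] at h1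
  set X : ℝ≥0∞ := (∫⁻ y, ‖Φ y‖ₑ) ^ (p - 1) * ((∫⁻ y, ‖σ y‖ₑ ^ p) * ENNReal.ofReal D) with hX
  have hXt : X ≠ ⊤ := ENNReal.mul_ne_top
    (ENNReal.rpow_ne_top_of_nonneg (by linarith) Φ.integrable.2.ne)
    (ENNReal.mul_ne_top h1.ne ENNReal.ofReal_ne_top)
  refine ⟨(X ^ (1 / p)).toReal, fun z => ?_⟩
  have hXt' : X ^ (1 / p) ≠ ⊤ := ENNReal.rpow_ne_top_of_nonneg (by positivity) hXt
  rw [← ENNReal.ofReal_le_iff_le_toReal hXt', ofReal_norm, one_div, ENNReal.le_rpow_inv_iff hp0]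
  have hk : AEMeasurable fun y => ‖Φ (z - y)‖ₑ := by
    have : Continuous fun y => Φ (z - y) := by fun_prop
    exact this.measurable.enorm.aemeasurable
  calc _ ≤ (∫⁻ y, ‖σ y‖ₑ * ‖Φ (z - y)‖ₑ) ^ p := by
        gcongr
        refine (enorm_integral_le_lintegral_enorm _).trans (le_of_eq ?_)
        simp only [enorm_mul]
    _ ≤ _ := lintegral_mul_rpow_le hp hσ.1.enorm hk
    _ ≤ X := by
        rw [hX, ← lintegral_mul_const'' _ (hσ.1.enorm.pow_const p),
          lintegral_sub_left_eq_self (fun y => ‖Φ y‖ₑ) z]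
        gcongr with y
        rw [← ofReal_norm]
        exact ENNReal.ofReal_le_ofReal (hΦD _)

/-- The continuous representative of a bandlimited function in `L^p`, `1 ≤ p < ∞`: it is bounded
and reproduced by the convolution with the Schwartz functions whose Fourier transform is `1` on the
spectrum. -/
theorem exists_continuous_representative {p : ℝ≥0∞} [hp : Fact (1 ≤ p)] (hp' : p ≠ ⊤)
    (σ : Lp ℂ p (volume : Measure V)) {C : Set V} (hCc : IsCompact C)
    (hC : ∀ r : ℝ, 0 < r → r < 1 → ∀ x ∈ C, r • x ∈ interior C)
    (hσ : Distribution.dsupport (𝓕 (σ : 𝓢'(V, ℂ)) : 𝓢'(V, ℂ)) ⊆ C) :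
    ∃ (s : V → ℂ) (B : ℝ), Continuous s ∧ (∀ z, ‖s z‖ ≤ B) ∧ s =ᵐ[volume] σ ∧
      ∀ Φ : 𝓢(V, ℂ), (∀ w ∈ C, 𝓕 (Φ : V → ℂ) w = 1) → cconv s Φ = s := by
  obtain ⟨φ, hφ, hc, -, h1⟩ := exists_contDiff_eq_one_tsupport_subset hCc isOpen_univ
    (Set.subset_univ C)
  obtain ⟨Φ₀, hΦ₀⟩ := exists_schwartz_fourier_eq hφ hc
  obtain ⟨N, hN⟩ := exists_integrable_mul_decay hp.out (Lp.memLp σ)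
  have hpr : 1 ≤ p.toReal := by
    simpa using (ENNReal.toReal_le_toReal ENNReal.one_ne_top hp').2 hp.out
  obtain ⟨B, hB⟩ := exists_norm_integral_mul_schwartz_sub_le hpr (σ := σ)
    (by rw [ENNReal.ofReal_toReal hp']; exact Lp.memLp σ) Φ₀
  have hcont := fun Φ : 𝓢(V, ℂ) =>
    continuous_integral_mul_schwartz_sub (Lp.memLp σ).1 hN Φ
  have hae := fun (Φ : 𝓢(V, ℂ)) (hΦ : ∀ w ∈ C, 𝓕 (Φ : V → ℂ) w = 1) =>
    ae_eq_integral_mul_schwartz_sub σ hC hσ Φ hΦ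
  have hΦ₀1 : ∀ w ∈ C, 𝓕 (Φ₀ : V → ℂ) w = 1 := fun w hw => by rw [hΦ₀, h1 w hw]
  refine ⟨fun z => ∫ y, σ y * Φ₀ (z - y), B, hcont Φ₀, hB, (hae Φ₀ hΦ₀1).symm, fun Φ hΦ => ?_⟩
  -- Both sides are continuous and agree with σ almost everywhere, so the representative does not
  -- depend on the reproducing function.
  have h2 : (fun z => ∫ y, σ y * Φ (z - y)) = fun z => ∫ y, σ y * Φ₀ (z - y) :=
    (Continuous.ae_eq_iff_eq volume (hcont Φ) (hcont Φ₀)).1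
      ((hae Φ hΦ).symm.trans (hae Φ₀ hΦ₀1))
  rw [← h2]
  funext z
  refine integral_congr_ae ?_
  filter_upwards [hae Φ hΦ] with y hy
  simp only [ContinuousLinearMap.mul_apply']
  rw [hy]

/-- The convolution with an integrable function keeps the reproducing property. -/
theorem cconv_schwartz_eq_of_cconv (hs : Continuous s) (hB : ∀ z, ‖s z‖ ≤ B) (hf : Integrable f)
    {Φ : 𝓢(V, ℂ)} (h : cconv s Φ = s) : cconv (cconv s f) Φ = cconv s f := by
  rw [cconv_assoc hs hB hf Φ.integrable, cconv_comm f, ← cconv_assoc hs hB Φ.integrable hf, h]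

/-- A reproducing function is recovered from its convolution with `f` by the convolution with a
kernel whose Fourier transform inverts that of `f` on the spectrum. -/
theorem cconv_cconv_eq_self (hs : Continuous s) (hB : ∀ z, ‖s z‖ ≤ B) (hf : Integrable f)
    (hg : Integrable g) {Φ : 𝓢(V, ℂ)} (h : cconv s Φ = s)
    (hfg : ∀ w, 𝓕 f w * 𝓕 g w = 𝓕 (Φ : V → ℂ) w) : cconv (cconv s f) g = s := by
  rw [cconv_assoc hs hB hf hg]
  have h1 : cconv f g =ᵐ[volume] Φ := by
    refine ae_eq_of_fourier_eq (integrable_convolution hf hg) Φ.integrable (funext fun w => ?_)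
    rw [fourier_convolution hf hg, hfg]
  conv_rhs => rw [← h]
  funext z
  rw [cconv_apply, cconv_apply]
  refine integral_congr_ae ?_
  filter_upwards [h1] with y hy
  rw [hy]

end BoundedConvolution


/-! ### Covariance and Fourier transform of the Rihaczek distribution. -/

section PhaseSpace

variable {d : ℕ}

/-- The coordinates `(x, ξ)` of a point of the time-frequency plane. -/
noncomputable def phaseEquiv (d : ℕ) : Phase d ≃ᵐ Config d × Config d :=
  ((MeasurableEquiv.toLp 2 (Fin d ⊕ Fin d → ℝ)).symm.trans
    (MeasurableEquiv.sumPiEquivProdPi fun _ => ℝ)).trans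
    ((MeasurableEquiv.toLp 2 (Fin d → ℝ)).prodCongr (MeasurableEquiv.toLp 2 (Fin d → ℝ)))

theorem measurePreserving_phaseEquiv :
    MeasurePreserving (phaseEquiv d) volume (volume.prod volume) :=
  (((PiLp.volume_preserving_toLp (Fin d)).prod (PiLp.volume_preserving_toLp (Fin d))).comp
    (volume_measurePreserving_sumPiEquivProdPi fun _ : Fin d ⊕ Fin d => ℝ)).comp
    (PiLp.volume_preserving_ofLp (Fin d ⊕ Fin d))

theorem integral_phase (f : Config d × Config d → ℂ) :
    ∫ z : Phase d, f (fstPart z, sndPart z) = ∫ q, f q ∂(volume.prod volume) :=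
  measurePreserving_phaseEquiv.integral_comp' f

theorem integrable_phase_iff {f : Config d × Config d → ℂ} :
    Integrable (fun z : Phase d => f (fstPart z, sndPart z)) ↔
      Integrable f (volume.prod volume) :=
  measurePreserving_phaseEquiv.integrable_comp_emb (phaseEquiv d).measurableEmbedding

theorem inner_phase (z w : Phase d) :
    inner ℝ z w = inner ℝ (fstPart z) (fstPart w) + inner ℝ (sndPart z) (sndPart w) := by
  simp [PiLp.inner_apply, Fintype.sum_sum_type, fstPart, sndPart]

theorem fstPart_pair (x ξ : Config d) : fstPart (pair x ξ) = x := rfl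

theorem sndPart_pair (x ξ : Config d) : sndPart (pair x ξ) = ξ := rfl

theorem fstPart_sub (z w : Phase d) : fstPart (z - w) = fstPart z - fstPart w := rfl

theorem sndPart_sub (z w : Phase d) : sndPart (z - w) = sndPart z - sndPart w := rfl

theorem norm_character (x y : Config d) : ‖character x y‖ = 1 := by
  rw [character, show 2 * (Real.pi : ℂ) * Complex.I * (inner ℝ x y : ℝ) =
    ((2 * Real.pi * inner ℝ x y : ℝ) : ℂ) * Complex.I by push_cast; ring,
    Complex.norm_exp_ofReal_mul_I]

theorem continuous_character : Continuous fun q : Config d × Config d => character q.1 q.2 := by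
  unfold character
  fun_prop

theorem character_eq_fourierChar (x y : Config d) :
    character x y = ((Real.fourierChar (inner ℝ x y) : Circle) : ℂ) := by
  rw [character, Real.fourierChar_apply]
  congr 1
  push_cast
  ring

theorem integrable_rihaczek {f h : Config d → ℂ} (hf : Integrable f) (hh : Integrable (𝓕 h)) :
    Integrable (rihaczek f h) := by
  refine (integrable_phase_iff (f := fun q => f q.1 * conj (𝓕 h q.2) * character (-q.1) q.2)).2 ?_
  have h1 : Integrable (fun q : Config d × Config d => f q.1 * conj (𝓕 h q.2))
      (volume.prod volume) := hf.mul_prod (Complex.conjCLE.integrable_comp_iff.2 hh)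
  have h2 : Continuous fun q : Config d × Config d => character (-q.1) q.2 :=
    continuous_character.comp (by fun_prop : Continuous fun q : Config d × Config d => (-q.1, q.2))
  exact h1.mul_bdd (c := 1) h2.aestronglyMeasurable (ae_of_all _ fun q => (norm_character _ _).le)

theorem integrable_tfShift {f : Config d → ℂ} (hf : Integrable f) (z : Phase d) :
    Integrable (tfShift z f) := by
  have h2 : Continuous fun t : Config d => character (sndPart z) t :=
    continuous_character.comp (by fun_prop : Continuous fun t : Config d => (sndPart z, t))
  exact (hf.comp_sub_right (fstPart z)).bdd_mul (c := 1) h2.aestronglyMeasurable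
    (ae_of_all _ fun t => (norm_character _ _).le)

theorem fourier_tfShift (f : Config d → ℂ) (z : Phase d) (w : Config d) :
    𝓕 (tfShift z f) w = character (-fstPart z) (w - sndPart z) * 𝓕 f (w - sndPart z) := by
  have h1 : tfShift z f = fun t =>
      ((Real.fourierChar (inner ℝ t (sndPart z)) : Circle) : ℂ) * f (t - fstPart z) := by
    funext t
    rw [tfShift, character_eq_fourierChar, real_inner_comm]
  have h2 := VectorFourier.fourierIntegral_comp_add_right Real.fourierChar volume
    (innerₗ (Config d)) f (-fstPart z)
  have h3 := congrFun h2 (w - sndPart z)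
  simp only [Function.comp_def, ← sub_eq_add_neg] at h3
  rw [h1, fourier_modulate (fun t => f (t - fstPart z)), character_eq_fourierChar]
  exact h3

theorem integrable_fourier_tfShift {f : Config d → ℂ} (hf : Integrable (𝓕 f)) (z : Phase d) :
    Integrable (𝓕 (tfShift z f)) := by
  have h1 : Integrable fun w => 𝓕 f (w - sndPart z) := hf.comp_sub_right (sndPart z)
  have h2 : Continuous fun t : Config d => character (-fstPart z) (t - sndPart z) := by
    unfold character
    fun_prop
  have h3 : Integrable fun w => character (-fstPart z) (w - sndPart z) * 𝓕 f (w - sndPart z) :=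
    h1.bdd_mul (c := 1) h2.aestronglyMeasurable (ae_of_all _ fun t => (norm_character _ _).le)
  have he : 𝓕 (tfShift z f) = fun w =>
    character (-fstPart z) (w - sndPart z) * 𝓕 f (w - sndPart z) := funext (fourier_tfShift f z)
  rw [he]
  exact h3

/-- With the same shift in both slots, the phases from the modulation, from the Fourier transform of
the translation and from the character combine into the single character at z - l. For two different
shifts an oscillating factor would remain. -/
theorem rihaczek_tfShift (g : Config d → ℂ) (l z : Phase d) :
    rihaczek (tfShift l g) (tfShift l g) z = rihaczek g g (z - l) := by
  have hc : ∀ x y : Config d, conj (character x y) = character (-x) y := by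
    intro x y
    rw [character, character, ← Complex.exp_conj]
    congr 1
    simp only [map_mul, map_ofNat, Complex.conj_ofReal, Complex.conj_I, inner_neg_left,
      Complex.ofReal_neg]
    ring
  rw [rihaczek, rihaczek, fourier_tfShift, tfShift, map_mul, hc, fstPart_sub, sndPart_sub]
  have hm : character (sndPart l) (fstPart z) *
      (character (- -fstPart l) (sndPart z - sndPart l) * character (-fstPart z) (sndPart z)) =
      character (-(fstPart z - fstPart l)) (sndPart z - sndPart l) := by
    simp only [character]
    rw [← Complex.exp_add, ← Complex.exp_add]
    congr 1
    rw [← mul_add, ← mul_add]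
    congr 1
    norm_cast
    simp only [inner_sub_left, inner_sub_right, inner_neg_left]
    rw [real_inner_comm (fstPart z) (sndPart l)]
    ring
  rw [← hm]
  ring

/-- The Fourier transform of the Rihaczek distribution of `g` is its rotated short-time Fourier
transform. -/
theorem fourier_rihaczek {g : Config d → ℂ} (hg : Integrable g) (hg' : Integrable (𝓕 g))
    (w : Phase d) : 𝓕 (rihaczek g g) w = swapU (stft g g) w := by
  set x₀ := fstPart w with hx₀
  set ξ₀ := sndPart w with hξ₀
  have hR := integrable_rihaczek hg hg'
  have hint : Integrable (fun q : Config d × Config d =>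
      ((Real.fourierChar (-(inner ℝ q.1 x₀ + inner ℝ q.2 ξ₀)) : Circle) : ℂ) *
        (g q.1 * conj (𝓕 g q.2) * character (-q.1) q.2)) (volume.prod volume) := by
    have h1 : Integrable (fun q : Config d × Config d => g q.1 * conj (𝓕 g q.2) *
      character (-q.1) q.2) (volume.prod volume) := integrable_phase_iff.1 hR
    refine h1.bdd_mul (c := 1) (Continuous.aestronglyMeasurable ?_)
      (ae_of_all _ fun q => (Circle.norm_coe _).le)
    have := Real.continuous_fourierChar
    fun_prop
  calc _ = ∫ z : Phase d, (fun q : Config d × Config d =>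
        ((Real.fourierChar (-(inner ℝ q.1 x₀ + inner ℝ q.2 ξ₀)) : Circle) : ℂ) *
        (g q.1 * conj (𝓕 g q.2) * character (-q.1) q.2)) (fstPart z, sndPart z) := by
        rw [Real.fourier_eq]
        refine integral_congr_ae (ae_of_all _ fun z => ?_)
        simp only [Circle.smul_def, smul_eq_mul]
        rw [inner_phase, rihaczek]
    _ = ∫ x, ∫ ξ, ((Real.fourierChar (-(inner ℝ x x₀ + inner ℝ ξ ξ₀)) : Circle) : ℂ) *
        (g x * conj (𝓕 g ξ) * character (-x) ξ) := by
        exact (integral_phase _).trans (integral_prod _ hint)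
    -- The integral over ξ is a conjugated inverse Fourier transform of ĝ at x + ξ₀; inversion then
    -- holds for almost every x, which suffices.
    _ = ∫ x, g x * character (-x₀) x * conj (𝓕⁻ (𝓕 g) (x + ξ₀)) := by
        refine integral_congr_ae (ae_of_all _ fun x => ?_)
        simp only
        rw [Real.fourierInv_eq, ← integral_conj, ← integral_const_mul]
        refine integral_congr_ae (ae_of_all _ fun ξ => ?_)
        simp only [Circle.smul_def, smul_eq_mul, map_mul, character_eq_fourierChar]
        have hm : ((Real.fourierChar (-(inner ℝ x x₀ + inner ℝ ξ ξ₀)) : Circle) : ℂ) *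
            ((Real.fourierChar (inner ℝ (-x) ξ) : Circle) : ℂ) =
            ((Real.fourierChar (inner ℝ (-x₀) x) : Circle) : ℂ) *
              conj ((Real.fourierChar (inner ℝ ξ (x + ξ₀)) : Circle) : ℂ) := by
          rw [← Circle.coe_inv_eq_conj, ← AddChar.map_neg_eq_inv, ← Circle.coe_mul,
            ← Circle.coe_mul, ← AddChar.map_add_eq_mul, ← AddChar.map_add_eq_mul]
          congr 2
          simp only [inner_add_right, inner_neg_left]
          rw [real_inner_comm x₀ x, real_inner_comm ξ x]
          ring
        linear_combination (g x * conj (𝓕 g ξ)) * hm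
    _ = ∫ x, g x * character (-x₀) x * conj (g (x + ξ₀)) := by
        have h1 := (measurePreserving_add_right volume ξ₀).quasiMeasurePreserving.ae
          (fourierInv_fourier_ae hg hg')
        refine integral_congr_ae ?_
        filter_upwards [h1] with x hx
        rw [hx]
    _ = _ := by
        rw [swapU, stft, sndPart_pair, fstPart_pair]
        refine integral_congr_ae (ae_of_all _ fun x => ?_)
        simp only [sub_neg_eq_add]
        ring

end PhaseSpace

/-! ### Reflection and conjugation. -/

section Reflection

variable {V : Type*} [NormedAddCommGroup V] [InnerProductSpace ℝ V] [FiniteDimensional ℝ V]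
  [MeasurableSpace V] [BorelSpace V]

theorem fourier_conj_comp_neg (R : V → ℂ) (w : V) :
    𝓕 (fun z => conj (R (-z))) w = conj (𝓕 R w) := by
  rw [Real.fourier_eq, Real.fourier_eq, ← integral_conj, ← integral_neg_eq_self]
  refine integral_congr_ae (ae_of_all _ fun z => ?_)
  simp only [neg_neg, inner_neg_left, Circle.smul_def, smul_eq_mul, map_mul]
  rw [← Circle.coe_inv_eq_conj, ← AddChar.map_neg_eq_inv, neg_neg]

theorem integrable_conj_comp_neg {R : V → ℂ} (hR : Integrable R) :
    Integrable fun z => conj (R (-z)) :=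
  Complex.conjCLE.integrable_comp_iff.2 hR.comp_neg

end Reflection

/-! ### The kernel K and the diagonal of the channel matrix. -/

section Kernel

variable {d : ℕ} {g : Config d → ℂ} {φ : Phase d → ℂ}

theorem fourier_conj_rihaczek_comp_neg (hg : Integrable g) (hg' : Integrable (𝓕 g)) (w : Phase d) :
    𝓕 (fun z => conj (rihaczek g g (-z))) w = conj (swapU (stft g g) w) := by
  rw [fourier_conj_comp_neg, fourier_rihaczek hg hg']

/-- The kernel `K` is integrable, with Fourier transform `φ / conj(U V_g g)`. -/
theorem kernelK_spec (hg : Integrable g) (hg' : Integrable (𝓕 g)) (hφ : ContDiff ℝ ∞ φ)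
    (hφc : HasCompactSupport φ) (hφ0 : ∀ w ∈ tsupport φ, conj (swapU (stft g g) w) ≠ 0) :
    Integrable (quotientSymbol g φ) ∧ Continuous (quotientSymbol g φ) ∧
      Integrable (kernelK g φ) ∧ 𝓕 (kernelK g φ) = quotientSymbol g φ := by
  have hρ := integrable_conj_comp_neg (integrable_rihaczek hg hg')
  have hF := fourier_conj_rihaczek_comp_neg hg hg'
  obtain ⟨k, hk, hkF⟩ := isFourierL1_div hρ hφ hφc fun w hw => by rw [hF]; exact hφ0 w hw
  have hq : 𝓕 k = quotientSymbol g φ := by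
    rw [hkF]
    funext w
    rw [hF, quotientSymbol]
  have hqc : Continuous (quotientSymbol g φ) := hq ▸ continuous_fourier hk
  have hqi : Integrable (quotientSymbol g φ) := by
    refine hqc.integrable_of_hasCompactSupport (hφc.mono fun w hw h0 => hw ?_)
    rw [quotientSymbol, h0, zero_div]
  -- Wiener's lemma only provides some integrable k with the right transform; inversion identifies
  -- it almost everywhere with K.
  have hae : kernelK g φ =ᵐ[volume] k := by
    rw [kernelK, ← hq]
    exact fourierInv_fourier_ae hk (hq ▸ hqi)
  refine ⟨hqi, hqc, hk.congr hae.symm, ?_⟩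
  rw [← hq]
  funext w
  rw [Real.fourier_eq, Real.fourier_eq]
  refine integral_congr_ae ?_
  filter_upwards [hae] with x hx
  rw [hx]

/-- The covariance makes the diagonal pairing a correlation of σ with R(g, g), that is, a
convolution with the reflected conjugate, sampled at the lattice point. -/
theorem channelMatrix_diag (a b : ℝ) (σ : Phase d → ℂ) (l : Index d) :
    channelMatrix a b g σ l l =
      cconv σ (fun z => conj (rihaczek g g (-z))) (latticePoint a b l) := by
  rw [channelMatrix, knForm]
  refine integral_congr_ae (ae_of_all _ fun z => ?_)
  simp only [rihaczek_tfShift, neg_sub, ContinuousLinearMap.mul_apply']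

end Kernel


/-! ### Series of translates of a convolution. -/

section TranslateSeries

set_option linter.unusedSectionVars false

variable {V : Type*} [NormedAddCommGroup V] [InnerProductSpace ℝ V] [FiniteDimensional ℝ V]
  [MeasurableSpace V] [BorelSpace V] {κ : Type*} {s K : V → ℂ} {pt : κ → V}

/-- The `ℓ^q` norms of the sequences `k ↦ s (z - pt k)` are bounded, uniformly in `z`. -/
def TranslatesBounded (s : V → ℂ) (pt : κ → V) (q : ℝ) : Prop :=
  ∃ D : ℝ, ∀ (z : V) (S : Finset κ), ∑ k ∈ S, ‖s (z - pt k)‖ ^ q ≤ D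

/-- The synthesis operator `c ↦ ∑ c k s (· - pt k)` is bounded from `ℓ^q` to `L^q`. -/
def SynthesisBounded (s : V → ℂ) (pt : κ → V) (q : ℝ) : Prop :=
  ∃ C : NNReal, ∀ (S : Finset κ) (c : κ → ℂ),
    ∫⁻ z, ‖∑ k ∈ S, c k * s (z - pt k)‖ₑ ^ q ≤ C * ∑ k ∈ S, ‖c k‖ₑ ^ q

theorem norm_cconv_le_integral (z : V) : ‖cconv s K z‖ ≤ ∫ y, ‖s (z - y)‖ * ‖K y‖ := by
  rw [cconv_apply]
  refine (norm_integral_le_integral_norm _).trans (le_of_eq ?_)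
  simp only [norm_mul]

/-- Hölder is applied under the integral, at each shifted point z - y, where the ℓ^q bound of the
translates is uniform; what remains is ∫ |K|. So s ∗ K inherits the bound without any decay of K
beyond integrability. -/
theorem exists_sum_mul_integral_le (hs : Continuous s) {B : ℝ} (hB : ∀ z, ‖s z‖ ≤ B)
    (hK : Integrable K) {p q : ℝ} (hpq : p.HolderConjugate q) (hD : TranslatesBounded s pt q) :
    ∃ M : ℝ, 0 ≤ M ∧ ∀ (c : κ → ℂ) (S : Finset κ) (z : V),
      ∑ k ∈ S, ‖c k‖ * ∫ y, ‖s (z - pt k - y)‖ * ‖K y‖ ≤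
        M * (∑ k ∈ S, ‖c k‖ ^ p) ^ (1 / p) := by
  obtain ⟨D, hD⟩ := hD
  have hD0 : 0 ≤ D := by simpa using hD 0 ∅
  refine ⟨D ^ (1 / q) * ∫ y, ‖K y‖, mul_nonneg (by positivity)
    (integral_nonneg fun y => norm_nonneg _), fun c S z => ?_⟩
  have hint : ∀ x, Integrable fun y => ‖s (x - y)‖ * ‖K y‖ := fun x =>
    (integrable_bounded_sub_mul hs hB hK x).norm.congr (ae_of_all _ fun y => norm_mul _ _)
  have hc0 : 0 ≤ ∑ k ∈ S, ‖c k‖ ^ p := Finset.sum_nonneg fun k _ => by positivity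
  calc _ = ∫ y, ∑ k ∈ S, ‖c k‖ * (‖s (z - pt k - y)‖ * ‖K y‖) := by
        rw [integral_finsetSum _ fun k _ => (hint _).const_mul _]
        simp only [integral_const_mul]
    _ ≤ ∫ y, ((∑ k ∈ S, ‖c k‖ ^ p) ^ (1 / p) * D ^ (1 / q)) * ‖K y‖ := by
        refine integral_mono (integrable_finsetSum _ fun k _ => (hint _).const_mul _)
          (hK.norm.const_mul _) fun y => ?_
        simp only
        calc _ = (∑ k ∈ S, ‖c k‖ * ‖s (z - y - pt k)‖) * ‖K y‖ := by
              rw [Finset.sum_mul]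
              refine Finset.sum_congr rfl fun k _ => ?_
              rw [sub_right_comm, mul_assoc]
          _ ≤ _ := by
              have h1 := norm_sum_mul_le_Lp_mul_Lq hpq S c fun k => s (z - y - pt k)
              have h2 : 0 ≤ ∑ k ∈ S, ‖s (z - y - pt k)‖ ^ q :=
                Finset.sum_nonneg fun k _ => by positivity
              have h3 := hpq.symm.one_div_nonneg
              refine mul_le_mul_of_nonneg_right (h1.trans ?_) (norm_nonneg _)
              gcongr
              exact hD _ _
    _ = _ := by rw [integral_const_mul]; ring

/-- Sums of translates of a convolution with coefficients in `ℓ^p`. -/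
theorem exists_sum_norm_mul_cconv_le (hs : Continuous s) {B : ℝ} (hB : ∀ z, ‖s z‖ ≤ B)
    (hK : Integrable K) {p q : ℝ} (hpq : p.HolderConjugate q) (hD : TranslatesBounded s pt q) :
    ∃ M : ℝ, 0 ≤ M ∧ ∀ (c : κ → ℂ) (S : Finset κ) (z : V),
      ∑ k ∈ S, ‖c k * cconv s K (z - pt k)‖ ≤ M * (∑ k ∈ S, ‖c k‖ ^ p) ^ (1 / p) := by
  obtain ⟨M, hM, h⟩ := exists_sum_mul_integral_le hs hB hK hpq hD
  refine ⟨M, hM, fun c S z => (Finset.sum_le_sum fun k _ => ?_).trans (h c S z)⟩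
  rw [norm_mul]
  exact mul_le_mul_of_nonneg_left (norm_cconv_le_integral _) (norm_nonneg _)

/-- The given series is convolved with K term by term; the uniform bound on sums of absolute values
justifies the exchange. -/
theorem hasSum_mul_cconv [Countable κ] (hs : Continuous s) {B : ℝ} (hB : ∀ z, ‖s z‖ ≤ B)
    (hK : Integrable K) {p q : ℝ} (hpq : p.HolderConjugate q) (hD : TranslatesBounded s pt q)
    {c : κ → ℂ} (hc : Summable fun k => ‖c k‖ ^ p) {F : V → ℂ}
    (hF : ∀ z, HasSum (fun k => c k * s (z - pt k)) (F z)) (z : V) :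
    HasSum (fun k => c k * cconv s K (z - pt k)) (cconv F K z) := by
  obtain ⟨M, hM, h⟩ := exists_sum_mul_integral_le (pt := pt) hs hB hK hpq hD
  have hint : ∀ x, Integrable fun y => s (x - y) * K y := integrable_bounded_sub_mul hs hB hK
  have hfub := hasSum_integral_of_summable_integral_norm (μ := volume)
    (F := fun (k : κ) y => c k * (s (z - pt k - y) * K y)) (fun k => (hint _).const_mul _) ?_
  · have hv : cconv F K z = ∫ y, ∑' k, c k * (s (z - pt k - y) * K y) := by
      rw [cconv_apply]
      refine integral_congr_ae (ae_of_all _ fun y => ?_)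
      simp only
      rw [← ((hF (z - y)).mul_right (K y)).tsum_eq]
      congr 1
      funext k
      rw [sub_right_comm, mul_assoc]
    rw [hv]
    refine hfub.congr_fun fun k => ?_
    rw [cconv_apply, integral_const_mul]
  · refine summable_of_sum_le (fun k => integral_nonneg fun y => norm_nonneg _)
      (c := M * (∑' k, ‖c k‖ ^ p) ^ (1 / p)) fun S => ?_
    simp only [norm_mul, integral_const_mul]
    refine (h c S z).trans ?_
    have hn : ∀ k, 0 ≤ ‖c k‖ ^ p := fun k => by positivity
    have h1 := hc.sum_le_tsum S fun k _ => hn k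
    have h2 : 0 ≤ ∑ k ∈ S, ‖c k‖ ^ p := Finset.sum_nonneg fun k _ => hn k
    have h3 := hpq.one_div_nonneg
    gcongr

/-- A series whose absolute partial sums are controlled, uniformly in `z`, by the partial sums of a
convergent series converges absolutely and uniformly. -/
theorem summable_and_tendstoUniformly_of_sum_norm_le {X : Type*} {u : κ → X → ℂ} {f : X → ℂ}
    {a : κ → ℝ} {M r : ℝ} (hr : 0 < r) (hM : 0 ≤ M) (ha0 : ∀ k, 0 ≤ a k) (ha : Summable a)
    (hu : ∀ S z, ∑ k ∈ S, ‖u k z‖ ≤ M * (∑ k ∈ S, a k) ^ r)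
    (hf : ∀ z, HasSum (fun k => u k z) (f z)) :
    (∀ z, Summable fun k => ‖u k z‖) ∧
      TendstoUniformly (fun (S : Finset κ) z => ∑ k ∈ S, u k z) f atTop := by
  classical
  refine ⟨fun z => summable_of_sum_le (fun _ => norm_nonneg _) (c := M * (∑' k, a k) ^ r)
    fun S => (hu S z).trans ?_, ?_⟩
  · have h1 := ha.sum_le_tsum S fun k _ => ha0 k
    have h2 : 0 ≤ ∑ k ∈ S, a k := Finset.sum_nonneg fun k _ => ha0 k
    gcongr
  · rw [Metric.tendstoUniformly_iff]
    intro ε hε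
    set δ : ℝ := (ε / 2 / (M + 1)) ^ (1 / r) with hδ
    have hδ0 : 0 < δ := by positivity
    obtain ⟨T₀, hT₀⟩ := summable_iff_vanishing_norm.1 ha δ hδ0
    filter_upwards [eventually_ge_atTop T₀] with T hT z
    have h1 : Tendsto (fun S : Finset κ => ‖∑ k ∈ S, u k z - ∑ k ∈ T, u k z‖) atTop
        (𝓝 ‖f z - ∑ k ∈ T, u k z‖) := ((hf z).sub_const _).norm
    rw [dist_eq_norm]
    refine lt_of_le_of_lt (le_of_tendsto h1 ?_) (half_lt_self hε)
    filter_upwards [eventually_ge_atTop T] with S hS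
    rw [← Finset.sum_sdiff hS, add_sub_cancel_right]
    refine (norm_sum_le _ _).trans ((hu _ z).trans ?_)
    have h2 : ∑ k ∈ S \ T, a k ≤ δ :=
      (le_abs_self _).trans (hT₀ (S \ T) (Finset.disjoint_of_subset_right hT
        Finset.sdiff_disjoint)).le
    have h3 : 0 ≤ ∑ k ∈ S \ T, a k := Finset.sum_nonneg fun k _ => ha0 k
    calc _ ≤ M * δ ^ r := by gcongr
      _ = M * (ε / 2 / (M + 1)) := by
          rw [hδ, ← Real.rpow_mul (by positivity), one_div_mul_cancel hr.ne', Real.rpow_one]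
      _ ≤ ε / 2 := by
          rw [mul_div_assoc', div_le_iff₀ (by positivity)]
          nlinarith

theorem sum_mul_cconv_eq (hs : Continuous s) {B : ℝ} (hB : ∀ z, ‖s z‖ ≤ B)
    (hK : Integrable K) (S : Finset κ) (c : κ → ℂ) (z : V) :
    ∑ k ∈ S, c k * cconv s K (z - pt k) = cconv (fun x => ∑ k ∈ S, c k * s (x - pt k)) K z := by
  simp only [cconv_apply]
  have hint : ∀ x, Integrable fun y => s (x - y) * K y := integrable_bounded_sub_mul hs hB hK
  simp only [← integral_const_mul]
  rw [← integral_finsetSum _ fun k _ => (hint _).const_mul _]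
  refine integral_congr_ae (ae_of_all _ fun y => ?_)
  simp only
  rw [Finset.sum_mul]
  refine Finset.sum_congr rfl fun k _ => ?_
  rw [sub_right_comm, mul_assoc]

theorem synthesisBounded_cconv (hs : Continuous s) {B : ℝ} (hB : ∀ z, ‖s z‖ ≤ B)
    (hK : Integrable K) {q : ℝ} (hq : 1 ≤ q) (h : SynthesisBounded s pt q) :
    SynthesisBounded (cconv s K) pt q := by
  obtain ⟨C, hC⟩ := h
  have hKt : (∫⁻ y, ‖K y‖ₑ) ^ q ≠ ⊤ := ENNReal.rpow_ne_top_of_nonneg (by linarith) hK.2.ne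
  refine ⟨((∫⁻ y, ‖K y‖ₑ) ^ q).toNNReal * C, fun S c => ?_⟩
  simp only [sum_mul_cconv_eq hs hB hK]
  have hcont : Continuous fun x => ∑ k ∈ S, c k * s (x - pt k) := by fun_prop
  refine (lintegral_cconv_rpow_le hcont.aestronglyMeasurable hK hq).trans ?_
  rw [ENNReal.coe_mul, ENNReal.coe_toNNReal hKt, mul_assoc]
  gcongr
  exact hC S c

/-- Convergence in `L^q` of a pointwise convergent series of translates with coefficients in
`ℓ^q`. -/
theorem memLp_and_tendsto_eLpNorm [Countable κ] {G : V → ℂ} (hG : Continuous G) {q : ℝ}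
    (hq : 0 < q) (h : SynthesisBounded G pt q) {c : κ → ℂ} (hc : Summable fun k => ‖c k‖ ^ q)
    {f : V → ℂ} (hf : ∀ z, HasSum (fun k => c k * G (z - pt k)) (f z)) :
    (∀ k, MemLp (fun z => c k * G (z - pt k)) (ENNReal.ofReal q)) ∧
      Tendsto (fun S : Finset κ => eLpNorm (fun z => ∑ k ∈ S, c k * G (z - pt k) - f z)
        (ENNReal.ofReal q) volume) atTop (𝓝 0) := by
  classical
  obtain ⟨C, hC⟩ := h
  have hq0 : ENNReal.ofReal q ≠ 0 := by simpa using hq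
  have hbound : ∀ S : Finset κ, eLpNorm (fun z => ∑ k ∈ S, c k * G (z - pt k))
      (ENNReal.ofReal q) volume ≤ (C * ∑ k ∈ S, ‖c k‖ₑ ^ q) ^ (1 / q) := by
    intro S
    rw [eLpNorm_eq_lintegral_rpow_enorm_toReal hq0 ENNReal.ofReal_ne_top,
      ENNReal.toReal_ofReal hq.le]
    gcongr
    exact hC S c
  have hcont : ∀ S : Finset κ, Continuous fun z => ∑ k ∈ S, c k * G (z - pt k) := fun S => by
    fun_prop
  refine ⟨fun k => ⟨(by fun_prop : Continuous fun z => c k * G (z - pt k)).aestronglyMeasurable,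
    ?_⟩, ?_⟩
  · have h1 := hbound {k}
    simp only [Finset.sum_singleton] at h1
    refine h1.trans_lt (ENNReal.rpow_lt_top_of_nonneg (by positivity)
      (ENNReal.mul_ne_top ENNReal.coe_ne_top (ENNReal.rpow_ne_top_of_nonneg hq.le enorm_ne_top)))
  · rw [ENNReal.tendsto_nhds_zero]
    intro ε hε
    rcases eq_or_ne ε ⊤ with rfl | hεt
    · exact Eventually.of_forall fun _ => le_top
    have hε' : 0 < ε.toReal := ENNReal.toReal_pos hε.ne' hεt
    set δ : ℝ := ε.toReal ^ q / (C + 1) with hδ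
    have hδ0 : 0 < δ := by positivity
    obtain ⟨T₀, hT₀⟩ := summable_iff_vanishing_norm.1 hc δ hδ0
    -- Fatou's lemma needs a sequence, so a cofinal sequence of finite sets is chosen; joining T
    -- makes each difference a sum over indices outside T, which the synthesis bound controls.
    obtain ⟨Tn, hTn⟩ := exists_seq_tendsto (atTop : Filter (Finset κ))
    filter_upwards [eventually_ge_atTop T₀] with T hT
    have hlim : ∀ z, Tendsto (fun n => ∑ k ∈ Tn n ∪ T, c k * G (z - pt k) -
        ∑ k ∈ T, c k * G (z - pt k)) atTop (𝓝 (f z - ∑ k ∈ T, c k * G (z - pt k))) := by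
      intro z
      have h1 : Tendsto (fun n => Tn n ∪ T) atTop atTop :=
        tendsto_atTop_mono (fun n => Finset.subset_union_left) hTn
      exact ((hf z).comp h1).sub_const _
    have hfat := Lp.eLpNorm_lim_le_liminf_eLpNorm (μ := volume) (p := ENNReal.ofReal q)
      (fun n => ((hcont (Tn n ∪ T)).sub (hcont T)).aestronglyMeasurable)
      _ (ae_of_all _ hlim)
    have hsymm : eLpNorm (fun z => ∑ k ∈ T, c k * G (z - pt k) - f z) (ENNReal.ofReal q) volume =
        eLpNorm (fun z => f z - ∑ k ∈ T, c k * G (z - pt k)) (ENNReal.ofReal q) volume :=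
      eLpNorm_congr_norm_ae (ae_of_all _ fun z => norm_sub_rev _ _)
    rw [hsymm]
    refine hfat.trans ?_
    refine liminf_le_of_frequently_le' (Frequently.of_forall fun n => ?_)
    have h2 : ∀ z, ∑ k ∈ Tn n ∪ T, c k * G (z - pt k) - ∑ k ∈ T, c k * G (z - pt k) =
        ∑ k ∈ (Tn n ∪ T) \ T, c k * G (z - pt k) := fun z => by
      rw [← Finset.sum_sdiff Finset.subset_union_right, add_sub_cancel_right]
    refine (eLpNorm_congr_ae (ae_of_all _ h2)).trans_le ((hbound _).trans ?_)
    rw [one_div, ENNReal.rpow_inv_le_iff hq]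
    have h3 : ∑ k ∈ (Tn n ∪ T) \ T, ‖c k‖ ^ q ≤ δ :=
      (le_abs_self _).trans (hT₀ _ (Finset.disjoint_of_subset_right hT Finset.sdiff_disjoint)).le
    have h4 : ∑ k ∈ (Tn n ∪ T) \ T, ‖c k‖ₑ ^ q = ENNReal.ofReal (∑ k ∈ (Tn n ∪ T) \ T, ‖c k‖ ^ q) := by
      rw [ENNReal.ofReal_sum_of_nonneg fun k _ => by positivity]
      refine Finset.sum_congr rfl fun k _ => ?_
      rw [← ENNReal.ofReal_rpow_of_nonneg (norm_nonneg _) hq.le, ofReal_norm]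
    calc _ ≤ (C : ℝ≥0∞) * ENNReal.ofReal δ := by
          rw [h4]
          gcongr
      _ ≤ ENNReal.ofReal (ε.toReal ^ q) := by
          rw [← ENNReal.ofReal_coe_nnreal, ← ENNReal.ofReal_mul (by positivity)]
          refine ENNReal.ofReal_le_ofReal ?_
          rw [hδ, mul_div_assoc', div_le_iff₀ (by positivity)]
          have : (0 : ℝ) ≤ ε.toReal ^ q := by positivity
          nlinarith
      _ = _ := by
          rw [← ENNReal.ofReal_rpow_of_nonneg hε'.le hq.le, ENNReal.ofReal_toReal hεt]

end TranslateSeries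


/-! ### The Fourier transform of sinc ∗ K and its jump at the boundary of the box. -/

section BoxSpectrum

set_option linter.unusedSectionVars false

variable {ι : Type*} [Fintype ι]

theorem measurableSet_gridBox (A : ι → ℝ) : MeasurableSet (gridBox A) :=
  (isCompact_gridBox A).isClosed.measurableSet

theorem zero_mem_gridBox {A : ι → ℝ} (hA : ∀ i, 0 < A i) : (0 : EuclideanSpace ℝ ι) ∈ gridBox A := by
  intro i
  have := hA i
  simp only [PiLp.zero_apply, abs_zero]
  positivity

theorem zero_mem_interior_gridBox {A : ι → ℝ} (hA : ∀ i, 0 < A i) :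
    (0 : EuclideanSpace ℝ ι) ∈ interior (gridBox A) := by
  have := smul_mem_interior_gridBox hA (r := 1 / 2) (by norm_num) (by norm_num)
    (zero_mem_gridBox hA)
  rwa [smul_zero] at this

/-- The corner of the box. -/
noncomputable def gridCorner (A : ι → ℝ) : EuclideanSpace ℝ ι := WithLp.toLp 2 fun i => 1 / (2 * A i)

theorem gridCorner_mem {A : ι → ℝ} (hA : ∀ i, 0 < A i) : gridCorner A ∈ gridBox A := by
  intro i
  have := hA i
  simp only [gridCorner]
  rw [abs_of_pos (by positivity)]

theorem smul_gridCorner_notMem [Nonempty ι] {A : ι → ℝ} (hA : ∀ i, 0 < A i) {r : ℝ} (hr : 1 < r) :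
    r • gridCorner A ∉ gridBox A := by
  intro h
  obtain ⟨i⟩ := ‹Nonempty ι›
  have h1 := h i
  have h2 : 0 < 1 / (2 * A i) := by have := hA i; positivity
  simp only [gridCorner, PiLp.smul_apply, smul_eq_mul] at h1
  rw [abs_of_pos (mul_pos (by linarith) h2)] at h1
  nlinarith

theorem tendsto_smul_of_tendsto_one {r : ℕ → ℝ} (hr : Tendsto r atTop (𝓝 1))
    (x : EuclideanSpace ℝ ι) : Tendsto (fun n => r n • x) atTop (𝓝 x) := by
  simpa using hr.smul_const x

theorem gridCorner_mem_closure_interior {A : ι → ℝ} (hA : ∀ i, 0 < A i) :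
    gridCorner A ∈ closure (interior (gridBox A)) := by
  have h1 : Tendsto (fun n : ℕ => (1 : ℝ) - 1 / ((n : ℝ) + 1 + 1)) atTop (𝓝 1) := by
    have := (tendsto_add_atTop_iff_nat 1).2 (tendsto_one_div_add_atTop_nhds_zero_nat (𝕜 := ℝ))
    simpa only [sub_zero, Nat.cast_add, Nat.cast_one] using
      (tendsto_const_nhds (x := (1 : ℝ))).sub this
  refine mem_closure_of_tendsto (tendsto_smul_of_tendsto_one h1 _) (Eventually.of_forall fun n => ?_)
  have h2 : (0 : ℝ) < 1 / ((n : ℝ) + 1 + 1) := by positivity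
  have h3 : (1 : ℝ) / ((n : ℝ) + 1 + 1) < 1 := by
    rw [div_lt_one (by positivity)]
    linarith [(Nat.cast_nonneg n : (0 : ℝ) ≤ n)]
  exact smul_mem_interior_gridBox hA (by linarith) (by linarith) (gridCorner_mem hA)

theorem gridCorner_mem_closure_compl [Nonempty ι] {A : ι → ℝ} (hA : ∀ i, 0 < A i) :
    gridCorner A ∈ closure (gridBox A)ᶜ := by
  have h1 : Tendsto (fun n : ℕ => (1 : ℝ) + 1 / ((n : ℝ) + 1)) atTop (𝓝 1) := by
    simpa only [add_zero] using
      (tendsto_const_nhds (x := (1 : ℝ))).add (tendsto_one_div_add_atTop_nhds_zero_nat (𝕜 := ℝ))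
  refine mem_closure_of_tendsto (tendsto_smul_of_tendsto_one h1 _) (Eventually.of_forall fun n => ?_)
  have h2 : (0 : ℝ) < 1 / ((n : ℝ) + 1) := by positivity
  exact smul_gridCorner_notMem hA (by linarith)

/-- The cardinal sine is a multiple of the inverse Fourier transform of the indicator function of
the box. -/
theorem exists_gridSinc_eq {A : ι → ℝ} (hA : ∀ i, 0 < A i) : ∃ c : ℂ, c ≠ 0 ∧
    gridSinc A = 𝓕⁻ ((gridBox A).indicator fun _ => c) := by
  obtain ⟨c, hc⟩ := exists_integral_eq_mul_integral_scaled hA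
  have key : ∀ z, 𝓕⁻ ((gridBox A).indicator fun _ => (1 : ℂ)) z = c * gridSinc A z := by
    intro z
    rw [Real.fourierInv_eq, hc]
    congr 1
    have hmem : ∀ u : ι → ℝ, (WithLp.toLp 2 fun i => u i / A i : EuclideanSpace ℝ ι) ∈ gridBox A ↔
        u ∈ Set.Icc (fun _ : ι => (-(1 / 2) : ℝ)) (fun _ => -(1 / 2) + 1) := by
      intro u
      simp only [gridBox, Set.mem_ofPred_eq, Set.mem_Icc, Pi.le_def, ← forall_and]
      refine forall_congr' fun i => ?_
      have hAi := hA i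
      rw [abs_div, abs_of_pos hAi, div_le_div_iff₀ hAi (by positivity), ← mul_assoc,
        mul_le_mul_iff_of_pos_right hAi, ← abs_two, ← abs_mul, abs_two, abs_le]
      constructor <;> rintro ⟨h1, h2⟩ <;> constructor <;> linarith
    have hcube : unitCube ι =ᵐ[volume]
        Set.Icc (fun _ : ι => (-(1 / 2) : ℝ)) (fun _ => -(1 / 2) + 1) := by
      have := Measure.univ_pi_Ioc_ae_eq_Icc (μ := fun _ : ι => (volume : Measure ℝ))
        (f := fun _ => (-(1 / 2) : ℝ)) (g := fun _ => -(1 / 2) + 1)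
      rwa [show Set.univ.pi (fun _ : ι => Set.Ioc (-(1 / 2) : ℝ) (-(1 / 2) + 1)) = unitCube ι by
        ext u; simp [unitCube]] at this
    have h1 := integral_unitCube_exp fun i => z i / A i
    rw [setIntegral_congr_set hcube, ← integral_indicator measurableSet_Icc] at h1
    have h2 : gridSinc A z = ∏ i, (Real.sinc (Real.pi * (z i / A i)) : ℂ) := by
      simp only [gridSinc, mul_div_assoc]
    rw [h2, ← h1]
    refine integral_congr_ae (ae_of_all _ fun u => ?_)
    simp only
    by_cases hu : u ∈ Set.Icc (fun _ : ι => (-(1 / 2) : ℝ)) (fun _ => -(1 / 2) + 1)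
    · rw [Set.indicator_of_mem hu, Set.indicator_of_mem ((hmem u).2 hu), Circle.smul_def,
        smul_eq_mul, mul_one, Real.fourierChar_apply]
      congr 1
      rw [PiLp.inner_apply]
      push_cast
      rw [mul_right_comm]
      congr 1
      refine Finset.sum_congr rfl fun i _ => ?_
      simp
      ring
    · rw [Set.indicator_of_notMem hu, Set.indicator_of_notMem (mt (hmem u).1 hu), smul_zero]
  -- At the origin the transform of the indicator function is the volume of the box, which is
  -- positive.
  have hc0 : c ≠ 0 := by
    rintro rfl
    have h1 := key 0
    rw [zero_mul, Real.fourierInv_eq] at h1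
    simp only [inner_zero_right, AddChar.map_zero_eq_one, one_smul] at h1
    rw [integral_indicator (measurableSet_gridBox A), setIntegral_const, smul_eq_zero] at h1
    have h2 : volume.real (gridBox A) ≠ 0 := by
      rw [measureReal_def, ENNReal.toReal_ne_zero]
      refine ⟨(Measure.measure_pos_of_mem_nhds volume
        (mem_interior_iff_mem_nhds.1 (zero_mem_interior_gridBox hA))).ne',
        (isCompact_gridBox A).measure_lt_top.ne⟩
    simp [h2] at h1
  refine ⟨c⁻¹, inv_ne_zero hc0, funext fun z => ?_⟩
  have h3 : ((gridBox A).indicator fun _ => c⁻¹) =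
      fun w => c⁻¹ * (gridBox A).indicator (fun _ => (1 : ℂ)) w := by
    funext w
    by_cases hw : w ∈ gridBox A <;> simp [hw]
  rw [h3, Real.fourierInv_eq]
  simp only [Circle.smul_def, smul_eq_mul, mul_left_comm _ c⁻¹]
  rw [integral_const_mul]
  have h4 := key z
  rw [Real.fourierInv_eq] at h4
  simp only [Circle.smul_def, smul_eq_mul] at h4
  rw [h4, inv_mul_cancel_left₀ hc0]

/-- The inverse transform of u need not be integrable, as for sinc, so the convolution theorem in L¹
is unavailable. The multiplication formula moves the inverse transform onto the reflected translate
of K instead. -/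
theorem cconv_fourierInv {V : Type*} [NormedAddCommGroup V] [InnerProductSpace ℝ V]
    [FiniteDimensional ℝ V] [MeasurableSpace V] [BorelSpace V] {u K : V → ℂ} (hu : Integrable u)
    (hK : Integrable K) : cconv (𝓕⁻ u) K = 𝓕⁻ fun w => u w * 𝓕 K w := by
  funext z
  have h1 : cconv (𝓕⁻ u) K z = ∫ y, 𝓕⁻ u y * K (z - y) := rfl
  rw [h1, integral_fourierInv_mul_eq hu (hK.comp_sub_left z), Real.fourierInv_eq]
  refine integral_congr_ae (ae_of_all _ fun w => ?_)
  simp only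
  have h2 : ∫ y, Real.fourierChar (inner ℝ y w) • K (z - y) =
      ∫ y, Real.fourierChar (inner ℝ (z - y) w) • K y := by
    rw [← integral_sub_left_eq_self (fun y : V => Real.fourierChar (inner ℝ (z - y) w) • K y) volume z]
    simp only [sub_sub_cancel]
  rw [Real.fourierInv_eq, Real.fourier_eq, h2]
  simp only [Circle.smul_def, smul_eq_mul]
  rw [mul_left_comm]
  congr 1
  rw [← integral_const_mul]
  refine integral_congr_ae (ae_of_all _ fun y => ?_)
  simp only
  rw [← mul_assoc, ← Circle.coe_mul, ← AddChar.map_add_eq_mul, inner_sub_left,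
    real_inner_comm w z, sub_eq_add_neg]

/-- The spectrum of `sinc ∗ K`. -/
theorem exists_cconv_gridSinc_eq {A : ι → ℝ} (hA : ∀ i, 0 < A i) {K : EuclideanSpace ℝ ι → ℂ}
    (hK : Integrable K) : ∃ c : ℂ, c ≠ 0 ∧
      Integrable ((gridBox A).indicator fun w => c * 𝓕 K w) ∧
      cconv (gridSinc A) K = 𝓕⁻ ((gridBox A).indicator fun w => c * 𝓕 K w) := by
  obtain ⟨c, hc, h⟩ := exists_gridSinc_eq hA
  have hi : Integrable ((gridBox A).indicator fun _ => c) :=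
    (integrable_indicator_iff (measurableSet_gridBox A)).2
      (integrableOn_const (isCompact_gridBox A).measure_lt_top.ne)
  refine ⟨c, hc, ?_, ?_⟩
  · refine (integrable_indicator_iff (measurableSet_gridBox A)).2 ?_
    exact ((continuous_const.mul (continuous_fourier hK)).continuousOn).integrableOn_compact
      (isCompact_gridBox A)
  · rw [h, cconv_fourierInv hi hK]
    congr 1
    funext w
    by_cases hw : w ∈ gridBox A <;> simp [hw]

/-- `sinc ∗ K` is not integrable: its Fourier transform is discontinuous. -/
theorem not_integrable_cconv_gridSinc [Nonempty ι] {A : ι → ℝ} (hA : ∀ i, 0 < A i)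
    {K : EuclideanSpace ℝ ι → ℂ} (hK : Integrable K) (hK0 : 𝓕 K (gridCorner A) ≠ 0) :
    ¬ Integrable (cconv (gridSinc A) K) := by
  intro hG
  obtain ⟨c, hc, hi, h⟩ := exists_cconv_gridSinc_eq hA hK
  have hae := fourier_fourierInv_ae hi (h ▸ hG)
  rw [← h] at hae
  have hcont := continuous_fourier hG
  have hcontK := continuous_fourier hK
  -- If sinc ∗ K were integrable, its continuous transform would equal c K̂ inside the box and 0
  -- outside, and both identities would extend to the corner, where K̂ ≠ 0.
  have h1 : Set.EqOn (𝓕 (cconv (gridSinc A) K)) (fun w => c * 𝓕 K w) (interior (gridBox A)) := by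
    refine Measure.eqOn_open_of_ae_eq (μ := volume) ?_ isOpen_interior hcont.continuousOn
      (by fun_prop)
    rw [EventuallyEq, ae_restrict_iff' isOpen_interior.measurableSet]
    filter_upwards [hae] with w hw hwi
    rw [hw, Set.indicator_of_mem (interior_subset hwi)]
  have h2 : Set.EqOn (𝓕 (cconv (gridSinc A) K)) (fun _ => 0) (gridBox A)ᶜ := by
    refine Measure.eqOn_open_of_ae_eq (μ := volume) ?_ (isCompact_gridBox A).isClosed.isOpen_compl
      hcont.continuousOn (by fun_prop)
    rw [EventuallyEq, ae_restrict_iff' (measurableSet_gridBox A).compl]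
    filter_upwards [hae] with w hw hwi
    rw [hw, Set.indicator_of_notMem hwi]
  have h3 := h1.closure hcont (by fun_prop) (gridCorner_mem_closure_interior hA)
  have h4 := h2.closure hcont (by fun_prop) (gridCorner_mem_closure_compl hA)
  simp only [h4] at h3
  exact mul_ne_zero hc hK0 h3.symm

theorem analyticOnNhd_trigPolynomial {κ : Type*} (T : Finset κ) (c : κ → ℂ)
    (x : κ → EuclideanSpace ℝ ι) : AnalyticOnNhd ℝ (fun w : EuclideanSpace ℝ ι =>
      ∑ k ∈ T, c k * ((Real.fourierChar (-inner ℝ (x k) w) : Circle) : ℂ)) Set.univ := by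
  have h : ∀ k ∈ T, AnalyticOnNhd ℝ (fun w : EuclideanSpace ℝ ι =>
      c k * ((Real.fourierChar (-inner ℝ (x k) w) : Circle) : ℂ)) Set.univ := by
    intro k _
    have h1 : ∀ w : EuclideanSpace ℝ ι, c k * ((Real.fourierChar (-inner ℝ (x k) w) : Circle) : ℂ) =
        c k * Complex.exp ((-(2 * Real.pi * Complex.I)) • Complex.ofRealCLM (innerSL ℝ (x k) w)) := by
      intro w
      rw [Real.fourierChar_apply]
      congr 2
      simp
      ring
    simp only [h1]
    have h2 : AnalyticOnNhd ℝ (fun w => (-(2 * Real.pi * Complex.I)) •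
        Complex.ofRealCLM (innerSL ℝ (x k) w)) Set.univ := by
      have h3 : AnalyticOnNhd ℝ (fun w => Complex.ofRealCLM (innerSL ℝ (x k) w)) Set.univ :=
        (Complex.ofRealCLM.comp (innerSL ℝ (x k))).analyticOnNhd _
      simp only [smul_eq_mul]
      exact analyticOnNhd_const.mul h3
    have h4 : AnalyticOnNhd ℝ Complex.exp Set.univ := fun z _ =>
      (analyticAt_cexp (z := z)).restrictScalars
    exact analyticOnNhd_const.mul (h4.comp h2 fun _ _ => Set.mem_univ _)
  have := Finset.analyticOnNhd_fun_sum T h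
  exact this

/-- A finite sum of translates of `sinc ∗ K` is not a function whose Fourier transform is a cutoff
function of the box. -/
theorem fourierInv_ne_finset_sum_cconv [Nonempty ι] {A : ι → ℝ} (hA : ∀ i, 0 < A i)
    {K : EuclideanSpace ℝ ι → ℂ} (hK : Integrable K) (hK0 : ∀ w ∈ gridBox A, 𝓕 K w ≠ 0)
    {f : EuclideanSpace ℝ ι → ℂ} (hf : Integrable f) (hf0 : 𝓕 f 0 ≠ 0)
    (hfs : tsupport (𝓕 f) ⊆ (fun w => (2 : ℝ) • w) ⁻¹' gridBox A) {κ : Type*} (T : Finset κ)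
    (c : κ → ℂ) (x : κ → EuclideanSpace ℝ ι) :
    f ≠ fun z => ∑ k ∈ T, c k * cconv (gridSinc A) K (z - x k) := by
  intro heq
  obtain ⟨b, hb, hi, h⟩ := exists_cconv_gridSinc_eq hA hK
  set H := (gridBox A).indicator fun w => b * 𝓕 K w with hH
  set P : EuclideanSpace ℝ ι → ℂ := fun w =>
    ∑ k ∈ T, c k * ((Real.fourierChar (-inner ℝ (x k) w) : Circle) : ℂ) with hP
  have hPa : AnalyticOnNhd ℝ P Set.univ := analyticOnNhd_trigPolynomial T c x
  have hPc : Continuous P := by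
    have := Real.continuous_fourierChar
    rw [hP]
    fun_prop
  have hPi : ∀ k, Integrable fun w => ((Real.fourierChar (-inner ℝ (x k) w) : Circle) : ℂ) * H w := by
    intro k
    have h1 : Continuous fun w : EuclideanSpace ℝ ι =>
        ((Real.fourierChar (-inner ℝ (x k) w) : Circle) : ℂ) := by
      have := Real.continuous_fourierChar
      fun_prop
    exact hi.bdd_mul (c := 1) h1.aestronglyMeasurable (ae_of_all _ fun w => (Circle.norm_coe _).le)
  have hPH : (fun w => P w * H w) = fun w => ∑ k ∈ T, c k *
      (((Real.fourierChar (-inner ℝ (x k) w) : Circle) : ℂ) * H w) := by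
    funext w
    rw [hP]
    simp only
    rw [Finset.sum_mul]
    exact Finset.sum_congr rfl fun k _ => mul_assoc _ _ _
  have hPHi : Integrable fun w => P w * H w := by
    rw [hPH]
    exact integrable_finsetSum _ fun k _ => (hPi k).const_mul _
  have hinv : 𝓕⁻ (fun w => P w * H w) = f := by
    rw [heq, hPH]
    funext z
    rw [Real.fourierInv_eq]
    have hsm : ∀ w, Real.fourierChar (inner ℝ w z) • ∑ k ∈ T, c k *
        (((Real.fourierChar (-inner ℝ (x k) w) : Circle) : ℂ) * H w) =
        ∑ k ∈ T, c k * (Real.fourierChar (inner ℝ w (z - x k)) • H w) := by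
      intro w
      rw [Finset.smul_sum]
      refine Finset.sum_congr rfl fun k _ => ?_
      simp only [Circle.smul_def, smul_eq_mul]
      rw [mul_left_comm, ← mul_assoc ((Real.fourierChar _ : Circle) : ℂ), ← Circle.coe_mul,
        ← AddChar.map_add_eq_mul, inner_sub_right, real_inner_comm w (x k), sub_eq_add_neg]
    simp only [hsm]
    have hmod : ∀ k, Integrable fun w => Real.fourierChar (inner ℝ w (z - x k)) • H w := by
      intro k
      have h1 : Continuous fun w : EuclideanSpace ℝ ι =>
          ((Real.fourierChar (inner ℝ w (z - x k)) : Circle) : ℂ) := by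
        have := Real.continuous_fourierChar
        fun_prop
      exact hi.bdd_mul (c := 1) h1.aestronglyMeasurable
        (ae_of_all _ fun w => (Circle.norm_coe _).le)
    rw [integral_finsetSum _ fun k _ => (hmod k).const_mul _]
    refine Finset.sum_congr rfl fun k _ => ?_
    rw [integral_const_mul, h, Real.fourierInv_eq]
  have hae := fourier_fourierInv_ae hPHi (hinv ▸ hf)
  rw [hinv] at hae
  have hfc := continuous_fourier hf
  have hKc := continuous_fourier hK
  have h1 : Set.EqOn (𝓕 f) (fun w => P w * (b * 𝓕 K w)) (interior (gridBox A)) := by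
    refine Measure.eqOn_open_of_ae_eq (μ := volume) ?_ isOpen_interior hfc.continuousOn
      (by fun_prop)
    rw [EventuallyEq, ae_restrict_iff' isOpen_interior.measurableSet]
    filter_upwards [hae] with w hw hwi
    rw [hw, hH, Set.indicator_of_mem (interior_subset hwi)]
  -- Three quarters of the way to the corner one is inside the box but outside the half-size box
  -- carrying f̂. There P b K̂ = 0 with b K̂ ≠ 0, so P vanishes near that point and, being analytic,
  -- everywhere; this contradicts f̂(0) ≠ 0.
  have hP0 : P = fun _ => 0 := by
    have hx1 : (3 / 4 : ℝ) • gridCorner A ∈ interior (gridBox A) :=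
      smul_mem_interior_gridBox hA (by norm_num) (by norm_num) (gridCorner_mem hA)
    have hx2 : (3 / 4 : ℝ) • gridCorner A ∈ (tsupport (𝓕 f))ᶜ := by
      intro hmem
      have := hfs hmem
      rw [Set.mem_preimage, smul_smul] at this
      exact smul_gridCorner_notMem hA (by norm_num) this
    refine hPa.eq_of_eventuallyEq (z₀ := (3 / 4 : ℝ) • gridCorner A) analyticOnNhd_const ?_
    filter_upwards [isOpen_interior.mem_nhds hx1,
      (isClosed_tsupport _).isOpen_compl.mem_nhds hx2] with w hw1 hw2
    have h2 := h1 hw1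
    simp only [image_eq_zero_of_notMem_tsupport hw2] at h2
    have h3 := (mul_eq_zero.1 h2.symm)
    exact h3.resolve_right (mul_ne_zero hb (hK0 w (interior_subset hw1)))
  have h2 := h1 (zero_mem_interior_gridBox hA)
  simp only [hP0, zero_mul] at h2
  exact hf0 h2

end BoxSpectrum

/-! ### The spectrum of a Schwartz function as an element of L¹. -/

section SpectralSupport

variable {V : Type*} [NormedAddCommGroup V] [InnerProductSpace ℝ V] [FiniteDimensional ℝ V]
  [MeasurableSpace V] [BorelSpace V]

theorem dsupport_fourier_toLp_subset (Φ : 𝓢(V, ℂ)) {C : Set V} (hC : IsClosed C)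
    (hΦ : ∀ w, w ∉ C → 𝓕 (Φ : V → ℂ) w = 0) : Distribution.dsupport
      (𝓕 ((Φ.toLp 1 volume : Lp ℂ 1 (volume : Measure V)) : 𝓢'(V, ℂ)) : 𝓢'(V, ℂ)) ⊆ C := by
  intro w hw
  by_contra hwC
  refine (Distribution.notMem_dsupport_iff w).2 ⟨Cᶜ, fun u hu => ?_, hC.isOpen_compl, hwC⟩ hw
  rw [TemperedDistribution.fourier_apply, Lp.toTemperedDistribution_apply]
  have h1 : ∫ y, (𝓕 u : 𝓢(V, ℂ)) y • (Φ.toLp 1 volume : Lp ℂ 1 (volume : Measure V)) y =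
      ∫ y, 𝓕 (u : V → ℂ) y * Φ y := by
    refine integral_congr_ae ?_
    filter_upwards [Φ.coeFn_toLp 1 volume] with y hy
    rw [hy, SchwartzMap.fourier_coe, smul_eq_mul]
  rw [h1, integral_fourier_mul_eq u.integrable Φ.integrable]
  refine integral_eq_zero_of_ae (ae_of_all _ fun y => ?_)
  simp only [Pi.zero_apply]
  by_cases hy : y ∈ C
  · rw [image_eq_zero_of_notMem_tsupport fun h => hu h hy, zero_mul]
  · rw [hΦ y hy, mul_zero]

end SpectralSupport

/-! ### Terms of a norm-convergent ordered series. -/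

section OrderedSums

/-- A term is the difference of two consecutive errors of partial sums, and these errors eventually
have finite norm. Neither f nor the terms are assumed to lie in L^q. -/
theorem exists_forall_memLp_of_tendsto {α κ : Type*} [MeasurableSpace α] {μ : Measure α}
    {q : ℝ≥0∞} (hq : 1 ≤ q) {u : κ → α → ℂ} {f : α → ℂ} (hu : ∀ k, AEStronglyMeasurable (u k) μ)
    (hf : AEStronglyMeasurable f μ) (e : ℕ ≃ κ)
    (h : Tendsto (fun N : ℕ => eLpNorm (fun z => ∑ n ∈ Finset.range N, u (e n) z - f z) q μ)
      atTop (𝓝 0)) : ∃ N₀, ∀ N, N₀ ≤ N → MemLp (u (e N)) q μ := by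
  obtain ⟨N₀, hN₀⟩ := eventually_atTop.1 (h.eventually_lt_const ENNReal.zero_lt_top)
  refine ⟨N₀, fun N hN => ⟨hu _, ?_⟩⟩
  have hm : ∀ N : ℕ, AEStronglyMeasurable (fun z => ∑ n ∈ Finset.range N, u (e n) z - f z) μ :=
    fun N => (Finset.aestronglyMeasurable_fun_sum _ fun n _ => hu (e n)).sub hf
  have he : u (e N) = (fun z => ∑ n ∈ Finset.range (N + 1), u (e n) z - f z) -
      fun z => ∑ n ∈ Finset.range N, u (e n) z - f z := by
    funext z
    simp only [Pi.sub_apply]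
    rw [Finset.sum_range_succ]
    ring
  rw [he]
  exact (eLpNorm_sub_le (hm _) (hm _) hq).trans_lt
    (ENNReal.add_lt_top.2 ⟨hN₀ _ (hN.trans (Nat.le_succ N)), hN₀ _ hN⟩)

end OrderedSums


/-! ### Translation to the lattice in the time-frequency plane. -/

section PhaseLattice

variable {d : ℕ}

/-- The steps of the lattice `a ℤ^d × b ℤ^d`. -/
def latticeSteps (d : ℕ) (a b : ℝ) : Fin d ⊕ Fin d → ℝ := Sum.elim (fun _ => a) fun _ => b

theorem latticeSteps_pos {a b : ℝ} (ha : 0 < a) (hb : 0 < b) (i : Fin d ⊕ Fin d) :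
    0 < latticeSteps d a b i := by
  cases i <;> simpa [latticeSteps]

theorem box_eq_gridBox (a b : ℝ) : (box a b : Set (Phase d)) = gridBox (latticeSteps d a b) := by
  ext w
  simp [box, gridBox, latticeSteps]

theorem latticeSinc_eq_gridSinc (a b : ℝ) :
    (latticeSinc a b : Phase d → ℂ) = gridSinc (latticeSteps d a b) := by
  funext z
  rw [latticeSinc, gridSinc, Fintype.prod_sum_type]
  push_cast
  rfl

/-- The indices of the lattice points, as integer vectors. -/
def indexEquiv (d : ℕ) : Index d ≃ (Fin d ⊕ Fin d → ℤ) :=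
  (Equiv.sumArrowEquivProdArrow (Fin d) (Fin d) ℤ).symm

theorem latticePoint_eq_gridPoint (a b : ℝ) (m : Index d) :
    latticePoint a b m = gridPoint (latticeSteps d a b) (indexEquiv d m) := by
  ext i
  cases i <;> rfl

theorem translatesBounded_latticeSinc {a b : ℝ} (ha : 0 < a) (hb : 0 < b) {q : ℝ} (hq : 1 < q) :
    TranslatesBounded (latticeSinc a b) (latticePoint (d := d) a b) q := by
  obtain ⟨D, -, hD⟩ := exists_sum_norm_gridSinc_rpow_le (latticeSteps_pos (d := d) ha hb) hq
  refine ⟨D, fun z S => ?_⟩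
  have := hD z (S.map (indexEquiv d).toEmbedding)
  simp only [Finset.sum_map, Equiv.coe_toEmbedding] at this
  simpa only [latticeSinc_eq_gridSinc, latticePoint_eq_gridPoint] using this

theorem synthesisBounded_latticeSinc {a b : ℝ} (ha : 0 < a) (hb : 0 < b) {q : ℝ} (hq : 1 < q) :
    SynthesisBounded (latticeSinc a b) (latticePoint (d := d) a b) q := by
  obtain ⟨C, hC⟩ := exists_lintegral_sum_mul_gridSinc_le (latticeSteps_pos (d := d) ha hb) hq
  refine ⟨C, fun S c => ?_⟩
  have := hC (S.map (indexEquiv d).toEmbedding) fun k => c ((indexEquiv d).symm k)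
  simp only [Finset.sum_map, Equiv.coe_toEmbedding, Equiv.symm_apply_apply] at this
  simpa only [latticeSinc_eq_gridSinc, latticePoint_eq_gridPoint] using this

theorem continuous_latticeSinc (a b : ℝ) : Continuous (latticeSinc a b : Phase d → ℂ) := by
  rw [latticeSinc_eq_gridSinc]
  exact continuous_gridSinc _

theorem norm_latticeSinc_le_one (a b : ℝ) (z : Phase d) : ‖latticeSinc a b z‖ ≤ 1 := by
  rw [latticeSinc_eq_gridSinc]
  exact norm_gridSinc_le_one _ z

end PhaseLattice

/-! ### Bounded functions: from L¹ to L^r, and uniform convergence as convergence in L^∞. -/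

section Bounded

/-- From |s|^r ≤ B^{r-1} |s|. This is how a symbol in L¹ enters the theory for exponents r > 1. -/
theorem memLp_of_memLp_one_of_bounded {α : Type*} [MeasurableSpace α] {μ : Measure α} {s : α → ℂ}
    (hs : MemLp s 1 μ) {B : ℝ} (hB : ∀ z, ‖s z‖ ≤ B) {r : ℝ} (hr : 1 ≤ r) :
    MemLp s (ENNReal.ofReal r) μ := by
  have hr0 : 0 < r := by linarith
  refine ⟨hs.1, ?_⟩
  have h1 := hs.2
  rw [eLpNorm_one_eq_lintegral_enorm] at h1
  rw [eLpNorm_lt_top_iff_lintegral_rpow_enorm_lt_top (by simpa using hr0) ENNReal.ofReal_ne_top,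
    ENNReal.toReal_ofReal hr0.le]
  calc _ ≤ ∫⁻ z, ENNReal.ofReal B ^ (r - 1) * ‖s z‖ₑ ∂μ := by
        refine lintegral_mono fun z => ?_
        have h2 : ‖s z‖ₑ ≤ ENNReal.ofReal B := by
          rw [← ofReal_norm]
          exact ENNReal.ofReal_le_ofReal (hB z)
        calc ‖s z‖ₑ ^ r = ‖s z‖ₑ ^ (r - 1) * ‖s z‖ₑ := by
              nth_rewrite 3 [← ENNReal.rpow_one ‖s z‖ₑ]
              rw [← ENNReal.rpow_add_of_nonneg _ _ (by linarith) (by norm_num), sub_add_cancel]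
          _ ≤ _ := by
              have : 0 ≤ r - 1 := by linarith
              gcongr
    _ = ENNReal.ofReal B ^ (r - 1) * ∫⁻ z, ‖s z‖ₑ ∂μ := by
        rw [lintegral_const_mul'' _ hs.1.enorm]
    _ < ⊤ := ENNReal.mul_lt_top
        (ENNReal.rpow_lt_top_of_nonneg (by linarith) ENNReal.ofReal_ne_top) h1

theorem seriesConvergesInLp_top {d : ℕ} {κ : Type*} {u : κ → Phase d → ℂ} {s σ : Phase d → ℂ}
    (hu : ∀ k, Continuous (u k)) (hb : ∀ k, ∃ B, ∀ z, ‖u k z‖ ≤ B)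
    (h : TendstoUniformly (fun (F : Finset κ) z => ∑ l ∈ F, u l z) s atTop)
    (hs : s =ᵐ[volume] σ) : SeriesConvergesInLp ⊤ u σ := by
  refine ⟨fun k => ?_, ?_⟩
  · obtain ⟨B, hB⟩ := hb k
    exact memLp_top_of_bound (hu k).aestronglyMeasurable B (ae_of_all _ hB)
  · rw [ENNReal.tendsto_nhds_zero]
    intro ε hε
    obtain ⟨δ, hδ0, hδ⟩ := ENNReal.lt_iff_exists_nnreal_btwn.1 hε
    have hδ0' : (0 : ℝ) < δ := by exact_mod_cast hδ0
    filter_upwards [Metric.tendstoUniformly_iff.1 h δ hδ0'] with F hF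
    have h1 : eLpNorm (fun z => ∑ i ∈ F, u i z - σ z) ⊤ volume =
        eLpNorm (fun z => ∑ i ∈ F, u i z - s z) ⊤ volume := by
      refine eLpNorm_congr_ae ?_
      filter_upwards [hs] with z hz
      rw [hz]
    rw [h1, eLpNorm_exponent_top]
    refine (eLpNormEssSup_le_of_ae_bound (C := δ) (ae_of_all _ fun z => ?_)).trans
      ((ENNReal.ofReal_coe_nnreal).trans_le hδ.le)
    rw [← dist_eq_norm, dist_comm]
    exact (hF z).le

end Bounded

/-! ### Assembly of the reconstruction theorem and of the counterexample. -/

section Reconstruction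

variable {d : ℕ} {a b : ℝ} {g : Config d → ℂ} {φ : Phase d → ℂ}

theorem continuous_sincConvK (a b : ℝ) (hK : Integrable (kernelK g φ)) :
    Continuous (sincConvK a b g φ) :=
  continuous_cconv (continuous_latticeSinc a b) (norm_latticeSinc_le_one a b) hK

theorem continuous_seriesTerm (a b : ℝ) (hK : Integrable (kernelK g φ)) (σ : Phase d → ℂ)
    (l : Index d) : Continuous (seriesTerm a b g φ σ l) :=
  continuous_const.mul ((continuous_sincConvK a b hK).comp (continuous_id.sub continuous_const))

/-- The continuous representative of a bandlimited symbol, its channel matrix coefficients and the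
pointwise reconstruction. -/
theorem exists_representative_hasSum (ha : 0 < a) (hb : 0 < b) (hg : Integrable g)
    (hg' : Integrable (𝓕 g)) (hφ : ContDiff ℝ ∞ φ) (hφc : HasCompactSupport φ)
    (hφ1 : ∀ w ∈ box a b, φ w = 1) (hφ0 : ∀ w ∈ tsupport φ, conj (swapU (stft g g) w) ≠ 0)
    {p : ℝ≥0∞} [Fact (1 ≤ p)] (hp : p ≠ ⊤) (σ : Lp ℂ p (volume : Measure (Phase d)))
    (hσ : Distribution.dsupport (𝓕 (σ : 𝓢'(Phase d, ℂ)) : 𝓢'(Phase d, ℂ)) ⊆ box a b) :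
    ∃ (s : Phase d → ℂ) (B : ℝ), Continuous s ∧ (∀ z, ‖s z‖ ≤ B) ∧ s =ᵐ[volume] σ ∧
      ∀ r : ℝ, 1 < r → MemLp s (ENNReal.ofReal r) →
        (Summable fun l => ‖channelMatrix a b g σ l l‖ ^ r) ∧
        ∀ z, HasSum (fun l => seriesTerm a b g φ σ l z) (s z) := by
  have hA := latticeSteps_pos (d := d) ha hb
  rw [box_eq_gridBox] at hσ
  obtain ⟨s, B, hsc, hB, hsσ, hrep⟩ := exists_continuous_representative hp σ
    (isCompact_gridBox _) (fun r hr hr1 x hx => smul_mem_interior_gridBox hA hr hr1 hx) hσ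
  refine ⟨s, B, hsc, hB, hsσ, fun r hr hsr => ?_⟩
  set ρ : Phase d → ℂ := fun z => conj (rihaczek g g (-z)) with hρdef
  have hρ : Integrable ρ := integrable_conj_comp_neg (integrable_rihaczek hg hg')
  obtain ⟨-, -, hK, hFK⟩ := kernelK_spec hg hg' hφ hφc hφ0
  obtain ⟨Φ, hΦ⟩ := exists_schwartz_fourier_eq hφ hφc
  have hΦ1 : ∀ w ∈ gridBox (latticeSteps d a b), 𝓕 (Φ : Phase d → ℂ) w = 1 := by
    rw [← box_eq_gridBox]
    intro w hw
    rw [hΦ, hφ1 w hw]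
  set F := cconv s ρ with hF
  -- Here ρ̂ K̂ = φ everywhere: off the zeros of φ the denominators cancel, and at the zeros both
  -- sides vanish.
  have hinv : cconv F (kernelK g φ) = s := by
    refine cconv_cconv_eq_self hsc hB hρ hK (hrep Φ hΦ1) fun w => ?_
    rw [hFK, hΦ, fourier_conj_rihaczek_comp_neg hg hg', quotientSymbol]
    by_cases hw : φ w = 0
    · rw [hw, zero_div, mul_zero]
    · exact mul_div_cancel₀ _ (hφ0 w (subset_tsupport _ hw))
  have hFc : Continuous F := continuous_cconv hsc hB hρ
  have hFp : MemLp F (ENNReal.ofReal r) := memLp_cconv hsc hB hρ hr.le hsr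
  have hFrep : ∀ Ψ : 𝓢(Phase d, ℂ), (∀ w ∈ gridBox (latticeSteps d a b),
      𝓕 (Ψ : Phase d → ℂ) w = 1) → ∀ z, F z = ∫ y, F y * Ψ (z - y) := fun Ψ hΨ z =>
    (congrFun (cconv_schwartz_eq_of_cconv hsc hB hρ (hrep Ψ hΨ)) z).symm
  obtain ⟨hsum, hhas⟩ := hasSum_sample_mul_gridSinc hA hFc (norm_cconv_le hB hρ) hFrep hr hFp
  have hH : ∀ l : Index d, channelMatrix a b g σ l l = F (latticePoint a b l) := by
    intro l
    rw [channelMatrix_diag]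
    refine integral_congr_ae ?_
    filter_upwards [hsσ] with z hz
    rw [hz]
  have hsum' : Summable fun l : Index d => ‖channelMatrix a b g σ l l‖ ^ r := by
    rw [← (indexEquiv d).summable_iff] at hsum
    refine hsum.congr fun l => ?_
    simp only [Function.comp, hH, latticePoint_eq_gridPoint]
  refine ⟨hsum', fun z => ?_⟩
  have hpq := Real.HolderConjugate.conjExponent hr
  have := hasSum_mul_cconv (continuous_latticeSinc a b) (norm_latticeSinc_le_one a b) hK hpq
    (translatesBounded_latticeSinc (d := d) ha hb hpq.symm.lt) hsum' (F := F) (fun x => ?_) z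
  · rw [hinv] at this
    exact this
  · have h1 := hhas x
    rw [← (indexEquiv d).hasSum_iff] at h1
    refine h1.congr_fun fun l => ?_
    simp only [Function.comp, hH, latticePoint_eq_gridPoint, latticeSinc_eq_gridSinc]

theorem seriesConvergesInLp_of_hasSum (ha : 0 < a) (hb : 0 < b) (hK : Integrable (kernelK g φ))
    {s σ : Phase d → ℂ} (hs : s =ᵐ[volume] σ) {r : ℝ} (hr : 1 < r)
    (hc : Summable fun l => ‖channelMatrix a b g σ l l‖ ^ r)
    (hsum : ∀ z, HasSum (fun l => seriesTerm a b g φ σ l z) (s z)) :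
    SeriesConvergesInLp (ENNReal.ofReal r) (seriesTerm a b g φ σ) σ := by
  obtain ⟨h1, h2⟩ := memLp_and_tendsto_eLpNorm (continuous_sincConvK a b hK) (by linarith)
    (synthesisBounded_cconv (continuous_latticeSinc a b) (norm_latticeSinc_le_one a b) hK hr.le
      (synthesisBounded_latticeSinc ha hb hr)) hc hsum
  refine ⟨h1, h2.congr fun S => eLpNorm_congr_ae ?_⟩
  filter_upwards [hs] with z hz
  rw [hz]
  rfl

theorem fourier_kernelK_ne_zero (hφ1 : ∀ w ∈ box a b, φ w = 1)
    (hφ0 : ∀ w ∈ tsupport φ, conj (swapU (stft g g) w) ≠ 0)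
    (hFK : 𝓕 (kernelK g φ) = quotientSymbol g φ) (w : Phase d)
    (hw : w ∈ gridBox (latticeSteps d a b)) : 𝓕 (kernelK g φ) w ≠ 0 := by
  rw [← box_eq_gridBox] at hw
  have h1 : φ w ≠ 0 := by rw [hφ1 w hw]; exact one_ne_zero
  rw [hFK, quotientSymbol]
  exact div_ne_zero h1 (hφ0 w (subset_tsupport _ h1))

/-- The series does not converge in `L^1` unless it is a finite sum. -/
theorem not_someOrderingConvergesInLp_one (hd : 0 < d) (ha : 0 < a) (hb : 0 < b)
    (hK : Integrable (kernelK g φ))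
    (hK0 : ∀ w ∈ gridBox (latticeSteps d a b), 𝓕 (kernelK g φ) w ≠ 0) {σ : Phase d → ℂ}
    (hσ : AEStronglyMeasurable σ volume)
    (hinf : {l | channelMatrix a b g σ l l ≠ 0}.Infinite) :
    ¬ SomeOrderingConvergesInLp 1 (seriesTerm a b g φ σ) σ := by
  rintro ⟨e, he⟩
  have hne : Nonempty (Fin d ⊕ Fin d) := ⟨Sum.inl ⟨0, hd⟩⟩
  have hA := latticeSteps_pos (d := d) ha hb
  obtain ⟨N₀, hN₀⟩ := exists_forall_memLp_of_tendsto le_rfl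
    (fun l => (continuous_seriesTerm a b hK σ l).aestronglyMeasurable) hσ e he
  obtain ⟨N, hN, hcN⟩ : ∃ N, N₀ ≤ N ∧ channelMatrix a b g σ (e N) (e N) ≠ 0 := by
    by_contra! hcon
    refine hinf (((Finset.range N₀).image e).finite_toSet.subset fun l hl => ?_)
    rw [Finset.mem_coe, Finset.mem_image]
    refine ⟨e.symm l, ?_, e.apply_symm_apply l⟩
    rw [Finset.mem_range]
    by_contra! hle
    exact hl (by simpa using hcon _ hle)
  have h1 : Integrable (seriesTerm a b g φ σ (e N)) := memLp_one_iff_integrable.1 (hN₀ N hN)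
  have h2 : Integrable fun z => sincConvK a b g φ (z - latticePoint a b (e N)) :=
    (h1.const_mul (channelMatrix a b g σ (e N) (e N))⁻¹).congr
      (ae_of_all _ fun z => inv_mul_cancel_left₀ hcN _)
  have h3 : Integrable (sincConvK a b g φ) := by
    refine (h2.comp_add_right (latticePoint a b (e N))).congr (ae_of_all _ fun z => ?_)
    simp only [add_sub_cancel_right]
  refine not_integrable_cconv_gridSinc hA hK (hK0 _ (gridCorner_mem hA)) ?_
  rw [← latticeSinc_eq_gridSinc]
  exact h3

/-- Reconstruction of a bandlimited symbol in `L^p` from the diagonal of its channel matrix. -/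
theorem reconstruction (hd : 0 < d) (ha : 0 < a) (hb : 0 < b) (hg : Integrable g)
    (hg' : Integrable (𝓕 g)) (hφ : ContDiff ℝ ∞ φ) (hφc : HasCompactSupport φ)
    (hφ1 : ∀ w ∈ box a b, φ w = 1) (hφ0 : ∀ w ∈ tsupport φ, conj (swapU (stft g g) w) ≠ 0)
    (p : ℝ≥0∞) [hp1 : Fact (1 ≤ p)] (hp : p ≠ ⊤) (σ : Lp ℂ p (volume : Measure (Phase d)))
    (hσ : Distribution.dsupport (𝓕 (σ : 𝓢'(Phase d, ℂ)) : 𝓢'(Phase d, ℂ)) ⊆ box a b) :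
    (∀ l m : Index d, Integrable (fun z => σ z *
      conj (rihaczek (tfShift (latticePoint a b l) g) (tfShift (latticePoint a b m) g) z))
        volume) ∧
    (∃ s : Phase d → ℂ, Continuous s ∧ s =ᵐ[volume] σ ∧
      (∀ z, Summable fun l => ‖seriesTerm a b g φ σ l z‖) ∧
      (∀ z, HasSum (fun l => seriesTerm a b g φ σ l z) (s z)) ∧
      TendstoUniformly (fun (F : Finset (Index d)) z => ∑ l ∈ F, seriesTerm a b g φ σ l z)
        s atTop) ∧
    (1 < p → SeriesConvergesInLp p (seriesTerm a b g φ σ) σ) ∧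
    (p = 1 →
      (∀ q : ℝ≥0∞, 1 < q → SeriesConvergesInLp q (seriesTerm a b g φ σ) σ) ∧
      ({l | channelMatrix a b g σ l l ≠ 0}.Infinite →
        ¬ SomeOrderingConvergesInLp 1 (seriesTerm a b g φ σ) σ)) := by
  obtain ⟨-, -, hK, hFK⟩ := kernelK_spec hg hg' hφ hφc hφ0
  obtain ⟨s, B, hsc, hB, hsσ, hr⟩ := exists_representative_hasSum ha hb hg hg' hφ hφc hφ1 hφ0 hp σ hσ
  have hsp : MemLp s p := (Lp.memLp σ).ae_eq hsσ.symm
  have hofReal : ∀ q : ℝ≥0∞, 1 < q → q ≠ ⊤ → ∃ r : ℝ, 1 < r ∧ q = ENNReal.ofReal r := by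
    intro q hq hqt
    refine ⟨q.toReal, ?_, (ENNReal.ofReal_toReal hqt).symm⟩
    rw [← ENNReal.toReal_one]
    exact (ENNReal.toReal_lt_toReal ENNReal.one_ne_top hqt).2 hq
  -- The sampling theorem needs an exponent above 1: p itself if p > 1, and 2 if p = 1, as s is
  -- bounded.
  obtain ⟨r, hr1, hsr⟩ : ∃ r : ℝ, 1 < r ∧ MemLp s (ENNReal.ofReal r) := by
    rcases hp1.out.eq_or_lt with h | h
    · subst h
      exact ⟨2, by norm_num, memLp_of_memLp_one_of_bounded hsp hB (by norm_num)⟩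
    · obtain ⟨r, hr1, rfl⟩ := hofReal p h hp
      exact ⟨r, hr1, hsp⟩
  obtain ⟨hsum, hhas⟩ := hr r hr1 hsr
  have hpq := Real.HolderConjugate.conjExponent hr1
  obtain ⟨M, hM, hMb⟩ := exists_sum_norm_mul_cconv_le (continuous_latticeSinc a b)
    (norm_latticeSinc_le_one a b) hK hpq (translatesBounded_latticeSinc (d := d) ha hb hpq.symm.lt)
  obtain ⟨habs, hunif⟩ := summable_and_tendstoUniformly_of_sum_norm_le
    (u := seriesTerm a b g φ σ) (f := s) (a := fun l => ‖channelMatrix a b g σ l l‖ ^ r)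
    (one_div_pos.2 hpq.pos) hM (fun l => by positivity) hsum
    (fun S z => hMb (fun l => channelMatrix a b g σ l l) S z) hhas
  refine ⟨fun l m => ?_, ⟨s, hsc, hsσ, habs, hhas, hunif⟩, fun h => ?_, fun h => ⟨fun q hq => ?_, ?_⟩⟩
  · have h1 := integrable_rihaczek (integrable_tfShift hg (latticePoint a b l))
      (integrable_fourier_tfShift hg' (latticePoint a b m))
    refine (Complex.conjCLE.integrable_comp_iff.2 h1).bdd_mul (c := B) (Lp.memLp σ).1 ?_
    filter_upwards [hsσ] with z hz
    rw [← hz]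
    exact hB z
  · obtain ⟨t, ht1, rfl⟩ := hofReal p h hp
    exact seriesConvergesInLp_of_hasSum ha hb hK hsσ ht1 (hr t ht1 hsp).1 hhas
  · subst h
    by_cases hqt : q = ⊤
    · subst hqt
      refine seriesConvergesInLp_top (fun l => continuous_seriesTerm a b hK σ l) (fun l => ?_)
        hunif hsσ
      refine ⟨‖channelMatrix a b g σ l l‖ * (1 * ∫ y, ‖kernelK g φ y‖), fun z => ?_⟩
      rw [seriesTerm, norm_mul]
      exact mul_le_mul_of_nonneg_left (norm_cconv_le (norm_latticeSinc_le_one a b) hK _)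
        (norm_nonneg _)
    · obtain ⟨t, ht1, rfl⟩ := hofReal q hq hqt
      exact seriesConvergesInLp_of_hasSum ha hb hK hsσ ht1
        (hr t ht1 (memLp_of_memLp_one_of_bounded hsp hB ht1.le)).1 hhas
  · exact not_someOrderingConvergesInLp_one hd ha hb hK
      (fourier_kernelK_ne_zero hφ1 hφ0 hFK) (Lp.memLp σ).1

/-- A bandlimited symbol in `L^1` whose series does not converge in `L^1`. -/
theorem exists_not_someOrderingConvergesInLp_one (hd : 0 < d) (ha : 0 < a) (hb : 0 < b)
    (hg : Integrable g) (hg' : Integrable (𝓕 g)) (hφ : ContDiff ℝ ∞ φ) (hφc : HasCompactSupport φ)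
    (hφ1 : ∀ w ∈ box a b, φ w = 1) (hφ0 : ∀ w ∈ tsupport φ, conj (swapU (stft g g) w) ≠ 0) :
    ∃ σ : Lp ℂ 1 (volume : Measure (Phase d)),
      Distribution.dsupport (𝓕 (σ : 𝓢'(Phase d, ℂ)) : 𝓢'(Phase d, ℂ)) ⊆ box a b ∧
      ¬ SomeOrderingConvergesInLp 1 (seriesTerm a b g φ σ) σ := by
  have hne : Nonempty (Fin d ⊕ Fin d) := ⟨Sum.inl ⟨0, hd⟩⟩
  have hA := latticeSteps_pos (d := d) ha hb
  obtain ⟨-, -, hK, hFK⟩ := kernelK_spec hg hg' hφ hφc hφ0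
  have hK0 := fourier_kernelK_ne_zero hφ1 hφ0 hFK
  -- The symbol has a smooth transform supported in the half-size box and equal to 1 at the origin.
  obtain ⟨η, hη, hηc, hηs, hη1⟩ := exists_contDiff_eq_one_tsupport_subset
    (K := {(0 : Phase d)}) (U := (fun w => (2 : ℝ) • w) ⁻¹' interior (gridBox (latticeSteps d a b)))
    isCompact_singleton (isOpen_interior.preimage (by fun_prop)) (by
      rw [Set.singleton_subset_iff, Set.mem_preimage, smul_zero]
      exact zero_mem_interior_gridBox hA)
  obtain ⟨Φ, hΦ⟩ := exists_schwartz_fourier_eq hη hηc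
  have hspec : Distribution.dsupport
      (𝓕 ((Φ.toLp 1 volume : Lp ℂ 1 (volume : Measure (Phase d))) : 𝓢'(Phase d, ℂ)) :
        𝓢'(Phase d, ℂ)) ⊆ box a b := by
    rw [box_eq_gridBox]
    refine dsupport_fourier_toLp_subset Φ (isCompact_gridBox _).isClosed fun w hw => ?_
    rw [hΦ]
    by_contra h0
    have h1 := interior_subset (hηs (subset_tsupport _ h0))
    refine hw ?_
    intro i
    have h2 := h1 i
    simp only [PiLp.smul_apply, smul_eq_mul, abs_mul, abs_two] at h2
    linarith [abs_nonneg (w i)]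
  refine ⟨Φ.toLp 1 volume, hspec, fun hconv => ?_⟩
  obtain ⟨-, ⟨s, hsc, hsσ, -, hhas, -⟩, -, hone⟩ :=
    reconstruction hd ha hb hg hg' hφ hφc hφ1 hφ0 1 ENNReal.one_ne_top (Φ.toLp 1 volume) hspec
  -- Convergence in L¹ would leave only finitely many nonzero coefficients, making the symbol a
  -- finite sum of translates of sinc ∗ K, which its spectrum forbids.
  have hfin : {l | channelMatrix a b g (Φ.toLp 1 volume : Lp ℂ 1 (volume : Measure (Phase d)))
      l l ≠ 0}.Finite := by
    by_contra hinf
    exact (hone rfl).2 hinf hconv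
  have hsΦ : s = Φ := (Continuous.ae_eq_iff_eq volume hsc Φ.continuous).1
    (hsσ.trans (Φ.coeFn_toLp 1 volume))
  refine fourierInv_ne_finset_sum_cconv hA hK hK0 Φ.integrable
    (by rw [hΦ, hη1 0 rfl]; exact one_ne_zero)
    (by rw [hΦ]; exact hηs.trans (Set.preimage_mono interior_subset)) hfin.toFinset
    (fun l => channelMatrix a b g (Φ.toLp 1 volume : Lp ℂ 1 (volume : Measure (Phase d))) l l)
    (fun l => latticePoint a b l) (funext fun z => ?_)
  rw [← hsΦ]
  refine (hhas z).unique ?_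
  rw [← latticeSinc_eq_gridSinc]
  refine hasSum_sum_of_ne_finset_zero fun l hl => ?_
  have : channelMatrix a b g (Φ.toLp 1 volume : Lp ℂ 1 (volume : Measure (Phase d))) l l = 0 := by
    simpa using hl
  rw [seriesTerm, this, zero_mul]

end Reconstruction

end KohnNirenberg

/-! ### The main theorem. -/

theorem theorem2 {d : ℕ} (hd : 0 < d) {a b : ℝ} (ha : 0 < a) (hb : 0 < b)
    (g : Config d → ℂ) (hg : Integrable g volume) (hg' : Integrable (𝓕 g) volume)
    (φ : Phase d → ℂ) (hφ : ContDiff ℝ ∞ φ) (hφc : HasCompactSupport φ)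
    (hφ1 : ∀ w ∈ box a b, φ w = 1)
    (hφ0 : ∀ w ∈ tsupport φ, conj (swapU (stft g g) w) ≠ 0) :
    -- the kernel `K` and the convolution `sinc ∗ K` are well defined
    (Integrable (quotientSymbol g φ) volume ∧
      ConvolutionExists (latticeSinc a b) (kernelK g φ) (ContinuousLinearMap.mul ℂ ℂ) volume) ∧
    -- the reconstruction formula for all bandlimited symbols in `L^p`, `1 ≤ p < ∞`
    (∀ (p : ℝ≥0∞) [Fact (1 ≤ p)], p ≠ ⊤ → ∀ σ : Lp ℂ p (volume : Measure (Phase d)),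
      Distribution.dsupport (𝓕 (σ : 𝓢'(Phase d, ℂ)) : 𝓢'(Phase d, ℂ)) ⊆ box a b →
      -- the integrals defining the channel matrix converge absolutely
      (∀ l m : Index d, Integrable (fun z => σ z *
        conj (rihaczek (tfShift (latticePoint a b l) g) (tfShift (latticePoint a b m) g) z))
          volume) ∧
      -- absolute and uniform convergence to the continuous representative of `σ`
      (∃ s : Phase d → ℂ, Continuous s ∧ s =ᵐ[volume] σ ∧
        (∀ z, Summable fun l => ‖seriesTerm a b g φ σ l z‖) ∧
        (∀ z, HasSum (fun l => seriesTerm a b g φ σ l z) (s z)) ∧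
        TendstoUniformly (fun (F : Finset (Index d)) z => ∑ l ∈ F, seriesTerm a b g φ σ l z)
          s atTop) ∧
      -- convergence in `L^p` for `1 < p`
      (1 < p → SeriesConvergesInLp p (seriesTerm a b g φ σ) σ) ∧
      -- for `p = 1`, convergence in `L^q` for `1 < q`, and no convergence in `L^1` unless the
      -- series is a finite sum
      (p = 1 →
        (∀ q : ℝ≥0∞, 1 < q → SeriesConvergesInLp q (seriesTerm a b g φ σ) σ) ∧
        ({l | channelMatrix a b g σ l l ≠ 0}.Infinite →
          ¬ SomeOrderingConvergesInLp 1 (seriesTerm a b g φ σ) σ))) ∧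
    -- the series fails to converge in `L^1` for some bandlimited symbol in `L^1`
    (∃ σ : Lp ℂ 1 (volume : Measure (Phase d)),
      Distribution.dsupport (𝓕 (σ : 𝓢'(Phase d, ℂ)) : 𝓢'(Phase d, ℂ)) ⊆ box a b ∧
      ¬ SomeOrderingConvergesInLp 1 (seriesTerm a b g φ σ) σ) := by
  obtain ⟨hq, -, hK, -⟩ := kernelK_spec hg hg' hφ hφc hφ0
  exact ⟨⟨hq, fun z => integrable_bounded_mul_sub (continuous_latticeSinc a b)
      (norm_latticeSinc_le_one a b) hK z⟩,
    fun p _ hp σ hσ => reconstruction hd ha hb hg hg' hφ hφc hφ1 hφ0 p hp σ hσ,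
    exists_not_someOrderingConvergesInLp_one hd ha hb hg hg' hφ hφc hφ1 hφ0⟩
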